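/- Let $0\le m\le n$. An $m\to n$ isometry is a $2^n\times 2^m$ complex matrix $V$ with $V^\dagger V=I$. A circuit on $n$ qubits is a finite sequence of single-qubit unitaries and C-NOT gates (between any two distinct qubits) with total unitary $U$. It implements $V$ if $U\,I_{2^n\times 2^m}=e^{\mathrm i\theta}V$ for some real $\theta$, where $I_{2^n\times 2^m}$ denotes the first $2^m$ columns of the identity matrix (the $n-m$ most significant qubits start in $|0\rangle$). A circuit topology is a circuit in which the single-qubit gates are left free (their positions and the C-NOT gates are fixed). It generates all $m\to n$ isometries if every $m\to n$ isometry is implemented by the topology for a suitable choice of its single-qubit gates. For each pair $(m,n)$ in the following table there is a circuit topology with at most the indicated number of C-NOT gates that generates all $m\to n$ isometries: $$\begin{array}{c|ccccc} n\backslash m&0&1&2&3&4\\\hline 2&1&2&3&-&-\\ 3&3&9&14&20&-\\ 4&8&22&54&73&100\end{array}$$ Moreover, the count $2$ for $1\to2$ isometries meets the lower bound $\lceil\frac14(2^{n+m+1}-2^{2m}-2n-m-1)\rceil$, which equals $2$ for $m=1$, $n=2$, and it is optimal: $2$ is the least number of C-NOT gates in a circuit topology that generates all $1\to 2$ isometries.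 Indeed, some $1\to2$ isometry is not implemented by any circuit with fewer than two C-NOT gates. -/

import Mathlib

open scoped Matrix

/-- Labels of the computational basis states of an `n`-qubit register. The bit `b i` is the one of
weight `2 ^ i`, so that `b` is the state `|b (n-1) … b 1 b 0⟩`. -/
abbrev BitString (n : ℕ) : Type := Fin n → Fin 2

/-- An `m` to `n` isometry, as a `2 ^ n × 2 ^ m` complex matrix `V` with `V† V = I`. -/
def IsQubitIsometry {m n : ℕ} (V : Matrix (BitString n) (BitString m) ℂ) : Prop :=
  Vᴴ * V = 1

/-- The matrix on `n` qubits of the single-qubit operation `U` applied to the qubit `j`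
(that is, `U` on the tensor factor `j` and the identity on all the others). -/
def singleQubitMatrix {n : ℕ} (j : Fin n) (U : Matrix (Fin 2) (Fin 2) ℂ) :
    Matrix (BitString n) (BitString n) ℂ :=
  Matrix.of fun b b' => if ∀ i, i ≠ j → b i = b' i then U (b j) (b' j) else 0

/-- The matrix on `n` qubits of the controlled-NOT gate with control `c` and target `t`:
the basis state `b'` goes to the one in which the bit `t` is replaced by `b' t + b' c` (mod 2). -/
def cnotMatrix {n : ℕ} (c t : Fin n) : Matrix (BitString n) (BitString n) ℂ :=
  Matrix.of fun b b' => if b = Function.update b' t (b' t + b' c) then 1 else 0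

/-- The gate library: arbitrary single-qubit unitaries and controlled-NOT gates between any two
distinct qubits of an `n`-qubit register. -/
inductive QGate (n : ℕ) : Type
  | single (j : Fin n) (U : Matrix.unitaryGroup (Fin 2) ℂ) : QGate n
  | cnot (c t : Fin n) (h : c ≠ t) : QGate n

/-- The unitary matrix performed by a gate. -/
def QGate.toMatrix {n : ℕ} : QGate n → Matrix (BitString n) (BitString n) ℂ
  | .single j U => singleQubitMatrix j (U : Matrix (Fin 2) (Fin 2) ℂ)
  | .cnot c t _ => cnotMatrix c t

/-- A circuit is a finite sequence of gates, listed in the order of time. -/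
abbrev QCircuit (n : ℕ) : Type := List (QGate n)

/-- The operation performed by a circuit; the head of the list acts first. -/
def QCircuit.toMatrix {n : ℕ} : QCircuit n → Matrix (BitString n) (BitString n) ℂ
  | [] => 1
  | g :: C => QCircuit.toMatrix C * g.toMatrix

/-- A place of a circuit topology: a free single-qubit gate on a given qubit, or a fixed
controlled-NOT gate. -/
inductive QSlot (n : ℕ) : Type
  | free (j : Fin n) : QSlot n
  | cnot (c t : Fin n) (h : c ≠ t) : QSlot n

/-- Is the place occupied by a controlled-NOT gate? -/
def QSlot.isCnot {n : ℕ} : QSlot n → Bool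
  | .free _ => false
  | .cnot _ _ _ => true

/-- A circuit topology: a circuit whose single-qubit gates are left unspecified. -/
abbrev QTopology (n : ℕ) : Type := List (QSlot n)

/-- The number of controlled-NOT gates of a circuit topology. -/
def QTopology.cnotCount {n : ℕ} (T : QTopology n) : ℕ := List.countP QSlot.isCnot T

/-- The place that a gate occupies (the single-qubit unitary is forgotten). -/
def QGate.slot {n : ℕ} : QGate n → QSlot n
  | .single j _ => .free j
  | .cnot c t h => .cnot c t h

/-- The topology of a circuit. -/
def QCircuit.topology {n : ℕ} (C : QCircuit n) : QTopology n := List.map QGate.slot C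

/-- The number of controlled-NOT gates of a circuit. -/
def QCircuit.cnotCount {n : ℕ} (C : QCircuit n) : ℕ := QTopology.cnotCount (QCircuit.topology C)

/-- The first `2 ^ m` columns of the `2 ^ n × 2 ^ n` identity matrix: the `m` input qubits are the
`m` least significant ones, and the remaining `n - m` qubits start in the state `|0⟩`. -/
def firstColumns (m n : ℕ) : Matrix (BitString n) (BitString m) ℂ :=
  Matrix.of fun b c =>
    if ∀ i : Fin n, b i = if h : i.val < m then c ⟨i.val, h⟩ else 0 then 1 else 0

/-- The circuit `C` performs the isometry `V`, up to a global phase, when all qubits that are not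
input qubits start in the state `|0⟩`. -/
def QCircuit.Implements {m n : ℕ} (C : QCircuit n) (V : Matrix (BitString n) (BitString m) ℂ) :
    Prop :=
  ∃ z : ℂ, ‖z‖ = 1 ∧ QCircuit.toMatrix C * firstColumns m n = z • V

/-- The topology `T` generates all `m` to `n` isometries: every one of them is performed by a
suitable choice of the single-qubit gates of `T`. -/
def QTopology.GeneratesIsometries {n : ℕ} (T : QTopology n) (m : ℕ) : Prop :=
  ∀ V : Matrix (BitString n) (BitString m) ℂ, IsQubitIsometry V →
    ∃ C : QCircuit n, QCircuit.topology C = T ∧ QCircuit.Implements C V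

/-- `r` controlled-NOT gates are enough for `m` to `n` isometries: some circuit topology with at
most `r` controlled-NOT gates generates all of them. -/
def CnotsSuffice (m n r : ℕ) : Prop :=
  ∃ T : QTopology n, QTopology.cnotCount T ≤ r ∧ QTopology.GeneratesIsometries T m

/-- The theoretical (parameter counting) lower bound
`⌈(2 ^ (n + m + 1) - 2 ^ (2 * m) - 2 * n - m - 1) / 4⌉`. -/
def cnotLowerBound (m n : ℕ) : ℤ :=
  ⌈((2 : ℚ) ^ (n + m + 1) - 2 ^ (2 * m) - 2 * n - m - 1) / 4⌉

/-! Products of matrices are read as circuits from right to left: the rightmost factor acts first.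

Upper bounds: the most significant qubit is peeled off. The cosine-sine decomposition writes a
unitary as a block diagonal matrix, a `rotY` rotation of the top qubit selected by the lower qubits,
and another block diagonal matrix. For an isometry the last factor shrinks to a gate on the inputs,
and only the inputs select the rotation. A block diagonal matrix with blocks A, B is V ·
(multiplexed `rotZ`) · W with V, W on the lower qubits, found by diagonalising A B†
(`exists_demultiplex`). A rotation with k controls costs 2^k CNOTs, or 2^k - 1 up to a controlled
involution (`synth_rot_mul_ctlHead`); for `rotY` this is a controlled Z, which an adjacent block
diagonal factor absorbs.

Lower gates are needed only up to a diagonal gate that acts before them. It commutes with the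
rotations of the top qubit and with diagonal gates, so it moves right and merges into the next gate.
`GeneratesUpToDiagonal` records this saving; the recursions are `generates_succ`, `Generates.succ`
and `GeneratesUpToDiagonal.succ`.

The base case is two qubits: two CNOTs up to a diagonal, three exactly (`exists_magic_diagonal`).
The magic basis turns real orthogonal matrices into local gates, up to a reflection. In it a unitary
Y factors as K D Pᵀ with K, P real orthogonal, from a real eigenbasis of the symmetric unitary Yᵀ Y.
A preceding parity phase makes the trace of Yᵀ Y real, so its eigenvalues form conjugate pairs and D
costs only two CNOTs.

States use the Schmidt decomposition (`generates_zero_add`). For 1 to 4, the two isometries selected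
by the top qubit share a range of two qubits (`exists_common_range`).

Lower bound: local gates rescale the bilinear form J ⊗ J, with J symplectic. Circuits with at most
one CNOT pull it back to the input qubit as a multiple, possibly zero, of an invertible form
(`exists_form_of_cnotCount_le_one`), whereas `symmetricIsometry` gives a form of rank one. -/

section LinearAlgebra

/-! ### Matrix decompositions: singular values, cosine-sine, spectral theorems, demultiplexing. -/

variable {ι κ : Type*} [Fintype ι] [DecidableEq ι] [Fintype κ] [DecidableEq κ]

theorem Matrix.IsHermitian.exists_eq_mul_diagonal_mul {𝕜 : Type*} [RCLike 𝕜] {H : Matrix ι ι 𝕜}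
    (hH : H.IsHermitian) : ∃ (E : Matrix ι ι 𝕜) (d : ι → ℝ), Eᴴ * E = 1 ∧ E * Eᴴ = 1 ∧
      H = E * Matrix.diagonal (fun i => (d i : 𝕜)) * Eᴴ := by
  refine ⟨hH.eigenvectorUnitary, hH.eigenvalues, ?_, ?_, ?_⟩
  · exact Matrix.mem_unitaryGroup_iff'.1 hH.eigenvectorUnitary.2
  · exact Matrix.mem_unitaryGroup_iff.1 hH.eigenvectorUnitary.2
  · conv_lhs => rw [hH.spectral_theorem]
    rfl

/-- A matrix with orthogonal columns of lengths `|s k|` is a unitary times a diagonal matrix. -/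
theorem exists_unitary_of_orthogonal_columns (j : κ → ι) (hj : Function.Injective j)
    (X : Matrix ι κ ℂ) (s : κ → ℝ)
    (h : Xᴴ * X = Matrix.diagonal (fun k => ((s k : ℂ) ^ 2))) :
    ∃ A ∈ Matrix.unitaryGroup ι ℂ,
      X = A.submatrix id j * Matrix.diagonal (fun k => (s k : ℂ)) := by
  classical
  have hent : ∀ k l, ∑ i, star (X i k) * X i l = if k = l then (s k : ℂ) ^ 2 else 0 := by
    intro k l
    have := congrFun (congrFun h k) l
    rw [Matrix.diagonal_apply] at this
    simpa [Matrix.mul_apply] using this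
  let w : κ → EuclideanSpace ℂ ι := fun k => WithLp.toLp 2 (fun i => ((s k : ℂ))⁻¹ * X i k)
  let v : ι → EuclideanSpace ℂ ι := Function.extend j w 0
  have hv : ∀ k, v (j k) = w k := fun k => hj.extend_apply _ _ _
  -- Only the nonzero columns are normalised and extended to an orthonormal basis. A column with `s
  -- k = 0` vanishes, so any basis vector serves for it.
  let T : Set ι := j '' {k | s k ≠ 0}
  have hort : Orthonormal ℂ (T.domRestrict v) := by
    rw [orthonormal_iff_ite]
    rintro ⟨i, hi⟩ ⟨i', hi'⟩
    obtain ⟨k, hk, rfl⟩ := (Set.mem_image _ _ _).1 hi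
    obtain ⟨l, hl, rfl⟩ := (Set.mem_image _ _ _).1 hi'
    have hk' : (s k : ℂ) ≠ 0 := by exact_mod_cast hk
    simp only [Set.domRestrict_apply, hv, Subtype.mk.injEq, hj.eq_iff]
    have : inner ℂ (w k) (w l) = (s k : ℂ)⁻¹ * (s l : ℂ)⁻¹ * ∑ i, star (X i k) * X i l := by
      simp only [PiLp.inner_apply, w, Finset.mul_sum]
      refine Finset.sum_congr rfl fun i _ => ?_
      simp
      ring
    rw [this, hent]
    split_ifs with hkl
    · subst hkl; field_simp
    · simp
  obtain ⟨b, hb⟩ := hort.exists_orthonormalBasis_extension_of_card_eq (by simp)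
  refine ⟨Matrix.of fun i k => b k i, ?_, ?_⟩
  · rw [Matrix.mem_unitaryGroup_iff']
    ext k l
    have := orthonormal_iff_ite.1 b.orthonormal k l
    simp only [PiLp.inner_apply] at this
    rw [Matrix.one_apply, ← this]
    simp [Matrix.mul_apply, Matrix.star_apply, mul_comm]
  · ext i k
    rw [Matrix.mul_diagonal]
    simp only [Matrix.submatrix_apply, id, Matrix.of_apply]
    by_cases hs : s k = 0
    · have h0 := hent k k
      simp only [hs, if_true] at h0
      have h1 : ∑ i, ‖X i k‖ ^ 2 = 0 := by
        have : ((∑ i, ‖X i k‖ ^ 2 : ℝ) : ℂ) = 0 := by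
          rw [← Complex.ofReal_zero]
          push_cast
          simp only [Complex.ofReal_zero, ne_eq, OfNat.ofNat_ne_zero, not_false_eq_true,
            zero_pow] at h0
          rw [← h0]
          refine Finset.sum_congr rfl fun i _ => ?_
          rw [← Complex.conj_mul']
          rfl
        exact_mod_cast this
      have h2 := (Finset.sum_eq_zero_iff_of_nonneg (fun i _ => by positivity)).1 h1 i
        (Finset.mem_univ i)
      simp [hs]
      simpa using h2
    · have hs' : (s k : ℂ) ≠ 0 := by exact_mod_cast hs
      rw [hb (j k) ⟨k, hs, rfl⟩, hv]
      simp [w]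
      field_simp

theorem exists_unitary_extension (j : κ → ι) (hj : Function.Injective j)
    (X : Matrix ι κ ℂ) (h : Xᴴ * X = 1) :
    ∃ A ∈ Matrix.unitaryGroup ι ℂ, X = A.submatrix id j := by
  obtain ⟨A, hA, hX⟩ := exists_unitary_of_orthogonal_columns j hj X (fun _ => 1) (by simp [h])
  exact ⟨A, hA, by simpa using hX⟩

theorem nonneg_of_conjTranspose_mul_self_eq_diagonal {μ ν : Type*} [Fintype μ] [DecidableEq ν]
    {X : Matrix μ ν ℂ} {d : ν → ℝ} (h : Xᴴ * X = Matrix.diagonal (fun k => (d k : ℂ))) (k : ν) : 0 ≤ d k := by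
  have := congrFun (congrFun h k) k
  rw [Matrix.diagonal_apply_eq, Matrix.mul_apply] at this
  have h2 : ((∑ i, ‖X i k‖ ^ 2 : ℝ) : ℂ) = (d k : ℂ) := by
    rw [← this]
    push_cast
    refine Finset.sum_congr rfl fun i _ => ?_
    rw [← Complex.conj_mul']
    rfl
  have h3 : (∑ i, ‖X i k‖ ^ 2 : ℝ) = d k := by exact_mod_cast h2
  rw [← h3]
  positivity

/-- Singular value decomposition. -/
theorem exists_svd (j : κ → ι) (hj : Function.Injective j) (M : Matrix ι κ ℂ) :
    ∃ X ∈ Matrix.unitaryGroup ι ℂ, ∃ Y ∈ Matrix.unitaryGroup κ ℂ, ∃ s : κ → ℝ, (∀ k, 0 ≤ s k) ∧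
      M = X.submatrix id j * Matrix.diagonal (fun k => (s k : ℂ)) * Y := by
  obtain ⟨E, d, h1, h2, h3⟩ :=
    (Matrix.isHermitian_conjTranspose_mul_self M).exists_eq_mul_diagonal_mul
  have h4 : (M * E)ᴴ * (M * E) = Matrix.diagonal (fun i => (d i : ℂ)) := by
    rw [Matrix.conjTranspose_mul, Matrix.mul_assoc, ← Matrix.mul_assoc Mᴴ, h3]
    simp only [← Matrix.mul_assoc, h1, Matrix.one_mul]
    rw [Matrix.mul_assoc, h1, Matrix.mul_one]
    rfl
  obtain ⟨X, hX, hM⟩ := exists_unitary_of_orthogonal_columns j hj (M * E) (fun k => √(d k)) (by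
    rw [h4]
    congr 1
    ext k
    rw [← Complex.ofReal_pow, Real.sq_sqrt (nonneg_of_conjTranspose_mul_self_eq_diagonal h4 k)])
  refine ⟨X, hX, Eᴴ, ?_, fun k => √(d k), fun k => Real.sqrt_nonneg _, ?_⟩
  · rw [Matrix.mem_unitaryGroup_iff, Matrix.star_eq_conjTranspose,
      Matrix.conjTranspose_conjTranspose, h1]
  · rw [← hM, Matrix.mul_assoc, h2, Matrix.mul_one]

/-- Cosine-sine decomposition of a pair of matrices that form an isometry when stacked. -/
theorem exists_cosineSine (j : κ → ι) (hj : Function.Injective j) (M N : Matrix ι κ ℂ)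
    (h : Mᴴ * M + Nᴴ * N = 1) :
    ∃ A ∈ Matrix.unitaryGroup ι ℂ, ∃ B ∈ Matrix.unitaryGroup ι ℂ,
    ∃ R ∈ Matrix.unitaryGroup κ ℂ, ∃ θ : κ → ℝ,
      M = A.submatrix id j * Matrix.diagonal (fun k => (Real.cos (θ k) : ℂ)) * R ∧
      N = B.submatrix id j * Matrix.diagonal (fun k => (Real.sin (θ k) : ℂ)) * R := by
  obtain ⟨E, d, h1, h2, h3⟩ :=
    (Matrix.isHermitian_conjTranspose_mul_self M).exists_eq_mul_diagonal_mul
  have h4 : (M * E)ᴴ * (M * E) = Matrix.diagonal (fun i => (d i : ℂ)) := by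
    rw [Matrix.conjTranspose_mul, Matrix.mul_assoc, ← Matrix.mul_assoc Mᴴ, h3]
    simp only [← Matrix.mul_assoc, h1, Matrix.one_mul]
    rw [Matrix.mul_assoc, h1, Matrix.mul_one]
    rfl
  -- Since `Nᴴ * N = 1 - Mᴴ * M`, one eigenbasis serves both blocks. Nonnegativity of both diagonals
  -- puts `d` in [0, 1], so it is a squared cosine.
  have h5 : (N * E)ᴴ * (N * E) = Matrix.diagonal (fun i => ((1 - d i : ℝ) : ℂ)) := by
    have : (M * E)ᴴ * (M * E) + (N * E)ᴴ * (N * E) = 1 := by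
      rw [← h1, ← Matrix.mul_one Eᴴ, ← h]
      simp only [Matrix.conjTranspose_mul, Matrix.mul_add, Matrix.add_mul, Matrix.mul_assoc]
    rw [h4] at this
    rw [← sub_eq_iff_eq_add'.2 this.symm, ← Matrix.diagonal_one, Matrix.diagonal_sub]
    simp
  have h6 := nonneg_of_conjTranspose_mul_self_eq_diagonal h4
  have h7 := nonneg_of_conjTranspose_mul_self_eq_diagonal h5
  have hc : ∀ k, Real.cos (Real.arccos √(d k)) = √(d k) := fun k =>
    Real.cos_arccos (by linarith [Real.sqrt_nonneg (d k)])
      (Real.sqrt_le_one.2 (by linarith [h7 k]))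
  have hs : ∀ k, Real.sin (Real.arccos √(d k)) = √(1 - d k) := fun k => by
    rw [Real.sin_arccos, Real.sq_sqrt (h6 k)]
  obtain ⟨A, hA, hM⟩ := exists_unitary_of_orthogonal_columns j hj (M * E) (fun k => √(d k)) (by
    rw [h4]
    congr 1
    ext k
    rw [← Complex.ofReal_pow, Real.sq_sqrt (h6 k)])
  obtain ⟨B, hB, hN⟩ := exists_unitary_of_orthogonal_columns j hj (N * E) (fun k => √(1 - d k)) (by
    rw [h5]
    congr 1
    ext k
    rw [← Complex.ofReal_pow, Real.sq_sqrt (h7 k)])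
  refine ⟨A, hA, B, hB, Eᴴ, ?_, fun k => Real.arccos √(d k), ?_, ?_⟩
  · rw [Matrix.mem_unitaryGroup_iff, Matrix.star_eq_conjTranspose,
      Matrix.conjTranspose_conjTranspose, h1]
  · simp only [hc]
    rw [← hM, Matrix.mul_assoc, h2, Matrix.mul_one]
  · simp only [hs]
    rw [← hN, Matrix.mul_assoc, h2, Matrix.mul_one]

/-- Otherwise every point of the unit circle would be a root of the characteristic polynomial. The
phase keeps -1 out of the spectrum, so that the Cayley transform exists. -/
theorem exists_phase_isUnit_one_add (U : Matrix ι ι ℂ) :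
    ∃ z : ℂ, ‖z‖ = 1 ∧ IsUnit (1 + z • U) := by
  by_contra! hcon
  have hroot : ∀ z : ℂ, ‖z‖ = 1 → -z ∈ U.charpoly.roots.toFinset := by
    intro z hz
    have hz0 : z ≠ 0 := by rintro rfl; simp at hz
    have h1 := hcon z⁻¹ (by simp [hz])
    rw [Matrix.isUnit_iff_isUnit_det, isUnit_iff_ne_zero, not_not] at h1
    rw [Multiset.mem_toFinset, Polynomial.mem_roots (Matrix.charpoly_monic U).ne_zero,
      Polynomial.IsRoot, Matrix.eval_charpoly]
    have h2 : Matrix.scalar ι (-z) - U = (-z) • (1 + z⁻¹ • U) := by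
      rw [smul_add, smul_smul, neg_mul, mul_inv_cancel₀ hz0, neg_one_smul, ← sub_eq_add_neg]
      congr 1
      rw [Matrix.scalar_apply, Matrix.smul_one_eq_diagonal]
    rw [h2, Matrix.det_smul, h1, mul_zero]
  have hinf : (Set.range fun x : ℝ => -Complex.exp (x * Complex.I)).Finite :=
    (U.charpoly.roots.toFinset.finite_toSet).subset (by
      rintro _ ⟨x, rfl⟩
      exact hroot _ (Complex.norm_exp_ofReal_mul_I x))
  have hinj : Set.InjOn (fun x : ℝ => -Complex.exp (x * Complex.I)) (Set.Ioo 0 1) := by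
    intro x hx y hy hxy
    simp only [neg_inj] at hxy
    rw [Complex.exp_eq_exp_iff_exists_int] at hxy
    obtain ⟨n, hn⟩ := hxy
    have h1 : (x : ℂ) = y + n * (2 * Real.pi) := by
      have hI := Complex.I_ne_zero
      apply mul_right_cancel₀ hI
      rw [hn]; ring
    have h2 : x = y + n * (2 * Real.pi) := by exact_mod_cast h1
    have hpi := Real.pi_gt_three
    have hn0 : n = 0 := by
      by_contra hne
      rcases lt_or_gt_of_ne hne with h | h
      · have : (n : ℝ) ≤ -1 := by exact_mod_cast Int.le_sub_one_of_lt h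
        nlinarith [hx.1, hy.2]
      · have : (1 : ℝ) ≤ n := by exact_mod_cast h
        nlinarith [hx.2, hy.1]
    simpa [hn0] using h2
  exact (Set.Ioo_infinite (zero_lt_one' ℝ)) (Set.Finite.of_finite_image
    (hinf.subset (Set.image_subset_range _ _)) hinj)

/-- The Cayley transform of a unitary matrix is Hermitian, and it is symmetric if the matrix is. -/
theorem exists_cayley {W : Matrix ι ι ℂ} (hW : W ∈ Matrix.unitaryGroup ι ℂ) (h1 : IsUnit (1 + W)) :
    ∃ H : Matrix ι ι ℂ, H.IsHermitian ∧ (Wᵀ = W → Hᵀ = H) ∧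
      H * (1 + W) = Complex.I • (1 - W) := by
  have hdet := (Matrix.isUnit_iff_isUnit_det _).1 h1
  have hcomm : (1 + W)⁻¹ * (1 - W) = (1 - W) * (1 + W)⁻¹ := by
    have h : (1 - W) * (1 + W) = (1 + W) * (1 - W) := by noncomm_ring
    calc (1 + W)⁻¹ * (1 - W) = (1 + W)⁻¹ * ((1 - W) * (1 + W)) * (1 + W)⁻¹ := by
          rw [Matrix.mul_assoc, Matrix.mul_assoc, Matrix.mul_nonsing_inv _ hdet, Matrix.mul_one]
      _ = (1 - W) * (1 + W)⁻¹ := by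
          rw [h, ← Matrix.mul_assoc, Matrix.nonsing_inv_mul _ hdet, Matrix.one_mul]
  have hWW : Wᴴ * W = 1 := Matrix.mem_unitaryGroup_iff'.1 hW
  refine ⟨Complex.I • ((1 - W) * (1 + W)⁻¹), ?_, ?_, ?_⟩
  · rw [Matrix.IsHermitian, Matrix.conjTranspose_smul, Matrix.conjTranspose_mul,
      Matrix.conjTranspose_nonsing_inv]
    -- By unitarity both adjoints contain the factor `Wᴴ`, which cancels in the quotient; what
    -- remains is minus the original quotient, and the conjugate of `I` restores the sign.
    have h2 : (1 + W)ᴴ = Wᴴ * (1 + W) := by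
      rw [Matrix.mul_add, hWW, Matrix.conjTranspose_add, Matrix.conjTranspose_one, Matrix.mul_one,
        add_comm]
    have h3 : (1 - W)ᴴ = -(Wᴴ * (1 - W)) := by
      rw [Matrix.mul_sub, hWW, Matrix.conjTranspose_sub, Matrix.conjTranspose_one, Matrix.mul_one,
        neg_sub]
    have h4 : ((1 + W)ᴴ)⁻¹ * (1 - W)ᴴ = -((1 + W)⁻¹ * (1 - W)) := by
      have hd : IsUnit (Wᴴ).det := by
        apply Matrix.isUnit_det_of_right_inverse hWW
      rw [h2, h3, Matrix.mul_inv_rev, Matrix.mul_neg, Matrix.mul_assoc, ← Matrix.mul_assoc (Wᴴ)⁻¹,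
        Matrix.nonsing_inv_mul _ hd, Matrix.one_mul]
    rw [h4, hcomm]
    simp
  · intro hs
    rw [Matrix.transpose_smul, Matrix.transpose_mul, Matrix.transpose_nonsing_inv,
      Matrix.transpose_add, Matrix.transpose_sub, hs, Matrix.transpose_one, hcomm]
  · rw [Matrix.smul_mul, Matrix.mul_assoc, Matrix.nonsing_inv_mul _ hdet, Matrix.mul_one]

/-- Inversion of the Cayley transform in an eigenbasis. -/
theorem eq_conj_diagonal_of_cayley {W H E F : Matrix ι ι ℂ} {d : ι → ℝ} (hEF : E * F = 1)
    (hH : H = E * Matrix.diagonal (fun i => (d i : ℂ)) * F)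
    (h : H * (1 + W) = Complex.I • (1 - W)) :
    ∃ e : ι → ℂ, W = E * Matrix.diagonal e * F := by
  have hFE : F * E = 1 := mul_eq_one_comm.1 hEF
  have hne : ∀ i, (d i : ℂ) + Complex.I ≠ 0 := fun i h0 => by
    have := congrArg Complex.im h0
    simp at this
  -- The relation `H (1 + W) = i (1 - W)` is `(H + i) W = i - H`, solved for `W` on each
  -- eigenvector; `d i + i` is nonzero because `d i` is real.
  refine ⟨fun i => ((d i : ℂ) + Complex.I)⁻¹ * (Complex.I - d i), ?_⟩
  have h1 : Matrix.diagonal (fun i => (d i : ℂ) + Complex.I) * (F * W * E) =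
      Matrix.diagonal (fun i => Complex.I - (d i : ℂ)) := by
    have h2 : F * (H * (1 + W)) * E = F * (Complex.I • (1 - W)) * E := by rw [h]
    have h3 : F * (H * (1 + W)) * E = Matrix.diagonal (fun i => (d i : ℂ)) +
        Matrix.diagonal (fun i => (d i : ℂ)) * (F * W * E) := by
      rw [hH]
      simp only [Matrix.mul_assoc, Matrix.mul_add, Matrix.add_mul, Matrix.mul_one]
      rw [hFE, ← Matrix.mul_assoc F E, hFE, Matrix.mul_one]
      simp only [← Matrix.mul_assoc, hFE, Matrix.one_mul]
    have h4 : F * (Complex.I • (1 - W)) * E = Complex.I • 1 - Complex.I • (F * W * E) := by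
      simp only [Matrix.mul_smul, Matrix.smul_mul, Matrix.mul_sub, Matrix.sub_mul, Matrix.mul_one,
        hFE, smul_sub]
    rw [h3, h4] at h2
    have h5 : Matrix.diagonal (fun i => (d i : ℂ) + Complex.I) =
        Matrix.diagonal (fun i => (d i : ℂ)) + Complex.I • (1 : Matrix ι ι ℂ) := by
      rw [Matrix.smul_one_eq_diagonal, Matrix.diagonal_add]
    have h6 : Matrix.diagonal (fun i => Complex.I - (d i : ℂ)) =
        Complex.I • (1 : Matrix ι ι ℂ) - Matrix.diagonal (fun i => (d i : ℂ)) := by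
      rw [Matrix.smul_one_eq_diagonal, Matrix.diagonal_sub]
    rw [h5, h6, Matrix.add_mul, Matrix.smul_mul, Matrix.one_mul, eq_sub_iff_add_eq,
      add_right_comm, add_comm (_ * _), h2, sub_add_cancel]
  have h7 : F * W * E = Matrix.diagonal
      (fun i => ((d i : ℂ) + Complex.I)⁻¹ * (Complex.I - d i)) := by
    rw [← Matrix.diagonal_mul_diagonal, ← h1, ← Matrix.mul_assoc, Matrix.diagonal_mul_diagonal]
    simp [inv_mul_cancel₀ (hne _)]
  rw [← h7]
  simp only [Matrix.mul_assoc, hEF, Matrix.mul_one]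
  rw [← Matrix.mul_assoc, hEF, Matrix.one_mul]

theorem norm_eq_one_of_diagonal_mem_unitaryGroup {d : ι → ℂ}
    (h : Matrix.diagonal d ∈ Matrix.unitaryGroup ι ℂ) (i : ι) : ‖d i‖ = 1 := by
  have h1 := congrFun (congrFun (Matrix.mem_unitaryGroup_iff'.1 h) i) i
  rw [Matrix.star_eq_conjTranspose, Matrix.diagonal_conjTranspose, Matrix.diagonal_mul_diagonal,
    Matrix.diagonal_apply_eq, Matrix.one_apply_eq] at h1
  have h2 : ((‖d i‖ ^ 2 : ℝ) : ℂ) = 1 := by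
    rw [← h1, Complex.ofReal_pow, ← Complex.conj_mul']
    rfl
  have h3 : ‖d i‖ ^ 2 = 1 := by exact_mod_cast h2
  exact by nlinarith [norm_nonneg (d i)]

theorem smul_mem_unitaryGroup {z : ℂ} (hz : ‖z‖ = 1) {U : Matrix ι ι ℂ}
    (hU : U ∈ Matrix.unitaryGroup ι ℂ) : z • U ∈ Matrix.unitaryGroup ι ℂ := by
  rw [Matrix.mem_unitaryGroup_iff] at hU ⊢
  rw [star_smul, Matrix.smul_mul, Matrix.mul_smul, smul_smul, hU]
  have : z * star z = 1 := by
    rw [← starRingEnd_apply, Complex.mul_conj']; simp [hz]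
  rw [this, one_smul]

/-- The spectral theorem for unitary matrices. -/
theorem exists_unitary_diagonalization {U : Matrix ι ι ℂ} (hU : U ∈ Matrix.unitaryGroup ι ℂ) :
    ∃ V ∈ Matrix.unitaryGroup ι ℂ, ∃ e : ι → ℂ, (∀ i, ‖e i‖ = 1) ∧
      U = V * Matrix.diagonal e * Vᴴ := by
  obtain ⟨z, hz, hunit⟩ := exists_phase_isUnit_one_add U
  have hW := smul_mem_unitaryGroup hz hU
  obtain ⟨H, hH, -, h1⟩ := exists_cayley hW hunit
  obtain ⟨E, d, h2, h3, h4⟩ := hH.exists_eq_mul_diagonal_mul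
  obtain ⟨e, he⟩ := eq_conj_diagonal_of_cayley h3 h4 h1
  have hz0 : z ≠ 0 := by rintro rfl; simp at hz
  have hU' : U = E * Matrix.diagonal (z⁻¹ • e) * Eᴴ := by
    rw [Matrix.diagonal_smul, Matrix.mul_smul, Matrix.smul_mul, ← he, smul_smul,
      inv_mul_cancel₀ hz0, one_smul]
  have hE : E ∈ Matrix.unitaryGroup ι ℂ := Matrix.mem_unitaryGroup_iff.2 h3
  refine ⟨E, hE, z⁻¹ • e, ?_, hU'⟩
  apply norm_eq_one_of_diagonal_mem_unitaryGroup
  have : Matrix.diagonal (z⁻¹ • e) = Eᴴ * U * E := by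
    rw [hU']
    simp only [← Matrix.mul_assoc, h2, Matrix.one_mul]
    rw [Matrix.mul_assoc, h2, Matrix.mul_one]
  rw [this]
  exact mul_mem (mul_mem (Unitary.star_mem hE) hU) hE

/-- Symmetric unitary matrices are diagonal in a real orthonormal basis. -/
theorem exists_orthogonal_diagonalization {G : Matrix ι ι ℂ} (hG : G ∈ Matrix.unitaryGroup ι ℂ)
    (hs : Gᵀ = G) :
    ∃ (O : Matrix ι ι ℝ) (e : ι → ℂ), Oᵀ * O = 1 ∧ (∀ i, ‖e i‖ = 1) ∧
      G = O.map Complex.ofReal * Matrix.diagonal e * Oᵀ.map Complex.ofReal := by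
  obtain ⟨z, hz, hunit⟩ := exists_phase_isUnit_one_add G
  have hW := smul_mem_unitaryGroup hz hG
  obtain ⟨H, hH, hHs, h1⟩ := exists_cayley hW hunit
  have hHs := hHs (by rw [Matrix.transpose_smul, hs])
  -- A Hermitian symmetric matrix is real, so the real spectral theorem provides an orthogonal
  -- eigenbasis.
  have hreal : H = (H.map Complex.re).map Complex.ofReal := by
    ext i k
    have h2 := congrFun (congrFun hH i) k
    have h3 := congrFun (congrFun hHs i) k
    rw [Matrix.conjTranspose_apply] at h2
    rw [Matrix.transpose_apply] at h3
    rw [h3] at h2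
    simp only [Matrix.map_apply]
    exact (Complex.conj_eq_iff_re.1 h2).symm
  have hHr : (H.map Complex.re).IsHermitian := by
    ext i k
    have h3 := congrFun (congrFun hHs i) k
    rw [Matrix.transpose_apply] at h3
    simp [h3]
  obtain ⟨O, d, h2, h3, h4⟩ := hHr.exists_eq_mul_diagonal_mul
  rw [Matrix.conjTranspose_eq_transpose_of_trivial] at h2 h3 h4
  have h3' : O.map Complex.ofReal * Oᵀ.map Complex.ofReal = 1 := by
    have := congrArg (fun M => M.map Complex.ofRealHom) h3
    rw [Matrix.map_mul, Matrix.map_one _ (map_zero _) (map_one _)] at this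
    exact this
  have h4' : H = O.map Complex.ofReal * Matrix.diagonal (fun i => (d i : ℂ)) *
      Oᵀ.map Complex.ofReal := by
    rw [hreal, h4]
    change ((O * Matrix.diagonal d) * Oᵀ).map Complex.ofRealHom = _
    rw [Matrix.map_mul, Matrix.map_mul, Matrix.diagonal_map (map_zero _)]
    rfl
  obtain ⟨e, he⟩ := eq_conj_diagonal_of_cayley h3' h4' h1
  have hz0 : z ≠ 0 := by rintro rfl; simp at hz
  have hU' : G = O.map Complex.ofReal * Matrix.diagonal (z⁻¹ • e) * Oᵀ.map Complex.ofReal := by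
    rw [Matrix.diagonal_smul, Matrix.mul_smul, Matrix.smul_mul, ← he, smul_smul,
      inv_mul_cancel₀ hz0, one_smul]
  refine ⟨O, z⁻¹ • e, h2, ?_, hU'⟩
  apply norm_eq_one_of_diagonal_mem_unitaryGroup
  have h2' := mul_eq_one_comm.1 h3'
  have hstar : star (O.map Complex.ofReal) = Oᵀ.map Complex.ofReal := by
    ext i k; simp [Matrix.star_apply]
  have hE : O.map Complex.ofReal ∈ Matrix.unitaryGroup ι ℂ :=
    Matrix.mem_unitaryGroup_iff.2 (by rw [hstar, h3'])
  have : Matrix.diagonal (z⁻¹ • e) = Oᵀ.map Complex.ofReal * G * O.map Complex.ofReal := by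
    rw [hU']
    simp only [← Matrix.mul_assoc, h2', Matrix.one_mul]
    rw [Matrix.mul_assoc, h2', Matrix.mul_one]
  rw [this, ← hstar]
  exact mul_mem (mul_mem (Unitary.star_mem hE) hG) hE

theorem exists_exp_mul_I_sq {z : ℂ} (hz : ‖z‖ = 1) : ∃ x : ℝ,
    Complex.exp (x * Complex.I) ^ 2 = z := by
  obtain ⟨y, hy⟩ := (Complex.norm_eq_one_iff z).1 hz
  refine ⟨y / 2, ?_⟩
  rw [← Complex.exp_nat_mul, ← hy]
  congr 1
  push_cast
  ring

/-- Two unitaries selected by one qubit are, up to common factors on both sides, a diagonal matrix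
and its inverse. -/
theorem exists_demultiplex {A B : Matrix ι ι ℂ} (hA : A ∈ Matrix.unitaryGroup ι ℂ)
    (hB : B ∈ Matrix.unitaryGroup ι ℂ) :
    ∃ V ∈ Matrix.unitaryGroup ι ℂ, ∃ W ∈ Matrix.unitaryGroup ι ℂ, ∃ d : ι → ℝ,
      A = V * Matrix.diagonal (fun i => Complex.exp (d i * Complex.I)) * W ∧
      B = V * Matrix.diagonal (fun i => Complex.exp (-(d i * Complex.I))) * W := by
  -- Write `A B† = V D² V†` with `D` a square root of the eigenvalue matrix and put `W = D V† B`.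
  -- Then `A = V D W` and `B = V D⁻¹ W`.
  obtain ⟨V, hV, e, he, hVe⟩ := exists_unitary_diagonalization
    (mul_mem hA (Unitary.star_mem hB))
  choose d hd using fun i => exists_exp_mul_I_sq (he i)
  have hVV : V * Vᴴ = 1 := Matrix.mem_unitaryGroup_iff.1 hV
  have hBB : star B * B = 1 := Matrix.mem_unitaryGroup_iff'.1 hB
  have hD : Matrix.diagonal (fun i => Complex.exp (d i * Complex.I)) ∈ Matrix.unitaryGroup ι ℂ := by
    rw [Matrix.mem_unitaryGroup_iff, Matrix.star_eq_conjTranspose, Matrix.diagonal_conjTranspose,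
      Matrix.diagonal_mul_diagonal, ← Matrix.diagonal_one]
    congr 1
    ext i
    rw [Pi.star_apply, ← starRingEnd_apply, Complex.mul_conj', Complex.norm_exp_ofReal_mul_I]
    simp
  refine ⟨V, hV, Matrix.diagonal (fun i => Complex.exp (d i * Complex.I)) * Vᴴ * B,
    mul_mem (mul_mem hD (Unitary.star_mem hV)) hB, d, ?_, ?_⟩
  · have : A = A * star B * B := by rw [Matrix.mul_assoc, hBB, Matrix.mul_one]
    rw [this, hVe]
    simp only [← Matrix.mul_assoc]
    rw [Matrix.mul_assoc V (Matrix.diagonal _) (Matrix.diagonal _), Matrix.diagonal_mul_diagonal]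
    have he2 : e = fun i => Complex.exp (d i * Complex.I) * Complex.exp (d i * Complex.I) :=
      funext fun i => by rw [← sq, hd]
    rw [he2]
  · simp only [← Matrix.mul_assoc]
    rw [Matrix.mul_assoc V (Matrix.diagonal _) (Matrix.diagonal _), Matrix.diagonal_mul_diagonal]
    simp [← Complex.exp_add, hVV]

end LinearAlgebra

/-! ### Circuit synthesis, relabelling of qubits and multiplexed rotations. -/

section Circuits

/-- The matrices in `S` are all performed by circuits of one topology with at most `k` controlled-NOT
gates. -/
def Synth {n : ℕ} (k : ℕ) (S : Set (Matrix (BitString n) (BitString n) ℂ)) : Prop :=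
  ∃ T : QTopology n, QTopology.cnotCount T ≤ k ∧
    ∀ M ∈ S, ∃ C : QCircuit n, QCircuit.topology C = T ∧ QCircuit.toMatrix C = M

theorem QCircuit.toMatrix_append {n : ℕ} (C D : QCircuit n) :
    QCircuit.toMatrix (C ++ D) = QCircuit.toMatrix D * QCircuit.toMatrix C := by
  induction C with
  | nil => simp [QCircuit.toMatrix]
  | cons g C ih =>
    rw [List.cons_append, QCircuit.toMatrix, ih, QCircuit.toMatrix, Matrix.mul_assoc]

namespace Synth

variable {n k l : ℕ} {S S' R : Set (Matrix (BitString n) (BitString n) ℂ)}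

/-- The topologies are concatenated, that of the right factor first since it acts first. Keeping `R`
separate means that only a factorisation of each of its members is needed. -/
theorem mul (h : Synth k S) (h' : Synth l S') (hR : ∀ M ∈ R, ∃ A ∈ S, ∃ B ∈ S', M = A * B) :
    Synth (k + l) R := by
  obtain ⟨T, hT, h⟩ := h
  obtain ⟨T', hT', h'⟩ := h'
  refine ⟨T' ++ T, ?_, fun M hM => ?_⟩
  · rw [QTopology.cnotCount, List.countP_append]
    unfold QTopology.cnotCount at hT hT'
    omega
  · obtain ⟨A, hA, B, hB, rfl⟩ := hR M hM
    obtain ⟨C, hC, rfl⟩ := h A hA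
    obtain ⟨C', hC', rfl⟩ := h' B hB
    exact ⟨C' ++ C, by rw [QCircuit.topology, List.map_append]; exact congrArg₂ _ hC' hC,
      QCircuit.toMatrix_append _ _⟩

theorem mono (h : Synth k S) (hR : R ⊆ S) (hkl : k ≤ l) : Synth l R := by
  obtain ⟨T, hT, h⟩ := h
  exact ⟨T, hT.trans hkl, fun M hM => h M (hR hM)⟩

end Synth

theorem synth_single {n : ℕ} (j : Fin n) :
    Synth 0 {M | ∃ U ∈ Matrix.unitaryGroup (Fin 2) ℂ, M = singleQubitMatrix j U} := by
  refine ⟨[.free j], by simp [QTopology.cnotCount, QSlot.isCnot], ?_⟩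
  rintro _ ⟨U, hU, rfl⟩
  exact ⟨[.single j ⟨U, hU⟩], rfl, by simp [QCircuit.toMatrix, QGate.toMatrix]⟩

theorem synth_cnot {n : ℕ} (c t : Fin n) (h : c ≠ t) : Synth 1 {cnotMatrix c t} := by
  refine ⟨[.cnot c t h], by simp [QTopology.cnotCount, QSlot.isCnot], ?_⟩
  rintro _ rfl
  exact ⟨[.cnot c t h], rfl, by simp [QCircuit.toMatrix, QGate.toMatrix]⟩

theorem synth_one {n : ℕ} : Synth 0 {(1 : Matrix (BitString n) (BitString n) ℂ)} :=
  ⟨[], by simp [QTopology.cnotCount], by rintro _ rfl; exact ⟨[], rfl, rfl⟩⟩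

/-- The operation `f b` on the qubit `t`, selected by the bits `b` of the other qubits. -/
def ctl {n : ℕ} (t : Fin n) (f : BitString n → Matrix (Fin 2) (Fin 2) ℂ) :
    Matrix (BitString n) (BitString n) ℂ :=
  Matrix.of fun b b' => if ∀ i, i ≠ t → b i = b' i then f b (b t) (b' t) else 0

theorem singleQubitMatrix_eq_ctl {n : ℕ} (j : Fin n) (U : Matrix (Fin 2) (Fin 2) ℂ) :
    singleQubitMatrix j U = ctl j fun _ => U := rfl

theorem sum_agree_off {n : ℕ} (t : Fin n) (b : BitString n) (f : BitString n → ℂ) :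
    ∑ b', (if ∀ i, i ≠ t → b i = b' i then f b' else 0) =
      ∑ x, f (Function.update b t x) := by
  rw [← Finset.sum_filter]
  refine Finset.sum_nbij' (fun b' => b' t) (fun x => Function.update b t x) ?_ ?_ ?_ ?_ ?_
  · simp
  · intro x _
    simp only [Finset.mem_filter, Finset.mem_univ, true_and]
    intro i hi
    rw [Function.update_of_ne hi]
  · intro b' hb'
    simp only [Finset.mem_filter, Finset.mem_univ, true_and] at hb'
    ext1 i
    by_cases hi : i = t
    · subst hi; simp
    · rw [Function.update_of_ne hi, hb' i hi]
  · simp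
  · intro b' hb'
    simp only [Finset.mem_filter, Finset.mem_univ, true_and] at hb'
    congr 1
    ext1 i
    by_cases hi : i = t
    · subst hi; simp
    · rw [Function.update_of_ne hi, hb' i hi]

/-- For fixed values of the other bits both factors are 2 × 2 blocks, which multiply. `g` is
evaluated at an intermediate bit string that may differ from `b` at `t`, so it must not depend on
that bit; `f` is evaluated at `b` itself. -/
theorem ctl_mul {n : ℕ} (t : Fin n) {f g : BitString n → Matrix (Fin 2) (Fin 2) ℂ}
    (hg : ∀ b x, g (Function.update b t x) = g b) :
    ctl t f * ctl t g = ctl t fun b => f b * g b := by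
  ext b b'
  have h1 : ∀ b'', ctl t f b b'' * ctl t g b'' b' =
      if ∀ i, i ≠ t → b i = b'' i then f b (b t) (b'' t) * ctl t g b'' b' else 0 := by
    intro b''
    simp only [ctl, Matrix.of_apply, ite_mul, zero_mul]
  rw [Matrix.mul_apply]
  simp only [h1]
  rw [sum_agree_off t b fun b'' => f b (b t) (b'' t) * ctl t g b'' b']
  simp only [ctl, Matrix.of_apply, hg, Function.update_self]
  have h2 : ∀ x, (∀ i, i ≠ t → Function.update b t x i = b' i) ↔ ∀ i, i ≠ t → b i = b' i :=
    fun x => forall₂_congr fun i hi => by rw [Function.update_of_ne hi]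
  simp only [h2]
  split_ifs
  · rw [Matrix.mul_apply]
  · simp

theorem ctl_one {n : ℕ} (t : Fin n) : ctl t (fun _ => 1) = 1 := by
  ext b b'
  simp only [ctl, Matrix.of_apply, Matrix.one_apply]
  by_cases h : b = b'
  · subst h; simp
  · rw [if_neg h]
    split_ifs with h1 h2
    · exact absurd (funext fun i => if hi : i = t then hi ▸ h2 else h1 i hi) h
    · rfl
    · rfl

theorem ctl_congr {n : ℕ} {t : Fin n} {f g : BitString n → Matrix (Fin 2) (Fin 2) ℂ}
    (h : ∀ b, f b = g b) : ctl t f = ctl t g := by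
  rw [funext h]

theorem ctl_conjTranspose {n : ℕ} (t : Fin n) {f : BitString n → Matrix (Fin 2) (Fin 2) ℂ}
    (hf : ∀ b x, f (Function.update b t x) = f b) :
    (ctl t f)ᴴ = ctl t fun b => (f b)ᴴ := by
  ext b b'
  rw [Matrix.conjTranspose_apply]
  simp only [ctl, Matrix.of_apply]
  by_cases h : ∀ i, i ≠ t → b i = b' i
  · have h' : ∀ i, i ≠ t → b' i = b i := fun i hi => (h i hi).symm
    have h2 : b' = Function.update b t (b' t) := by
      ext1 i
      by_cases hi : i = t
      · subst hi; simp
      · rw [Function.update_of_ne hi, h i hi]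
    rw [if_pos h, if_pos h', Matrix.conjTranspose_apply]
    conv_lhs => rw [h2]
    rw [hf]
    simp
  · have h' : ¬ ∀ i, i ≠ t → b' i = b i := fun h' => h fun i hi => (h' i hi).symm
    rw [if_neg h, if_neg h', star_zero]

theorem ctl_mem_unitaryGroup {n : ℕ} (t : Fin n) {f : BitString n → Matrix (Fin 2) (Fin 2) ℂ}
    (hf : ∀ b x, f (Function.update b t x) = f b) (hu : ∀ b, f b ∈ Matrix.unitaryGroup (Fin 2) ℂ) :
    ctl t f ∈ Matrix.unitaryGroup (BitString n) ℂ := by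
  rw [Matrix.mem_unitaryGroup_iff', Matrix.star_eq_conjTranspose, ctl_conjTranspose t hf,
    ctl_mul t hf, ← ctl_one t]
  exact ctl_congr fun b => Matrix.mem_unitaryGroup_iff'.1 (hu b)

def pauliX : Matrix (Fin 2) (Fin 2) ℂ := !![0, 1; 1, 0]

def pauliZ : Matrix (Fin 2) (Fin 2) ℂ := !![1, 0; 0, -1]

theorem cnotMatrix_eq_ctl {n : ℕ} {c t : Fin n} (h : c ≠ t) :
    cnotMatrix c t = ctl t fun b => if b c = 1 then pauliX else 1 := by
  ext b b'
  simp only [cnotMatrix, ctl, Matrix.of_apply]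
  by_cases h1 : ∀ i, i ≠ t → b i = b' i
  · have h2 : b = Function.update b' t (b' t + b' c) ↔ b t = b' t + b' c := by
      constructor
      · intro h3; rw [h3]; simp
      · intro h3
        ext1 i
        by_cases hi : i = t
        · subst hi; simpa using h3
        · rw [Function.update_of_ne hi, h1 i hi]
    rw [if_pos h1, h1 c h]
    simp only [h2]
    generalize b t = x
    generalize b' t = y
    generalize b' c = z
    fin_cases x <;> fin_cases y <;> fin_cases z <;> simp [pauliX]
  · rw [if_neg h1, if_neg]
    rintro rfl
    exact h1 fun i hi => by rw [Function.update_of_ne hi]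

/-! ### Operations on a subset of the qubits -/

/-- The operation `U` on the qubits in the range of `e`. -/
def liftMatrix {k n : ℕ} (e : Fin k → Fin n) (U : Matrix (BitString k) (BitString k) ℂ) :
    Matrix (BitString n) (BitString n) ℂ :=
  Matrix.of fun b b' => if ∀ i, (∀ a, e a ≠ i) → b i = b' i then U (b ∘ e) (b' ∘ e) else 0

variable {k n : ℕ} {e : Fin k → Fin n}

theorem sum_agree_off_range (he : Function.Injective e) (b : BitString n) (f : BitString n → ℂ) :
    ∑ b', (if ∀ i, (∀ a, e a ≠ i) → b i = b' i then f b' else 0) =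
      ∑ c, f (Function.extend e c b) := by
  rw [← Finset.sum_filter]
  have key : ∀ b' : BitString n, (∀ i, (∀ a, e a ≠ i) → b i = b' i) →
      Function.extend e (b' ∘ e) b = b' := by
    intro b' hb'
    ext1 i
    by_cases hi : ∃ a, e a = i
    · obtain ⟨a, rfl⟩ := hi
      rw [he.extend_apply]; rfl
    · rw [Function.extend_apply' _ _ _ hi, hb' i (by simpa using hi)]
  refine Finset.sum_nbij' (fun b' => b' ∘ e) (fun c => Function.extend e c b) ?_ ?_ ?_ ?_ ?_
  · simp
  · intro c _
    simp only [Finset.mem_filter, Finset.mem_univ, true_and]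
    intro i hi
    rw [Function.extend_apply' _ _ _ (by simpa using hi)]
  · intro b' hb'
    exact key b' (by simpa using hb')
  · intro c _
    exact funext fun a => he.extend_apply _ _ _
  · intro b' hb'
    rw [key b' (by simpa using hb')]

theorem liftMatrix_mul (he : Function.Injective e) (U V : Matrix (BitString k) (BitString k) ℂ) :
    liftMatrix e (U * V) = liftMatrix e U * liftMatrix e V := by
  ext b b'
  have h1 : ∀ b'', liftMatrix e U b b'' * liftMatrix e V b'' b' =
      if ∀ i, (∀ a, e a ≠ i) → b i = b'' i then
        U (b ∘ e) (b'' ∘ e) * liftMatrix e V b'' b' else 0 := by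
    intro b''
    simp only [liftMatrix, Matrix.of_apply, ite_mul, zero_mul]
  rw [Matrix.mul_apply]
  simp only [h1]
  rw [sum_agree_off_range he b fun b'' => U (b ∘ e) (b'' ∘ e) * liftMatrix e V b'' b']
  have h3 : ∀ c, Function.extend e c b ∘ e = c := fun c => funext fun a => he.extend_apply _ _ _
  simp only [liftMatrix, Matrix.of_apply, h3]
  have h2 : ∀ c, (∀ i, (∀ a, e a ≠ i) → Function.extend e c b i = b' i) ↔
      ∀ i, (∀ a, e a ≠ i) → b i = b' i :=
    fun c => forall₂_congr fun i hi => by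
      rw [Function.extend_apply' _ _ _ (by simpa using hi)]
  simp only [h2]
  split_ifs
  · rw [Matrix.mul_apply]
  · simp

theorem liftMatrix_one (e : Fin k → Fin n) :
    liftMatrix e (1 : Matrix (BitString k) (BitString k) ℂ) = 1 := by
  ext b b'
  simp only [liftMatrix, Matrix.of_apply, Matrix.one_apply]
  by_cases h : b = b'
  · subst h; simp
  · rw [if_neg h]
    split_ifs with h1 h2
    · exact absurd (funext fun i => if hi : ∃ a, e a = i then by
        obtain ⟨a, rfl⟩ := hi; exact congrFun h2 a
        else h1 i (by simpa using hi)) h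
    · rfl
    · rfl

theorem liftMatrix_ctl (he : Function.Injective e) (t : Fin k)
    (f : BitString k → Matrix (Fin 2) (Fin 2) ℂ) :
    liftMatrix e (ctl t f) = ctl (e t) fun b => f (b ∘ e) := by
  ext b b'
  simp only [liftMatrix, ctl, Matrix.of_apply, Function.comp_apply]
  rw [← ite_and]
  refine if_congr ⟨fun h i hi => ?_, fun h => ⟨fun i hi => h i fun h' => hi t h'.symm,
    fun a ha => h (e a) (he.ne ha)⟩⟩ rfl rfl
  by_cases hr : ∃ a, e a = i
  · obtain ⟨a, rfl⟩ := hr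
    exact h.2 a fun h' => hi (h' ▸ rfl)
  · exact h.1 i (by simpa using hr)

theorem liftMatrix_single (he : Function.Injective e) (t : Fin k) (U : Matrix (Fin 2) (Fin 2) ℂ) :
    liftMatrix e (singleQubitMatrix t U) = singleQubitMatrix (e t) U := by
  rw [singleQubitMatrix_eq_ctl, liftMatrix_ctl he, singleQubitMatrix_eq_ctl]

theorem liftMatrix_cnot (he : Function.Injective e) {c t : Fin k} (h : c ≠ t) :
    liftMatrix e (cnotMatrix c t) = cnotMatrix (e c) (e t) := by
  rw [cnotMatrix_eq_ctl h, liftMatrix_ctl he, cnotMatrix_eq_ctl (he.ne h)]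
  rfl

def QSlot.lift (he : Function.Injective e) : QSlot k → QSlot n
  | .free j => .free (e j)
  | .cnot c t h => .cnot (e c) (e t) (he.ne h)

def QGate.lift (he : Function.Injective e) : QGate k → QGate n
  | .single j U => .single (e j) U
  | .cnot c t h => .cnot (e c) (e t) (he.ne h)

/-- Lifting is multiplicative and sends gates to gates of the same kind, so relabelling the places
gives a topology with the same count. -/
theorem Synth.lift {r : ℕ} {S : Set (Matrix (BitString k) (BitString k) ℂ)} (h : Synth r S)
    (he : Function.Injective e) : Synth r (liftMatrix e '' S) := by
  obtain ⟨T, hT, h⟩ := h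
  refine ⟨T.map (QSlot.lift he), ?_, ?_⟩
  · rw [QTopology.cnotCount, List.countP_map]
    have : QSlot.isCnot ∘ QSlot.lift he = QSlot.isCnot := by
      funext s; cases s <;> rfl
    rw [this]
    exact hT
  · rintro _ ⟨M, hM, rfl⟩
    obtain ⟨C, hC, rfl⟩ := h M hM
    refine ⟨C.map (QGate.lift he), ?_, ?_⟩
    · rw [← hC, QCircuit.topology, QCircuit.topology, List.map_map, List.map_map]
      congr 1
      funext g; cases g <;> rfl
    · clear hC hM
      induction C with
      | nil => simp [QCircuit.toMatrix, liftMatrix_one]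
      | cons g C ih =>
        rw [List.map_cons, QCircuit.toMatrix, ih, QCircuit.toMatrix, liftMatrix_mul he]
        congr 1
        cases g with
        | single j U => exact (liftMatrix_single he j _).symm
        | cnot c t h => exact (liftMatrix_cnot he h).symm

/-! ### Multiplexed rotations -/

noncomputable def rotY (x : ℝ) : Matrix (Fin 2) (Fin 2) ℂ :=
  !![(Real.cos x : ℂ), -(Real.sin x : ℂ); (Real.sin x : ℂ), (Real.cos x : ℂ)]

noncomputable def rotZ (x : ℝ) : Matrix (Fin 2) (Fin 2) ℂ :=
  !![Complex.exp (x * Complex.I), 0; 0, Complex.exp (-(x * Complex.I))]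

/-- A one-parameter group of single-qubit unitaries that is inverted by conjugation with the
involution `F`, where `F` can be controlled with one controlled-NOT gate. -/
structure IsReversedBy (R : ℝ → Matrix (Fin 2) (Fin 2) ℂ) (F : Matrix (Fin 2) (Fin 2) ℂ) :
    Prop where
  add : ∀ x y, R (x + y) = R x * R y
  mem : ∀ x, R x ∈ Matrix.unitaryGroup (Fin 2) ℂ
  inv : F * F = 1
  conj : ∀ x, F * R x * F = R (-x)
  synth : ∀ {n : ℕ} (c t : Fin n), c ≠ t → Synth 1 {ctl t fun b => if b c = 1 then F else 1}

theorem isReversedBy_rotZ : IsReversedBy rotZ pauliX where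
  add x y := by
    simp only [rotZ, Matrix.mul_fin_two, Complex.ofReal_add, add_mul, neg_add, Complex.exp_add]
    simp
  mem x := by
    rw [Matrix.mem_unitaryGroup_iff]
    ext i j
    fin_cases i <;> fin_cases j <;>
      simp [rotZ, Matrix.mul_apply, Matrix.star_apply, ← Complex.exp_conj, ← Complex.exp_add]
  inv := by
    ext i j
    fin_cases i <;> fin_cases j <;> simp [pauliX]
  conj x := by
    ext i j
    fin_cases i <;> fin_cases j <;> simp [pauliX, rotZ]
  synth c t h := cnotMatrix_eq_ctl h ▸ synth_cnot c t h

noncomputable def hadamard : Matrix (Fin 2) (Fin 2) ℂ :=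
  ((√2 : ℝ) : ℂ)⁻¹ • !![1, 1; 1, -1]

theorem sqrt_two_inv_mul_self : ((√2 : ℝ) : ℂ)⁻¹ * ((√2 : ℝ) : ℂ)⁻¹ = 2⁻¹ := by
  rw [← mul_inv, ← Complex.ofReal_mul, Real.mul_self_sqrt (by norm_num)]
  norm_num

theorem hadamard_mul_self : hadamard * hadamard = 1 := by
  rw [hadamard, Matrix.smul_mul, Matrix.mul_smul, smul_smul, sqrt_two_inv_mul_self]
  ext i j
  fin_cases i <;> fin_cases j <;> simp <;> norm_num

theorem hadamard_mem : hadamard ∈ Matrix.unitaryGroup (Fin 2) ℂ := by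
  rw [Matrix.mem_unitaryGroup_iff]
  have : star hadamard = hadamard := by
    ext i j
    fin_cases i <;> fin_cases j <;> simp [hadamard, Matrix.star_apply]
  rw [this, hadamard_mul_self]

theorem hadamard_conj : hadamard * pauliX * hadamard = pauliZ := by
  rw [hadamard, Matrix.smul_mul, Matrix.smul_mul, Matrix.mul_smul, smul_smul,
    sqrt_two_inv_mul_self]
  ext i j
  fin_cases i <;> fin_cases j <;> simp [pauliX, pauliZ] <;> norm_num

/-- Conjugation by Z negates the sines. A controlled Z is a CNOT whose target is conjugated by
Hadamard gates, which are free. -/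
theorem isReversedBy_rotY : IsReversedBy rotY pauliZ where
  add x y := by
    simp only [rotY, Matrix.mul_fin_two, Real.cos_add, Real.sin_add]
    ext i j
    fin_cases i <;> fin_cases j <;> simp <;> ring
  mem x := by
    rw [Matrix.mem_unitaryGroup_iff]
    have h := Real.cos_sq_add_sin_sq x
    have h : (Real.cos x : ℂ) ^ 2 + (Real.sin x : ℂ) ^ 2 = 1 := by exact_mod_cast h
    ext i j
    fin_cases i <;> fin_cases j <;>
      simp only [rotY, Matrix.mul_apply, Matrix.star_apply, Fin.sum_univ_two] <;>
      simp [Complex.conj_ofReal, -Complex.ofReal_cos, -Complex.ofReal_sin] <;>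
      first | linear_combination h | ring
  inv := by
    ext i j
    fin_cases i <;> fin_cases j <;> simp [pauliZ]
  conj x := by
    ext i j
    fin_cases i <;> fin_cases j <;> simp [pauliZ, rotY]
  synth c t h := by
    refine ((synth_single t).mul (synth_cnot c t h) (R := {singleQubitMatrix t hadamard *
      cnotMatrix c t}) ?_).mul (synth_single t) ?_
    · rintro _ rfl
      exact ⟨_, ⟨_, hadamard_mem, rfl⟩, _, rfl, rfl⟩
    · rintro _ rfl
      refine ⟨_, rfl, _, ⟨_, hadamard_mem, rfl⟩, ?_⟩
      rw [cnotMatrix_eq_ctl h, singleQubitMatrix_eq_ctl, ctl_mul, ctl_mul]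
      · refine ctl_congr fun b => ?_
        split_ifs
        · exact hadamard_conj.symm
        · rw [Matrix.mul_one, hadamard_mul_self]
      · simp
      · intro b x
        rw [Function.update_of_ne h]

/-- The correction by which a multiplexed rotation becomes one controlled-NOT gate cheaper. -/
def ctlHead {n : ℕ} (t : Fin n) (F : Matrix (Fin 2) (Fin 2) ℂ) :
    List (Fin n) → Matrix (BitString n) (BitString n) ℂ
  | [] => 1
  | c :: _ => ctl t fun b => if b c = 1 then F else 1

/-- Induction on the controls. With `C` the `F` gate controlled by the new qubit `c`, the product `R
φ * C * R χ` rotates by `φ + χ` if `c` is 0 and by `φ - χ`, followed or preceded by `F`, if `c` is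
1. Suitable `φ`, `χ` on the old controls thus give any new multiplexed rotation up to `C`. Both
one-sided forms are needed: the corrections of the two halves then face each other and cancel,
whence the count 2 (2^k - 1) + 1 = 2^(k+1) - 1. -/
theorem synth_rot_mul_ctlHead {n : ℕ} {R : ℝ → Matrix (Fin 2) (Fin 2) ℂ} {F : Matrix (Fin 2) (Fin 2) ℂ}
    (hR : IsReversedBy R F) (t : Fin n) (l : List (Fin n)) (ht : t ∉ l) :
    Synth (2 ^ l.length - 1) {M | ∃ θ : BitString n → ℝ, DependsOn θ {i | i ∈ l} ∧
      M = ctl t (fun b => R (θ b)) * ctlHead t F l} ∧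
    Synth (2 ^ l.length - 1) {M | ∃ θ : BitString n → ℝ, DependsOn θ {i | i ∈ l} ∧
      M = ctlHead t F l * ctl t (fun b => R (θ b))} := by
  induction l with
  | nil =>
    have : Synth (2 ^ 0 - 1) {M | ∃ θ : BitString n → ℝ, DependsOn θ {i | i ∈ ([] : List (Fin n))} ∧
        M = ctl t (fun b => R (θ b))} := by
      refine (synth_single t).mono ?_ (by simp)
      rintro _ ⟨θ, hθ, rfl⟩
      exact ⟨_, hR.mem (θ 0), ctl_congr fun b => by rw [hθ (by simp)]⟩
    constructor
    · simpa [ctlHead] using this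
    · simpa [ctlHead] using this
  | cons c l ih =>
    obtain ⟨hct, hl⟩ := not_or.1 (List.mem_cons.not.1 ht)
    obtain ⟨ih1, ih2⟩ := ih hl
    have hindep : ∀ {θ : BitString n → ℝ} {l : List (Fin n)}, t ∉ l → DependsOn θ {i | i ∈ l} →
        ∀ b x, R (θ (Function.update b t x)) = R (θ b) := by
      intro θ l hl hθ b x
      refine congrArg R (hθ fun i hi => ?_)
      have hit : i ≠ t := by rintro rfl; exact hl hi
      exact Function.update_of_ne hit _ _
    have hcu : ∀ (b : BitString n) (x : Fin 2), (if (Function.update b t x) c = 1 then F else 1) =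
        if b c = 1 then F else 1 := fun b x => by rw [Function.update_of_ne (Ne.symm hct)]
    have hRF : ∀ x, R x * F = F * R (-x) := fun x => by
      rw [← hR.conj, ← Matrix.mul_assoc, ← Matrix.mul_assoc, hR.inv, Matrix.one_mul]
    have hE : ctlHead t F l * ctlHead t F l = 1 := by
      cases l with
      | nil => simp [ctlHead]
      | cons d l =>
        have hdt : d ≠ t := by rintro rfl; simp at hl
        rw [ctlHead, ctl_mul, ← ctl_one t]
        · refine ctl_congr fun b => ?_
          split_ifs
          · exact hR.inv
          · simp
        · intro b x
          rw [Function.update_of_ne hdt]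
    have hEc : ctlHead t F (c :: l) * ctlHead t F l = ctlHead t F l * ctlHead t F (c :: l) := by
      cases l with
      | nil => simp [ctlHead]
      | cons d l =>
        have hdt : d ≠ t := by rintro rfl; simp at hl
        rw [ctlHead, ctlHead, ctl_mul, ctl_mul]
        · refine ctl_congr fun b => ?_
          split_ifs <;> simp
        · exact hcu
        · intro b x
          rw [Function.update_of_ne hdt]
    -- both forms are products `R φ * C * R χ`
    have key : Synth (2 ^ (l.length + 1) - 1) {M | ∃ φ χ : BitString n → ℝ,
        DependsOn φ {i | i ∈ l} ∧ DependsOn χ {i | i ∈ l} ∧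
        M = ctl t (fun b => R (φ b)) * ctlHead t F (c :: l) * ctl t (fun b => R (χ b))} := by
      have h1 := ih1.mul (hR.synth c t (Ne.symm hct)) (R := {M | ∃ φ : BitString n → ℝ,
          DependsOn φ {i | i ∈ l} ∧ M = ctl t (fun b => R (φ b)) * ctlHead t F l *
            ctlHead t F (c :: l)}) (by
        rintro _ ⟨φ, hφ, rfl⟩
        exact ⟨_, ⟨φ, hφ, rfl⟩, _, rfl, rfl⟩)
      have h2 : 2 ^ (l.length + 1) - 1 = 2 ^ l.length - 1 + 1 + (2 ^ l.length - 1) := by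
        have := Nat.one_le_two_pow (n := l.length)
        rw [pow_succ]
        omega
      rw [h2]
      refine h1.mul ih2 ?_
      rintro _ ⟨φ, χ, hφ, hχ, rfl⟩
      refine ⟨_, ⟨φ, hφ, rfl⟩, _, ⟨χ, hχ, rfl⟩, ?_⟩
      -- The corrections of the two halves commute with the gate between them and are involutions,
      -- so they cancel.
      rw [Matrix.mul_assoc (ctl t fun b => R (φ b)) (ctlHead t F l), ← hEc]
      simp only [Matrix.mul_assoc]
      rw [← Matrix.mul_assoc (ctlHead t F l) (ctlHead t F l), hE, Matrix.one_mul]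
    -- Half the sum and half the difference of the angles at `c = 0` and `c = 1`; their sum and
    -- difference recover the angles.
    let φ : (BitString n → ℝ) → BitString n → ℝ := fun θ b =>
      (θ (Function.update b c 0) + θ (Function.update b c 1)) / 2
    let χ : (BitString n → ℝ) → BitString n → ℝ := fun θ b =>
      (θ (Function.update b c 0) - θ (Function.update b c 1)) / 2
    have hupd : ∀ {θ : BitString n → ℝ}, DependsOn θ {i | i ∈ c :: l} → ∀ y,
        DependsOn (fun b => θ (Function.update b c y)) {i | i ∈ l} := by
      intro θ hθ y b b' hbb
      apply hθ
      intro i hi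
      by_cases hic : i = c
      · subst hic; simp
      · rw [Function.update_of_ne hic, Function.update_of_ne hic]
        exact hbb i ((List.mem_cons.1 hi).resolve_left hic)
    have hφ : ∀ {θ : BitString n → ℝ}, DependsOn θ {i | i ∈ c :: l} →
        DependsOn (φ θ) {i | i ∈ l} := fun hθ b b' hbb => by
      have e0 := hupd hθ 0 hbb
      have e1 := hupd hθ 1 hbb
      simp only [φ] at e0 e1 ⊢
      rw [e0, e1]
    have hχ : ∀ {θ : BitString n → ℝ}, DependsOn θ {i | i ∈ c :: l} →
        DependsOn (χ θ) {i | i ∈ l} := fun hθ b b' hbb => by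
      have e0 := hupd hθ 0 hbb
      have e1 := hupd hθ 1 hbb
      simp only [χ] at e0 e1 ⊢
      rw [e0, e1]
    have h0 : ∀ (θ : BitString n → ℝ) (b : BitString n), b c ≠ 1 → θ b = φ θ b + χ θ b := by
      intro θ b hb
      have : b c = 0 := by omega
      simp only [φ, χ]
      rw [← this, Function.update_eq_self]
      ring
    have h1 : ∀ (θ : BitString n → ℝ) (b : BitString n), b c = 1 → θ b = φ θ b - χ θ b := by
      intro θ b hb
      simp only [φ, χ]
      rw [← hb, Function.update_eq_self]
      ring
    rw [List.length_cons]
    constructor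
    · refine key.mono ?_ le_rfl
      rintro _ ⟨θ, hθ, rfl⟩
      refine ⟨φ θ, χ θ, hφ hθ, hχ hθ, ?_⟩
      rw [ctlHead, ctl_mul _ hcu, ctl_mul _ hcu, ctl_mul _ (hindep hl (hχ hθ))]
      refine ctl_congr fun b => ?_
      split_ifs with hb
      · rw [h1 θ b hb, sub_eq_add_neg, hR.add, Matrix.mul_assoc, hRF, neg_neg, Matrix.mul_assoc]
      · rw [h0 θ b hb, hR.add, Matrix.mul_one, Matrix.mul_one]
    · refine key.mono ?_ le_rfl
      rintro _ ⟨θ, hθ, rfl⟩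
      -- The roles are exchanged because `F` now moves left past the first rotation and reverses
      -- that one.
      refine ⟨χ θ, φ θ, hχ hθ, hφ hθ, ?_⟩
      rw [ctlHead, ctl_mul _ (hindep ht hθ), ctl_mul _ hcu, ctl_mul _ (hindep hl (hφ hθ))]
      refine ctl_congr fun b => ?_
      split_ifs with hb
      · rw [h1 θ b hb, sub_eq_add_neg, add_comm, hR.add, hRF, Matrix.mul_assoc]
      · rw [h0 θ b hb, add_comm, hR.add, Matrix.mul_one, Matrix.one_mul]

theorem synth_ctlHead_mul_rot {n : ℕ} {R : ℝ → Matrix (Fin 2) (Fin 2) ℂ}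
    {F : Matrix (Fin 2) (Fin 2) ℂ} (hR : IsReversedBy R F) (t : Fin n) (l : List (Fin n))
    (ht : t ∉ l) :
    Synth (2 ^ l.length - 1) {M | ∃ θ : BitString n → ℝ, DependsOn θ {i | i ∈ l} ∧
      M = ctlHead t F l * ctl t (fun b => R (θ b))} :=
  (synth_rot_mul_ctlHead hR t l ht).2

/-- One more controlled `F` undoes the correction. With no controls there is nothing to undo and the
allowed gate is not used. -/
theorem synth_rot {n : ℕ} {R : ℝ → Matrix (Fin 2) (Fin 2) ℂ} {F : Matrix (Fin 2) (Fin 2) ℂ}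
    (hR : IsReversedBy R F) (t : Fin n) (l : List (Fin n)) (ht : t ∉ l) :
    Synth (2 ^ l.length) {M | ∃ θ : BitString n → ℝ, DependsOn θ {i | i ∈ l} ∧
      M = ctl t (fun b => R (θ b))} := by
  have h := (synth_rot_mul_ctlHead hR t l ht).1
  have h2 : 2 ^ l.length = 2 ^ l.length - 1 + 1 := by
    have := Nat.one_le_two_pow (n := l.length)
    omega
  rw [h2]
  cases l with
  | nil =>
    refine h.mono ?_ (by omega)
    rintro _ ⟨θ, hθ, rfl⟩
    exact ⟨θ, hθ, by rw [ctlHead, Matrix.mul_one]⟩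
  | cons c l =>
    have hct : c ≠ t := by rintro rfl; simp at ht
    refine h.mul (hR.synth c t hct) ?_
    rintro _ ⟨θ, hθ, rfl⟩
    refine ⟨_, ⟨θ, hθ, rfl⟩, _, rfl, ?_⟩
    rw [Matrix.mul_assoc, ctlHead, ctl_mul]
    · have : (ctl t fun b => (if b c = 1 then F else 1) * (if b c = 1 then F else 1)) = 1 := by
        rw [← ctl_one t]
        refine ctl_congr fun b => ?_
        split_ifs
        · exact hR.inv
        · simp
      rw [this, Matrix.mul_one]
    · intro b x
      rw [Function.update_of_ne hct]

end Circuits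

/-! ### Orthogonal transformations of the quaternions. -/

section TwoQubits

open scoped Kronecker

/-- The quaternion units as unitary `2 × 2` matrices. -/
def quat : Fin 2 × Fin 2 → Matrix (Fin 2) (Fin 2) ℂ
  | (0, 0) => 1
  | (0, 1) => !![Complex.I, 0; 0, -Complex.I]
  | (1, 0) => !![0, -1; 1, 0]
  | (1, 1) => !![0, -Complex.I; -Complex.I, 0]

/-- The polarisation of `q† q = |q|²`: it expresses that the units are orthonormal in the
four-dimensional real space of quaternions. -/
theorem quat_polar (p q : Fin 2 × Fin 2) :
    (quat p)ᴴ * quat q + (quat q)ᴴ * quat p = if p = q then 2 else 0 := by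
  obtain ⟨p1, p2⟩ := p
  obtain ⟨q1, q2⟩ := q
  ext i j
  fin_cases p1 <;> fin_cases p2 <;> fin_cases q1 <;> fin_cases q2 <;> fin_cases i <;>
    fin_cases j <;> simp [quat, Matrix.mul_apply, Matrix.ofNat_apply] <;> norm_num

/-- Any anticommuting pair of imaginary units is conjugate to the standard one. As `x² = -1`, the
columns of `x + i` are eigenvectors of `x` for `i`; they are not all zero, for a scalar `x` cannot
anticommute with the invertible `y`. If `v` is a unit eigenvector, `y v` is an eigenvector for `-i`,
and the two form the columns of `u`. -/
theorem exists_unitary_conj_quat {x y : Matrix (Fin 2) (Fin 2) ℂ} (hx : xᴴ = -x) (hy : yᴴ = -y)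
    (hxx : x * x = -1) (hyy : y * y = -1) (hxy : x * y = -(y * x)) :
    ∃ u ∈ Matrix.unitaryGroup (Fin 2) ℂ, x * u = u * quat (0, 1) ∧ y * u = u * quat (1, 0) := by
  have hne : x + Complex.I • 1 ≠ 0 := by
    intro h
    have hx' : x = -(Complex.I • 1) := eq_neg_of_add_eq_zero_left h
    rw [hx'] at hxy
    simp only [Matrix.neg_mul, Matrix.mul_neg, Matrix.smul_mul, Matrix.mul_smul, Matrix.one_mul,
      Matrix.mul_one, neg_neg] at hxy
    have h2 : y = 0 := by
      ext i j
      have h3 := congrFun (congrFun hxy i) j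
      simp only [Matrix.neg_apply, Matrix.smul_apply, smul_eq_mul] at h3
      have h4 : Complex.I * y i j = 0 := by linear_combination (-1 / 2 : ℂ) * h3
      exact (mul_eq_zero.1 h4).resolve_left Complex.I_ne_zero
    rw [h2, Matrix.mul_zero] at hyy
    have := congrFun (congrFun hyy 0) 0
    simp at this
  obtain ⟨k, hk⟩ : ∃ k, (x + Complex.I • 1).col k ≠ 0 := by
    by_contra! h
    exact hne (Matrix.ext fun i k => congrFun (h k) i)
  set v' : Fin 2 → ℂ := (x + Complex.I • 1).col k with hv'
  have hxv' : x *ᵥ v' = Complex.I • v' := by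
    have h1 : x * (x + Complex.I • 1) = Complex.I • (x + Complex.I • 1) := by
      rw [Matrix.mul_add, hxx, smul_add, smul_smul, Complex.I_mul_I, Matrix.mul_smul,
        Matrix.mul_one, neg_one_smul, add_comm]
    ext i
    exact congrFun (congrFun h1 i) k
  obtain ⟨r, hr, hrv⟩ : ∃ r : ℝ, r ≠ 0 ∧ star v' ⬝ᵥ v' = ((r ^ 2 : ℝ) : ℂ) := by
    refine ⟨√(∑ i, ‖v' i‖ ^ 2), ?_, ?_⟩
    · rw [Real.sqrt_ne_zero (by positivity)]
      intro h
      apply hk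
      ext i
      have := (Finset.sum_eq_zero_iff_of_nonneg (fun i _ => by positivity)).1 h i
        (Finset.mem_univ i)
      simpa using this
    · rw [Real.sq_sqrt (by positivity), dotProduct]
      push_cast
      refine Finset.sum_congr rfl fun i _ => ?_
      rw [← Complex.conj_mul']
      rfl
  have hr' : (r : ℂ) ≠ 0 := by exact_mod_cast hr
  set v : Fin 2 → ℂ := ((r : ℂ)⁻¹) • v' with hv
  have hvv : star v ⬝ᵥ v = 1 := by
    rw [hv, star_smul, smul_dotProduct, dotProduct_smul, hrv]
    simp
    field_simp
  have hxv : x *ᵥ v = Complex.I • v := by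
    rw [hv, Matrix.mulVec_smul, hxv', smul_comm]
  set w : Fin 2 → ℂ := y *ᵥ v with hw
  have hadj : ∀ (A : Matrix (Fin 2) (Fin 2) ℂ) (a b : Fin 2 → ℂ),
      star (A *ᵥ a) ⬝ᵥ b = star a ⬝ᵥ (Aᴴ *ᵥ b) := by
    intro A a b
    rw [Matrix.star_mulVec, Matrix.dotProduct_mulVec]
  have hyw : y *ᵥ w = -v := by
    rw [hw, Matrix.mulVec_mulVec, hyy, Matrix.neg_mulVec, Matrix.one_mulVec]
  have hxw : x *ᵥ w = -(Complex.I • w) := by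
    rw [hw, Matrix.mulVec_mulVec, hxy, Matrix.neg_mulVec, ← Matrix.mulVec_mulVec, hxv,
      Matrix.mulVec_smul]
  have hww : star w ⬝ᵥ w = 1 := by
    conv_lhs => rw [hw]
    rw [hadj, ← hw, hy, Matrix.neg_mulVec, hyw, neg_neg, hvv]
  have hvw : star v ⬝ᵥ w = 0 := by
    have h1 := hadj x v w
    rw [hxv, hx, Matrix.neg_mulVec, hxw, star_smul, smul_dotProduct, neg_neg, dotProduct_smul] at h1
    have h2 : Complex.I * (star v ⬝ᵥ w) = 0 := by
      simp only [smul_eq_mul] at h1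
      have h3 : star Complex.I = -Complex.I := Complex.conj_I
      rw [h3] at h1
      linear_combination (-1 / 2 : ℂ) * h1
    exact (mul_eq_zero.1 h2).resolve_left Complex.I_ne_zero
  have hwv : star w ⬝ᵥ v = 0 := by
    rw [Matrix.star_dotProduct, hvw, star_zero]
  refine ⟨Matrix.of fun i j => if j = 0 then v i else w i, ?_, ?_, ?_⟩
  · rw [Matrix.mem_unitaryGroup_iff']
    ext i j
    rw [dotProduct, Fin.sum_univ_two] at hvv hww hvw hwv
    fin_cases i <;> fin_cases j <;>
      simpa [Matrix.mul_apply, Matrix.star_apply] using by assumption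
  · ext i j
    have h1 := congrFun hxv i
    have h2 := congrFun hxw i
    simp only [Matrix.mulVec, dotProduct, Fin.sum_univ_two, Pi.smul_apply, Pi.neg_apply,
      smul_eq_mul] at h1 h2
    fin_cases j <;> simp [Matrix.mul_apply, quat, h1, h2, mul_comm]
  · ext i j
    have h1 := congrFun hw i
    have h2 := congrFun hyw i
    simp only [Matrix.mulVec, dotProduct, Fin.sum_univ_two, Pi.neg_apply] at h1 h2
    fin_cases j <;> simp [Matrix.mul_apply, quat, h1, h2]

/-- The sign matrix that distinguishes the two components of the orthogonal group. -/
def lastSign (ε : ℂ) : Fin 2 × Fin 2 → ℂ := fun p => if p = (1, 1) then ε else 1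

/-- Anticommuting with the first unit kills the diagonal, anticommuting with the second makes the
off-diagonal entries equal, and the square fixes them up to sign. -/
theorem exists_sign_of_anticommute {y : Matrix (Fin 2) (Fin 2) ℂ} (hy : y * y = -1)
    (h1 : quat (0, 1) * y = -(y * quat (0, 1))) (h2 : quat (1, 0) * y = -(y * quat (1, 0))) :
    ∃ ε : ℂ, (ε = 1 ∨ ε = -1) ∧ y = ε • quat (1, 1) := by
  have e1 := congrFun (congrFun h1 0) 0
  have e2 := congrFun (congrFun h1 1) 1
  have e3 := congrFun (congrFun h2 0) 0
  have e4 := congrFun (congrFun hy 0) 0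
  simp [quat, Matrix.mul_apply] at e1 e2 e3 e4
  have hI := Complex.I_ne_zero
  have f1 : y 0 0 = 0 := by
    have : Complex.I * y 0 0 = 0 := by linear_combination (1 / 2 : ℂ) * e1
    exact (mul_eq_zero.1 this).resolve_left hI
  have f2 : y 1 1 = 0 := by
    have : Complex.I * y 1 1 = 0 := by linear_combination (-1 / 2 : ℂ) * e2
    exact (mul_eq_zero.1 this).resolve_left hI
  have f3 : y 1 0 = y 0 1 := e3
  have f4 : (y 0 1 - Complex.I) * (y 0 1 + Complex.I) = 0 := by
    rw [f1, f3] at e4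
    linear_combination e4 - Complex.I_mul_I
  rcases mul_eq_zero.1 f4 with h | h
  · refine ⟨-1, Or.inr rfl, ?_⟩
    ext i j
    fin_cases i <;> fin_cases j <;> simp [quat, f1, f2, f3, sub_eq_zero.1 h]
  · refine ⟨1, Or.inl rfl, ?_⟩
    ext i j
    fin_cases i <;> fin_cases j <;> simp [quat, f1, f2, f3, eq_neg_of_add_eq_zero_left h]

/-- An orthogonal transformation of the quaternions is `q ↦ a q b`, up to a reflection. -/
theorem exists_quat_of_orthogonal {O : Matrix (Fin 2 × Fin 2) (Fin 2 × Fin 2) ℝ}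
    (hO : Oᵀ * O = 1) :
    ∃ a ∈ Matrix.unitaryGroup (Fin 2) ℂ, ∃ b ∈ Matrix.unitaryGroup (Fin 2) ℂ, ∃ ε : ℂ,
      a.det * b.det = 1 ∧ (ε = 1 ∨ ε = -1) ∧
      ∀ p, ∑ q, (O q p : ℂ) • quat q = lastSign ε p • (a * quat p * b) := by
  set τ : Fin 2 × Fin 2 → Matrix (Fin 2) (Fin 2) ℂ := fun p => ∑ q, (O q p : ℂ) • quat q with hτ
  have hent : ∀ p r, ∑ q, (O q p : ℂ) * (O q r : ℂ) = if p = r then 1 else 0 := by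
    intro p r
    have := congrFun (congrFun hO p) r
    rw [Matrix.mul_apply, Matrix.one_apply] at this
    simp only [Matrix.transpose_apply] at this
    have h2 := congrArg Complex.ofReal this
    push_cast at h2
    rw [h2]
    split_ifs <;> simp
  have hpol : ∀ p r, (τ p)ᴴ * τ r + (τ r)ᴴ * τ p = if p = r then 2 else 0 := by
    intro p r
    have h1 : ∀ p r, (τ p)ᴴ * τ r =
        ∑ q, ∑ q', ((O q p : ℂ) * (O q' r : ℂ)) • ((quat q)ᴴ * quat q') := by
      intro p r
      simp only [hτ, Matrix.conjTranspose_sum, Finset.sum_mul, Finset.mul_sum,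
        Matrix.conjTranspose_smul, Matrix.smul_mul, Matrix.mul_smul, smul_smul]
      rw [Finset.sum_comm]
      refine Finset.sum_congr rfl fun q _ => Finset.sum_congr rfl fun q' _ => ?_
      congr 1
      simp [mul_comm]
    have h2 : (τ r)ᴴ * τ p =
        ∑ q, ∑ q', ((O q p : ℂ) * (O q' r : ℂ)) • ((quat q')ᴴ * quat q) := by
      rw [h1, Finset.sum_comm]
      refine Finset.sum_congr rfl fun q _ => Finset.sum_congr rfl fun q' _ => ?_
      rw [mul_comm]
    rw [h1, h2]
    simp only [← Finset.sum_add_distrib, ← smul_add, quat_polar, smul_ite, smul_zero,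
      Finset.sum_ite_eq, Finset.mem_univ, if_true, ← Finset.sum_smul, hent]
    split_ifs <;> simp
  have hτ0 : ∀ p, (τ p)ᴴ * τ p = 1 := by
    intro p
    have h1 := hpol p p
    rw [if_pos rfl, ← two_smul ℂ] at h1
    have h2 := congrArg (fun M => (2⁻¹ : ℂ) • M) h1
    simp only [smul_smul] at h2
    rw [inv_mul_cancel₀ two_ne_zero, one_smul] at h2
    rw [h2]
    ext i j
    fin_cases i <;> fin_cases j <;> simp [Matrix.ofNat_apply]
  have hτ1 : ∀ p, τ p * (τ p)ᴴ = 1 := fun p => mul_eq_one_comm.1 (hτ0 p)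
  have hdet : (τ (0, 0)).det = 1 := by
    have h1 := hent (0, 0) (0, 0)
    rw [if_pos rfl] at h1
    rw [Matrix.det_fin_two]
    simp only [Fintype.sum_prod_type, Fin.sum_univ_two] at h1
    simp [hτ, Fintype.sum_prod_type, quat]
    linear_combination h1 -
      ((O (0, 1) (0, 0) : ℂ) ^ 2 + (O (1, 1) (0, 0) : ℂ) ^ 2) * Complex.I_mul_I
  -- Division by the image of 1 sends the other three images to mutually anticommuting imaginary
  -- units. Conjugation by `u` normalises two of them, and the third is then determined up to the
  -- sign `ε`, which records the orientation of `O`.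
  let x : Fin 2 × Fin 2 → Matrix (Fin 2) (Fin 2) ℂ := fun p => (τ (0, 0))ᴴ * τ p
  have hxH : ∀ p, p ≠ (0, 0) → (x p)ᴴ = -x p := by
    intro p hp
    have h1 := hpol p (0, 0)
    rw [if_neg hp] at h1
    simp only [x, Matrix.conjTranspose_mul, Matrix.conjTranspose_conjTranspose]
    exact eq_neg_of_add_eq_zero_left h1
  have hxx : ∀ p r, (x p)ᴴ * x r = (τ p)ᴴ * τ r := by
    intro p r
    simp only [x, Matrix.conjTranspose_mul, Matrix.conjTranspose_conjTranspose]
    rw [Matrix.mul_assoc, ← Matrix.mul_assoc (τ (0, 0)), hτ1, Matrix.one_mul]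
  have hsq : ∀ p, p ≠ (0, 0) → x p * x p = -1 := by
    intro p hp
    have h1 := hxx p p
    rw [hxH p hp, hτ0, Matrix.neg_mul] at h1
    exact neg_eq_iff_eq_neg.1 h1
  have hanti : ∀ p r, p ≠ (0, 0) → r ≠ (0, 0) → p ≠ r → x p * x r = -(x r * x p) := by
    intro p r hp hr hpr
    have h1 := hpol p r
    rw [if_neg hpr, ← hxx, ← hxx, hxH p hp, hxH r hr, Matrix.neg_mul, Matrix.neg_mul] at h1
    exact neg_inj.1 (eq_neg_of_add_eq_zero_left h1)
  obtain ⟨u, hu, hu1, hu2⟩ := exists_unitary_conj_quat (hxH (0, 1) (by decide))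
    (hxH (1, 0) (by decide)) (hsq _ (by decide)) (hsq _ (by decide))
    (hanti _ _ (by decide) (by decide) (by decide))
  have huu : uᴴ * u = 1 := Matrix.mem_unitaryGroup_iff'.1 hu
  have huu' : u * uᴴ = 1 := Matrix.mem_unitaryGroup_iff.1 hu
  have hc : ∀ p q : Matrix (Fin 2) (Fin 2) ℂ, p * u = u * q → p = u * q * uᴴ := by
    intro p q h
    rw [← h, Matrix.mul_assoc, huu', Matrix.mul_one]
  have hc' : ∀ p q : Matrix (Fin 2) (Fin 2) ℂ, p * u = u * q → q = uᴴ * p * u := by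
    intro p q h
    rw [Matrix.mul_assoc, h, ← Matrix.mul_assoc, huu, Matrix.one_mul]
  have hm : ∀ p q : Matrix (Fin 2) (Fin 2) ℂ, (uᴴ * p * u) * (uᴴ * q * u) = uᴴ * (p * q) * u := by
    intro p q
    simp only [Matrix.mul_assoc]
    rw [← Matrix.mul_assoc u uᴴ, huu', Matrix.one_mul]
  obtain ⟨ε, hε, hy⟩ := exists_sign_of_anticommute (y := uᴴ * x (1, 1) * u)
    (by rw [hm, hsq _ (by decide), Matrix.mul_neg, Matrix.mul_one, Matrix.neg_mul, huu])
    (by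
      rw [hc' _ _ hu1, hm, hm,
        hanti (0, 1) (1, 1) (by decide) (by decide) (by decide), Matrix.mul_neg,
        Matrix.neg_mul])
    (by
      rw [hc' _ _ hu2, hm, hm,
        hanti (1, 0) (1, 1) (by decide) (by decide) (by decide), Matrix.mul_neg,
        Matrix.neg_mul])
  have hx3 : x (1, 1) = u * (ε • quat (1, 1)) * uᴴ := by
    rw [← hy]
    simp only [Matrix.mul_assoc]
    rw [huu', Matrix.mul_one, ← Matrix.mul_assoc, huu', Matrix.one_mul]
  have hτx : ∀ p, τ p = τ (0, 0) * x p := by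
    intro p
    simp only [x]
    rw [← Matrix.mul_assoc, hτ1, Matrix.one_mul]
  have hmem : τ (0, 0) ∈ Matrix.unitaryGroup (Fin 2) ℂ := Matrix.mem_unitaryGroup_iff.2 (hτ1 _)
  -- From `τ p = τ (0, 0) * x p` and the normal form of `x p`. The determinants multiply to that of
  -- `τ (0, 0)`, the squared length of a column of `O`.
  refine ⟨τ (0, 0) * u, mul_mem hmem hu, uᴴ, Unitary.star_mem hu, ε, ?_, hε, ?_⟩
  · rw [Matrix.det_mul, mul_assoc, ← Matrix.det_mul, huu', hdet, Matrix.det_one, mul_one]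
  · rintro ⟨p1, p2⟩
    change τ (p1, p2) = _
    rw [hτx]
    fin_cases p1 <;> fin_cases p2
    · simp [lastSign, quat, x, hτ0, Matrix.mul_assoc, huu']
    · simp only [Fin.zero_eta, Fin.mk_one, hc _ _ hu1]
      simp [lastSign, Matrix.mul_assoc]
    · simp only [Fin.zero_eta, Fin.mk_one, hc _ _ hu2]
      simp [lastSign, Matrix.mul_assoc]
    · simp only [Fin.mk_one, hx3]
      simp [lastSign, Matrix.mul_assoc]

end TwoQubits

/-! ### The magic basis and the normal form of two-qubit unitaries. -/

section TwoQubitCircuits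

open scoped Kronecker

/-- The magic basis of two qubits: its vectors are the quaternion units. -/
noncomputable def magic : Matrix (Fin 2 × Fin 2) (Fin 2 × Fin 2) ℂ :=
  Matrix.of fun x p => ((√2 : ℝ) : ℂ)⁻¹ * quat p x.1 x.2

noncomputable def pairPhase (α : Fin 2 → ℝ) (p : Fin 2 × Fin 2) : ℂ :=
  if p.1 = 0 then Complex.exp (α p.2 * Complex.I) else Complex.exp (-(α p.2 * Complex.I))

noncomputable def parityPhase (ψ : ℝ) (x : Fin 2 × Fin 2) : ℂ :=
  if x.1 = x.2 then Complex.exp (ψ * Complex.I) else Complex.exp (-(ψ * Complex.I))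

theorem magic_conjTranspose_mul : magicᴴ * magic = 1 := by
  have h := sqrt_two_inv_mul_self
  ext ⟨p1, p2⟩ ⟨q1, q2⟩
  rw [Matrix.mul_apply, Fintype.sum_prod_type]
  simp only [Fin.sum_univ_two, Matrix.conjTranspose_apply, magic, Matrix.of_apply]
  fin_cases p1 <;> fin_cases p2 <;> fin_cases q1 <;> fin_cases q2 <;>
    simp [quat] <;> first | linear_combination (2 : ℂ) * h | skip
  all_goals linear_combination (2 : ℂ) * h -
    (2 : ℂ) * ((√2 : ℝ) : ℂ)⁻¹ * ((√2 : ℝ) : ℂ)⁻¹ * Complex.I_mul_I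

theorem magic_mul_conjTranspose : magic * magicᴴ = 1 :=
  mul_eq_one_comm.1 magic_conjTranspose_mul

theorem magic_mem : magic ∈ Matrix.unitaryGroup (Fin 2 × Fin 2) ℂ :=
  Matrix.mem_unitaryGroup_iff.2 magic_mul_conjTranspose

/-- Units with first index 0 are diagonal matrices, the others antidiagonal, so each magic vector
has a definite parity. -/
theorem parityPhase_mul_magic (ψ : ℝ) :
    Matrix.diagonal (parityPhase ψ) * magic = magic * Matrix.diagonal (pairPhase fun _ => ψ) := by
  ext ⟨x1, x2⟩ ⟨p1, p2⟩
  rw [Matrix.diagonal_mul, Matrix.mul_diagonal]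
  fin_cases x1 <;> fin_cases x2 <;> fin_cases p1 <;> fin_cases p2 <;>
    simp [magic, quat, parityPhase, pairPhase, mul_comm]

/-- The magic basis turns the spin flip into the transpose. -/
theorem kronecker_mul_magic {O : Matrix (Fin 2 × Fin 2) (Fin 2 × Fin 2) ℝ}
    {a b : Matrix (Fin 2) (Fin 2) ℂ} {ε : ℂ}
    (h : ∀ p, ∑ q, (O q p : ℂ) • quat q = lastSign ε p • (a * quat p * b)) :
    magic * O.map Complex.ofReal = (a ⊗ₖ bᵀ) * magic * Matrix.diagonal (lastSign ε) := by
  ext ⟨x1, x2⟩ p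
  -- Read as a vector of its entries, `a q b` is `a ⊗ₖ bᵀ` applied to `q`.
  have h1 := congrFun (congrFun (h p) x1) x2
  rw [Matrix.sum_apply, Matrix.smul_apply] at h1
  simp only [Matrix.smul_apply, smul_eq_mul] at h1
  rw [Matrix.mul_diagonal, Matrix.mul_apply, Matrix.mul_apply]
  simp only [magic, Matrix.of_apply, Matrix.map_apply, Matrix.kroneckerMap_apply,
    Matrix.transpose_apply]
  have h2 : ∑ q, ((√2 : ℝ) : ℂ)⁻¹ * quat q x1 x2 * (O q p : ℂ) =
      ((√2 : ℝ) : ℂ)⁻¹ * ∑ q, (O q p : ℂ) * quat q x1 x2 := by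
    rw [Finset.mul_sum]
    exact Finset.sum_congr rfl fun q _ => by ring
  rw [h2, h1]
  simp only [Matrix.mul_apply, Fintype.sum_prod_type, Fin.sum_univ_two]
  ring

/-- With product 1 on the unit circle, the conjugate of each number is the product of the other
three. If the sum is real, it therefore equals the third elementary symmetric function, and this
makes `(e₀ e₁ - 1)(e₀ e₂ - 1)(e₀ e₃ - 1)` vanish. Once one pair multiplies to 1, so does the
complementary pair. -/
theorem exists_perm_pairing {e : Fin 2 × Fin 2 → ℂ} (he : ∀ p, ‖e p‖ = 1) (hprod : ∏ p, e p = 1)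
    (hsum : (∑ p, e p).im = 0) :
    ∃ τ : Equiv.Perm (Fin 2 × Fin 2), ∀ k, e (τ (0, k)) * e (τ (1, k)) = 1 := by
  rw [Fintype.prod_prod_type, Fin.prod_univ_two, Fin.prod_univ_two, Fin.prod_univ_two] at hprod
  rw [Fintype.sum_prod_type, Fin.sum_univ_two, Fin.sum_univ_two, Fin.sum_univ_two] at hsum
  have hc : ∀ p, e p * (starRingEnd ℂ) (e p) = 1 := fun p => by
    rw [Complex.mul_conj', he]; simp
  have hconj := Complex.conj_eq_iff_im.2 hsum
  simp only [map_add] at hconj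
  have ha : (starRingEnd ℂ) (e (0, 0)) = e (0, 1) * e (1, 0) * e (1, 1) := by
    linear_combination (-(starRingEnd ℂ) (e (0, 0))) * hprod +
      e (0, 1) * e (1, 0) * e (1, 1) * hc (0, 0)
  have hb : (starRingEnd ℂ) (e (0, 1)) = e (0, 0) * e (1, 0) * e (1, 1) := by
    linear_combination (-(starRingEnd ℂ) (e (0, 1))) * hprod +
      e (0, 0) * e (1, 0) * e (1, 1) * hc (0, 1)
  have hc' : (starRingEnd ℂ) (e (1, 0)) = e (0, 0) * e (0, 1) * e (1, 1) := by
    linear_combination (-(starRingEnd ℂ) (e (1, 0))) * hprod +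
      e (0, 0) * e (0, 1) * e (1, 1) * hc (1, 0)
  have hd : (starRingEnd ℂ) (e (1, 1)) = e (0, 0) * e (0, 1) * e (1, 0) := by
    linear_combination (-(starRingEnd ℂ) (e (1, 1))) * hprod +
      e (0, 0) * e (0, 1) * e (1, 0) * hc (1, 1)
  rw [ha, hb, hc', hd] at hconj
  have key : (e (0, 0) * e (0, 1) - 1) * ((e (0, 0) * e (1, 0) - 1) *
      (e (0, 0) * e (1, 1) - 1)) = 0 := by
    linear_combination (e (0, 0) ^ 2 + 1) * hprod - e (0, 0) * hconj
  rcases mul_eq_zero.1 key with h | h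
  · refine ⟨Equiv.swap (0, 1) (1, 0), fun k => ?_⟩
    fin_cases k
    · change e (0, 0) * e (0, 1) = 1
      linear_combination h
    · change e (1, 0) * e (1, 1) = 1
      linear_combination hprod - e (1, 0) * e (1, 1) * h
  rcases mul_eq_zero.1 h with h | h
  · refine ⟨1, fun k => ?_⟩
    fin_cases k
    · change e (0, 0) * e (1, 0) = 1
      linear_combination h
    · change e (0, 1) * e (1, 1) = 1
      linear_combination hprod - e (0, 1) * e (1, 1) * h
  · refine ⟨Equiv.swap (1, 0) (1, 1), fun k => ?_⟩
    fin_cases k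
    · change e (0, 0) * e (1, 1) = 1
      linear_combination h
    · change e (0, 1) * e (1, 0) = 1
      linear_combination hprod - e (0, 1) * e (1, 0) * h

/-- With `t = 2 ψ` the imaginary part is `sin t (Re z - Re w) + cos t (Im z + Im w)`, which vanishes
for some `t`. It serves to make a trace real. -/
theorem exists_im_eq_zero (z w : ℂ) : ∃ ψ : ℝ,
    (Complex.exp (ψ * Complex.I) ^ 2 * z + Complex.exp (-(ψ * Complex.I)) ^ 2 * w).im = 0 := by
  have key : ∃ t : ℝ, Real.sin t * (z.re - w.re) + Real.cos t * (z.im + w.im) = 0 := by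
    by_cases h : z.re - w.re = 0
    · exact ⟨Real.pi / 2, by rw [h, Real.cos_pi_div_two]; ring⟩
    · refine ⟨Real.arctan (-(z.im + w.im) / (z.re - w.re)), ?_⟩
      have h1 := Real.tan_arctan (-(z.im + w.im) / (z.re - w.re))
      rw [Real.tan_eq_sin_div_cos, div_eq_div_iff (Real.cos_arctan_pos _).ne' h] at h1
      linarith
  obtain ⟨t, ht⟩ := key
  refine ⟨t / 2, ?_⟩
  have h1 : Complex.exp (((t / 2 : ℝ) : ℂ) * Complex.I) ^ 2 =
      (Real.cos t : ℂ) + (Real.sin t : ℂ) * Complex.I := by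
    rw [← Complex.exp_nat_mul, Complex.ofReal_cos, Complex.ofReal_sin, ← Complex.exp_mul_I]
    congr 1
    push_cast
    ring
  have h2 : Complex.exp (-(((t / 2 : ℝ) : ℂ) * Complex.I)) ^ 2 =
      (Real.cos t : ℂ) - (Real.sin t : ℂ) * Complex.I := by
    have : (Real.cos t : ℂ) - (Real.sin t : ℂ) * Complex.I =
        (Real.cos (-t) : ℂ) + (Real.sin (-t) : ℂ) * Complex.I := by
      rw [Real.cos_neg, Real.sin_neg]; push_cast; ring
    rw [this, ← Complex.exp_nat_mul, Complex.ofReal_cos, Complex.ofReal_sin, ← Complex.exp_mul_I]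
    congr 1
    push_cast
    ring
  rw [h1, h2]
  simp [-Complex.ofReal_cos, -Complex.ofReal_sin]
  linarith

theorem norm_pairPhase (α : Fin 2 → ℝ) (p : Fin 2 × Fin 2) : ‖pairPhase α p‖ = 1 := by
  rw [pairPhase]
  split_ifs
  · exact Complex.norm_exp_ofReal_mul_I _
  · rw [← neg_mul, ← Complex.ofReal_neg]
    exact Complex.norm_exp_ofReal_mul_I _

theorem pairPhase_mul_neg (α : Fin 2 → ℝ) (p : Fin 2 × Fin 2) :
    pairPhase α p * pairPhase (-α) p = 1 := by
  simp only [pairPhase]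
  split_ifs <;> simp [← Complex.exp_add]

theorem prod_pairPhase (α : Fin 2 → ℝ) : ∏ p, pairPhase α p = 1 := by
  simp only [Fintype.prod_prod_type, Fin.prod_univ_two, pairPhase]
  simp only [if_true, one_ne_zero, if_false, ← Complex.exp_add]
  rw [← Complex.exp_zero]
  congr 1
  ring

theorem diagonal_mem_unitaryGroup {ι : Type*} [Fintype ι] [DecidableEq ι] {d : ι → ℂ}
    (hd : ∀ i, ‖d i‖ = 1) : Matrix.diagonal d ∈ Matrix.unitaryGroup ι ℂ := by
  rw [Matrix.mem_unitaryGroup_iff, Matrix.star_eq_conjTranspose, Matrix.diagonal_conjTranspose,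
    Matrix.diagonal_mul_diagonal, ← Matrix.diagonal_one]
  congr 1
  ext i
  rw [Pi.star_apply, ← starRingEnd_apply, Complex.mul_conj', hd]
  simp

/-- A unitary matrix with `Kᵀ * K = 1` is real. -/
theorem exists_real_of_unitary {ι : Type*} [Fintype ι] [DecidableEq ι] {K : Matrix ι ι ℂ}
    (hK : K ∈ Matrix.unitaryGroup ι ℂ) (h : Kᵀ * K = 1) :
    ∃ O : Matrix ι ι ℝ, Oᵀ * O = 1 ∧ K = O.map Complex.ofReal := by
  have h1 : Kᴴ = Kᵀ := by
    have h2 : K * Kᴴ = 1 := Matrix.mem_unitaryGroup_iff.1 hK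
    rw [← Matrix.one_mul Kᴴ, ← h, Matrix.mul_assoc, h2, Matrix.mul_one]
  have h3 : K = (K.map Complex.re).map Complex.ofReal := by
    ext i j
    have h4 := congrFun (congrFun h1 j) i
    rw [Matrix.conjTranspose_apply, Matrix.transpose_apply] at h4
    exact (Complex.conj_eq_iff_re.1 h4).symm
  refine ⟨K.map Complex.re, ?_, h3⟩
  have h5 : ((K.map Complex.re)ᵀ * K.map Complex.re).map Complex.ofRealHom = 1 := by
    rw [Matrix.map_mul, ← h]
    conv_rhs => rw [h3]
    rfl
  ext i j
  have h6 := congrFun (congrFun h5 i) j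
  rw [Matrix.map_apply] at h6
  apply Complex.ofReal_injective
  rw [← Complex.ofRealHom_eq_coe, h6, Matrix.one_apply, Matrix.one_apply]
  split_ifs <;> simp

theorem diagonal_lastSign_mul_self {ε : ℂ} (hε : ε = 1 ∨ ε = -1) :
    Matrix.diagonal (lastSign ε) * Matrix.diagonal (lastSign ε) = 1 := by
  rw [Matrix.diagonal_mul_diagonal, ← Matrix.diagonal_one]
  congr 1
  ext p
  simp only [lastSign]
  split_ifs
  · rcases hε with rfl | rfl <;> simp
  · simp

set_option maxHeartbeats 400000 in
/-- Any two-qubit unitary becomes, up to single-qubit gates, diagonal in the magic basis with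
conjugate pairs of eigenvalues, when it is preceded by a suitable diagonal gate. -/
theorem exists_magic_diagonal {U : Matrix (Fin 2 × Fin 2) (Fin 2 × Fin 2) ℂ}
    (hU : U ∈ Matrix.unitaryGroup (Fin 2 × Fin 2) ℂ) :
    ∃ (ψ : ℝ) (α : Fin 2 → ℝ), ∃ a ∈ Matrix.unitaryGroup (Fin 2) ℂ,
      ∃ b ∈ Matrix.unitaryGroup (Fin 2) ℂ, ∃ c ∈ Matrix.unitaryGroup (Fin 2) ℂ,
      ∃ d ∈ Matrix.unitaryGroup (Fin 2) ℂ,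
      U * Matrix.diagonal (parityPhase ψ) =
        (a ⊗ₖ b) * (magic * Matrix.diagonal (pairPhase α) * magicᴴ) * (c ⊗ₖ d) := by
  -- normalise the determinant
  obtain ⟨z, hz, hzdet⟩ : ∃ z : ℂ, ‖z‖ = 1 ∧ z ^ 4 * U.det = 1 := by
    have h1 : ‖U.det‖ = 1 := by
      have h2 := congrArg Matrix.det (Matrix.mem_unitaryGroup_iff.1 hU)
      rw [Matrix.det_mul, Matrix.star_eq_conjTranspose, Matrix.det_conjTranspose, Matrix.det_one,
        ← starRingEnd_apply, Complex.mul_conj'] at h2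
      have h3 : ‖U.det‖ ^ 2 = 1 := by exact_mod_cast h2
      nlinarith [norm_nonneg U.det]
    obtain ⟨y, hy⟩ := (Complex.norm_eq_one_iff _).1 h1
    refine ⟨Complex.exp (((-y / 4 : ℝ) : ℂ) * Complex.I), Complex.norm_exp_ofReal_mul_I _, ?_⟩
    rw [← hy, ← Complex.exp_nat_mul, ← Complex.exp_add, ← Complex.exp_zero]
    congr 1
    push_cast
    ring
  have hz0 : z ≠ 0 := by rintro rfl; simp at hz
  set X := magicᴴ * (z • U) * magic with hX
  have hXmem : X ∈ Matrix.unitaryGroup (Fin 2 × Fin 2) ℂ :=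
    mul_mem (mul_mem (Unitary.star_mem magic_mem) (smul_mem_unitaryGroup hz hU)) magic_mem
  have hmdet : (magicᴴ).det * magic.det = 1 := by
    rw [← Matrix.det_mul, magic_conjTranspose_mul, Matrix.det_one]
  have hXdet : X.det = 1 := by
    rw [hX, Matrix.det_mul, Matrix.det_mul, Matrix.det_smul]
    simp only [Fintype.card_prod, Fintype.card_fin]
    linear_combination hmdet * z ^ 4 * U.det + hzdet
  -- make the trace real
  obtain ⟨ψ, hψ⟩ := exists_im_eq_zero ((Xᵀ * X) (0, 0) (0, 0) + (Xᵀ * X) (0, 1) (0, 1))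
    ((Xᵀ * X) (1, 0) (1, 0) + (Xᵀ * X) (1, 1) (1, 1))
  -- The parity gate in the magic basis. It multiplies the two halves of the diagonal of `Xᵀ * X` by
  -- `exp (± 2 i ψ)`, which is how `ψ` controls the trace.
  set E := Matrix.diagonal (pairPhase fun _ => ψ) with hE
  have hEmem : E ∈ Matrix.unitaryGroup (Fin 2 × Fin 2) ℂ :=
    diagonal_mem_unitaryGroup (norm_pairPhase _)
  have hEdet : E.det = 1 := by rw [hE, Matrix.det_diagonal, prod_pairPhase]
  set Y := X * E with hY
  have hYmem : Y ∈ Matrix.unitaryGroup (Fin 2 × Fin 2) ℂ := mul_mem hXmem hEmem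
  have hYdet : Y.det = 1 := by rw [hY, Matrix.det_mul, hXdet, hEdet, one_mul]
  have hYt : Yᵀ ∈ Matrix.unitaryGroup (Fin 2 × Fin 2) ℂ := by
    rw [Matrix.mem_unitaryGroup_iff]
    have h1 := congrArg Matrix.transpose (Matrix.mem_unitaryGroup_iff'.1 hYmem)
    rw [Matrix.transpose_mul, Matrix.transpose_one] at h1
    rw [← h1]
    rfl
  -- A left real orthogonal factor of `Y` disappears from the symmetric unitary `Yᵀ * Y`. Its
  -- eigenvalues have product `det Y ^ 2 = 1` and real sum, so they can be paired.
  obtain ⟨O, e, hO, he, hG⟩ := exists_orthogonal_diagonalization (mul_mem hYt hYmem)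
    (by rw [Matrix.transpose_mul, Matrix.transpose_transpose])
  set Oc := O.map Complex.ofReal with hOc
  have hOO : Oᵀ.map Complex.ofReal * Oc = 1 := by
    have := congrArg (fun M => M.map Complex.ofRealHom) hO
    rw [Matrix.map_mul, Matrix.map_one _ (map_zero _) (map_one _)] at this
    exact this
  have hprod : ∏ p, e p = 1 := by
    have h1 := congrArg Matrix.det hG
    have h2 := congrArg Matrix.det hOO
    rw [Matrix.det_mul, Matrix.det_one] at h2
    rw [Matrix.det_mul, Matrix.det_transpose, hYdet, Matrix.det_mul, Matrix.det_mul,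
      Matrix.det_diagonal] at h1
    linear_combination -h1 - (∏ p, e p) * h2
  have hsum : (∑ p, e p).im = 0 := by
    have h1 : ∑ p, e p = (Yᵀ * Y).trace := by
      rw [hG, Matrix.trace_mul_cycle, hOO, Matrix.one_mul, Matrix.trace_diagonal]
    rw [h1, ← hψ, hY, Matrix.transpose_mul, Matrix.mul_assoc, ← Matrix.mul_assoc Xᵀ, hE,
      Matrix.diagonal_transpose, Matrix.trace, Fintype.sum_prod_type]
    simp only [Fin.sum_univ_two, Matrix.diag_apply, Matrix.diagonal_mul, Matrix.mul_diagonal,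
      pairPhase, if_true, one_ne_zero, if_false]
    congr 1
    ring
  obtain ⟨τ, hτ⟩ := exists_perm_pairing he hprod hsum
  choose α hα using fun k => exists_exp_mul_I_sq (he (τ (0, k)))
  set D := Matrix.diagonal (pairPhase α) with hD
  set D' := Matrix.diagonal (pairPhase (-α)) with hD'
  have hDD' : D * D' = 1 := by
    rw [hD, hD', Matrix.diagonal_mul_diagonal, ← Matrix.diagonal_one]
    congr 1
    ext p
    exact pairPhase_mul_neg α p
  have hD'D : D' * D = 1 := mul_eq_one_comm.1 hDD'
  have hDsq : ∀ p, pairPhase α p * pairPhase α p = e (τ p) := by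
    rintro ⟨p1, p2⟩
    fin_cases p1
    · simp only [pairPhase, Fin.zero_eta, if_true]
      rw [← sq, hα]
    · simp only [pairPhase, Fin.mk_one, one_ne_zero, if_false]
      have h1 := hτ p2
      rw [← hα p2] at h1
      rw [Complex.exp_neg]
      have h3 : Complex.exp (α p2 * Complex.I) ≠ 0 := Complex.exp_ne_zero _
      field_simp
      linear_combination -h1
  -- the eigenbasis in the paired order
  set P := O.submatrix id τ with hP
  set Pc := P.map Complex.ofReal with hPc
  have hPO : Pᵀ * P = 1 := by
    rw [hP, Matrix.transpose_submatrix, ← Matrix.submatrix_mul _ _ _ _ _ Function.bijective_id, hO,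
      Matrix.submatrix_one_equiv]
  have hPP : Pcᵀ * Pc = 1 := by
    have := congrArg (fun M => M.map Complex.ofRealHom) hPO
    rw [Matrix.map_mul, Matrix.map_one _ (map_zero _) (map_one _)] at this
    exact this
  have hPmem : Pc ∈ Matrix.unitaryGroup (Fin 2 × Fin 2) ℂ := by
    rw [Matrix.mem_unitaryGroup_iff', ← hPP]
    congr 1
    ext i j
    simp [hPc, Matrix.star_apply]
  have hPP' : Pc * Pcᵀ = 1 := mul_eq_one_comm.1 hPP
  have hGP : Yᵀ * Y = Pc * (D * D) * Pcᵀ := by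
    have h1 : D * D = (Matrix.diagonal e).submatrix τ τ := by
      rw [hD, Matrix.diagonal_mul_diagonal, Matrix.submatrix_diagonal_equiv]
      congr 1
      ext p
      exact hDsq p
    have h2 : Pc = Oc.submatrix id τ := rfl
    have h3 : Pcᵀ = (Oᵀ.map Complex.ofReal).submatrix τ id := rfl
    rw [h1, h2, ← h2, h3, h2, Matrix.submatrix_mul_equiv, Matrix.submatrix_mul_equiv, hG]
    rfl
  -- As `D` is a square root of the eigenvalue matrix of `Yᵀ * Y`, this choice gives `Kᵀ * K = 1`;
  -- being also unitary, `K` is real orthogonal, and `Y = K * D * Pcᵀ`.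
  set K := Y * Pc * D' with hK
  have hKmem : K ∈ Matrix.unitaryGroup (Fin 2 × Fin 2) ℂ :=
    mul_mem (mul_mem hYmem hPmem) (diagonal_mem_unitaryGroup (norm_pairPhase _))
  have hKK : Kᵀ * K = 1 := by
    have h1 : Kᵀ * K = D' * (Pcᵀ * (Yᵀ * Y) * Pc) * D' := by
      rw [hK, Matrix.transpose_mul, Matrix.transpose_mul]
      have : D'ᵀ = D' := Matrix.diagonal_transpose _
      rw [this]
      simp only [Matrix.mul_assoc]
    have h2 : Pcᵀ * (Yᵀ * Y) * Pc = D * D := by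
      rw [hGP]
      simp only [← Matrix.mul_assoc, hPP, Matrix.one_mul]
      rw [Matrix.mul_assoc, hPP, Matrix.mul_one]
    rw [h1, h2, ← Matrix.mul_assoc, hD'D, Matrix.one_mul, hDD']
  have hYK : Y = K * D * Pcᵀ := by
    rw [hK, Matrix.mul_assoc _ D' D, hD'D, Matrix.mul_one, Matrix.mul_assoc, hPP', Matrix.mul_one]
  obtain ⟨Kr, hKr, hKKr⟩ := exists_real_of_unitary hKmem hKK
  obtain ⟨a, ha, b, hb, ε, hab, hε, h1⟩ := exists_quat_of_orthogonal hKr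
  obtain ⟨c, hc, d, hd, δ, hcd, hδ, h2⟩ := exists_quat_of_orthogonal hPO
  have h1 := kronecker_mul_magic h1
  have h2 := kronecker_mul_magic h2
  rw [← hKKr] at h1
  rw [← hPc] at h2
  have hdetm : magic.det ≠ 0 := right_ne_zero_of_mul_eq_one hmdet
  have hdet : ∀ {M : Matrix (Fin 2 × Fin 2) (Fin 2 × Fin 2) ℂ}
      {a b : Matrix (Fin 2) (Fin 2) ℂ} {ε : ℂ}, a.det * b.det = 1 →
      magic * M = (a ⊗ₖ bᵀ) * magic * Matrix.diagonal (lastSign ε) → M.det = ε := by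
    intro M a b ε hab h
    have h3 := congrArg Matrix.det h
    have h4 : ∏ p, lastSign ε p = ε := by
      rw [Fintype.prod_prod_type, Fin.prod_univ_two, Fin.prod_univ_two, Fin.prod_univ_two]
      simp [lastSign]
    simp only [Matrix.det_mul, Matrix.det_kronecker, Matrix.det_transpose, Matrix.det_diagonal, h4,
      Fintype.card_fin] at h3
    apply mul_left_cancel₀ hdetm
    rw [h3]
    linear_combination (a.det * b.det + 1) * magic.det * ε * hab
  have hDdet : D.det = 1 := by rw [hD, Matrix.det_diagonal, prod_pairPhase]
  -- The signs are the determinants of `K` and `Pc`, whose product is 1 because `Y` and `D` have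
  -- determinant 1.
  have hεδ : ε = δ := by
    have h3 := congrArg Matrix.det hYK
    rw [hYdet, Matrix.det_mul, Matrix.det_mul, Matrix.det_transpose, hDdet, hdet hab h1,
      hdet hcd h2] at h3
    rcases hε with rfl | rfl <;> rcases hδ with rfl | rfl <;> first | rfl | norm_num at h3
  subst hεδ
  have hPct : Pcᵀ = Pcᴴ := by
    ext i j
    simp [hPc]
  have hU' : U * Matrix.diagonal (parityPhase ψ) = z⁻¹ • (magic * Y * magicᴴ) := by
    have h3 : magic * Y * magicᴴ = z • (U * (magic * E * magicᴴ)) := by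
      rw [hY, hX]
      simp only [← Matrix.mul_assoc, magic_mul_conjTranspose, Matrix.one_mul]
      simp only [Matrix.smul_mul, Matrix.mul_assoc]
    have h4 : magic * E * magicᴴ = Matrix.diagonal (parityPhase ψ) := by
      rw [hE, ← parityPhase_mul_magic, Matrix.mul_assoc, magic_mul_conjTranspose, Matrix.mul_one]
    rw [h3, h4, smul_smul, inv_mul_cancel₀ hz0, one_smul]
  have hL : (Matrix.diagonal (lastSign ε))ᴴ = Matrix.diagonal (lastSign ε) := by
    rw [Matrix.diagonal_conjTranspose]
    congr 1
    ext p
    simp only [Pi.star_apply, lastSign]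
    rcases hε with rfl | rfl <;> split_ifs <;> simp
  -- The two reflections, being equal and diagonal, cancel across `D`; only local gates remain
  -- outside.
  have hLDL : Matrix.diagonal (lastSign ε) * D * Matrix.diagonal (lastSign ε) = D := by
    have h5 : Matrix.diagonal (lastSign ε) * D = D * Matrix.diagonal (lastSign ε) := by
      rw [hD, Matrix.diagonal_mul_diagonal, Matrix.diagonal_mul_diagonal]
      simp only [mul_comm]
    rw [h5, Matrix.mul_assoc, diagonal_lastSign_mul_self hε, Matrix.mul_one]
  have htr : ∀ {b : Matrix (Fin 2) (Fin 2) ℂ}, b ∈ Matrix.unitaryGroup (Fin 2) ℂ →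
      bᵀ ∈ Matrix.unitaryGroup (Fin 2) ℂ := by
    intro b hb
    rw [Matrix.mem_unitaryGroup_iff]
    have h1 := congrArg Matrix.transpose (Matrix.mem_unitaryGroup_iff'.1 hb)
    rw [Matrix.transpose_mul, Matrix.transpose_one] at h1
    rw [← h1]
    rfl
  refine ⟨ψ, α, z⁻¹ • a, smul_mem_unitaryGroup (by simp [hz]) ha, bᵀ, htr hb, cᴴ,
    Unitary.star_mem hc, (dᵀ)ᴴ, Unitary.star_mem (htr hd), ?_⟩
  have h3 : magic * Y * magicᴴ = (magic * K) * D * (magic * Pc)ᴴ := by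
    rw [hYK, hPct, Matrix.conjTranspose_mul]
    simp only [Matrix.mul_assoc]
  rw [hU', h3, h1, h2, Matrix.conjTranspose_mul, Matrix.conjTranspose_mul, hL,
    Matrix.conjTranspose_kronecker, Matrix.smul_kronecker, Matrix.smul_mul, Matrix.smul_mul]
  refine congrArg (fun M => z⁻¹ • M) ?_
  conv_rhs => rw [← hD, ← hLDL]
  simp only [Matrix.mul_assoc]

end TwoQubitCircuits

/-! ### Two-qubit unitaries with two CNOTs up to a diagonal, and with three. -/

section TwoQubitSynthesis

open scoped Kronecker

/-- A pair of bits, the more significant one first. -/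
def bitPair : BitString 2 ≃ Fin 2 × Fin 2 :=
  (finTwoArrowEquiv (Fin 2)).trans (Equiv.prodComm _ _)

theorem bitPair_apply (b : BitString 2) : bitPair b = (b 1, b 0) := rfl

theorem single_mul_single_eq_kronecker (a b : Matrix (Fin 2) (Fin 2) ℂ) :
    singleQubitMatrix (1 : Fin 2) a * singleQubitMatrix 0 b =
      (a ⊗ₖ b).submatrix bitPair bitPair := by
  rw [singleQubitMatrix_eq_ctl (1 : Fin 2)]
  ext x y
  have h1 : ∀ x', ctl (1 : Fin 2) (fun _ => a) x x' * singleQubitMatrix 0 b x' y =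
      if ∀ i, i ≠ 1 → x i = x' i then a (x 1) (x' 1) * singleQubitMatrix 0 b x' y else 0 := by
    intro x'
    simp only [ctl, Matrix.of_apply, ite_mul, zero_mul]
  rw [Matrix.mul_apply]
  simp only [h1]
  rw [sum_agree_off 1 x fun x' => a (x 1) (x' 1) * singleQubitMatrix 0 b x' y]
  simp [singleQubitMatrix, bitPair_apply, Fin.forall_fin_two]

/-- The controlled-NOT gate with the more significant qubit as its control. -/
def cnotPair : Matrix (Fin 2 × Fin 2) (Fin 2 × Fin 2) ℂ :=
  Matrix.of fun x y => if x = (y.1, y.2 + y.1) then 1 else 0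

theorem cnotMatrix_one_zero :
    cnotMatrix (1 : Fin 2) 0 = cnotPair.submatrix bitPair bitPair := by
  ext x y
  simp only [cnotMatrix, cnotPair, Matrix.of_apply, Matrix.submatrix_apply, bitPair_apply]
  refine if_congr ?_ rfl rfl
  rw [funext_iff, Fin.forall_fin_two, Prod.mk.injEq]
  simp [and_comm]

theorem cnotPair_mul {κ : Type*} (N : Matrix (Fin 2 × Fin 2) κ ℂ) (x y : Fin 2) (k : κ) :
    (cnotPair * N) (x, y) k = N (x, y + x) k := by
  rw [Matrix.mul_apply, Finset.sum_eq_single (x, y + x)]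
  · fin_cases x <;> fin_cases y <;> simp [cnotPair]
  · rintro ⟨z, w⟩ _ h
    rw [cnotPair, Matrix.of_apply, if_neg, zero_mul]
    intro h2
    apply h
    obtain ⟨rfl, rfl⟩ := Prod.mk.injEq .. ▸ h2
    fin_cases x <;> fin_cases w <;> rfl
  · simp

theorem cnotPair_mul_self : cnotPair * cnotPair = 1 := by
  ext ⟨x, y⟩ k
  rw [cnotPair_mul]
  obtain ⟨z, w⟩ := k
  fin_cases x <;> fin_cases y <;> fin_cases z <;> fin_cases w <;> simp [cnotPair]

theorem kronecker_one_rotZ_mul (ψ : ℝ) {κ : Type*} (N : Matrix (Fin 2 × Fin 2) κ ℂ) (x y : Fin 2)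
    (k : κ) : ((1 : Matrix (Fin 2) (Fin 2) ℂ) ⊗ₖ rotZ ψ * N) (x, y) k =
      (if y = 0 then Complex.exp (ψ * Complex.I) else Complex.exp (-(ψ * Complex.I))) *
        N (x, y) k := by
  rw [Matrix.mul_apply, Fintype.sum_prod_type]
  fin_cases x <;> fin_cases y <;> simp [rotZ]

theorem diagonal_parityPhase (ψ : ℝ) : Matrix.diagonal (parityPhase ψ) =
    cnotPair * ((1 : Matrix (Fin 2) (Fin 2) ℂ) ⊗ₖ rotZ ψ * cnotPair) := by
  ext ⟨x, y⟩ ⟨z, w⟩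
  rw [cnotPair_mul, kronecker_one_rotZ_mul]
  fin_cases x <;> fin_cases y <;> fin_cases z <;> fin_cases w <;>
    simp [cnotPair, parityPhase]

noncomputable def rotX (x : ℝ) : Matrix (Fin 2) (Fin 2) ℂ := hadamard * rotZ x * hadamard

theorem rotX_mem (x : ℝ) : rotX x ∈ Matrix.unitaryGroup (Fin 2) ℂ :=
  mul_mem (mul_mem hadamard_mem (isReversedBy_rotZ.mem x)) hadamard_mem

theorem rotX_eq (x : ℝ) : rotX x = (2 : ℂ)⁻¹ •
    !![Complex.exp (x * Complex.I) + Complex.exp (-(x * Complex.I)),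
      Complex.exp (x * Complex.I) - Complex.exp (-(x * Complex.I));
      Complex.exp (x * Complex.I) - Complex.exp (-(x * Complex.I)),
      Complex.exp (x * Complex.I) + Complex.exp (-(x * Complex.I))] := by
  rw [rotX, hadamard, rotZ, Matrix.smul_mul, Matrix.smul_mul, Matrix.mul_smul, smul_smul,
    sqrt_two_inv_mul_self]
  congr 1
  ext i j
  fin_cases i <;> fin_cases j <;> simp [sub_eq_add_neg]

theorem kronecker_rotX_rotZ_mul (a b : ℝ) {κ : Type*} (N : Matrix (Fin 2 × Fin 2) κ ℂ)
    (x y : Fin 2) (k : κ) : (rotX a ⊗ₖ rotZ b * N) (x, y) k =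
      (if y = 0 then Complex.exp (b * Complex.I) else Complex.exp (-(b * Complex.I))) *
        (rotX a x 0 * N (0, y) k + rotX a x 1 * N (1, y) k) := by
  rw [Matrix.mul_apply, Fintype.sum_prod_type]
  fin_cases y <;> simp [rotZ] <;> ring

/-- The magic vectors are Bell states up to phases. A CNOT turns each into a product of an X
eigenvector on the control and a basis state on the target, where phases are applied by `rotX` and
`rotZ`. The phases `± α 0`, `± α 1` are the signed sums of the two rotation angles. -/
theorem magic_diagonal_eq (α : Fin 2 → ℝ) :
    magic * Matrix.diagonal (pairPhase α) * magicᴴ = cnotPair *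
      (rotX ((α 0 - α 1) / 2) ⊗ₖ rotZ ((α 0 + α 1) / 2)) * cnotPair := by
  have key : cnotPair * ((rotX ((α 0 - α 1) / 2) ⊗ₖ rotZ ((α 0 + α 1) / 2)) *
      (cnotPair * magic)) = magic * Matrix.diagonal (pairPhase α) := by
    set A := (α 0 - α 1) / 2 with hA
    set B := (α 0 + α 1) / 2 with hB
    have h0 : α 0 = A + B := by rw [hA, hB]; ring
    have h1 : α 1 = B - A := by rw [hA, hB]; ring
    ext ⟨x, y⟩ ⟨p, q⟩
    rw [cnotPair_mul, kronecker_rotX_rotZ_mul, cnotPair_mul, cnotPair_mul, Matrix.mul_diagonal,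
      rotX_eq, pairPhase]
    fin_cases x <;> fin_cases y <;> fin_cases p <;> fin_cases q <;>
      simp [magic, quat, h0, h1, add_mul, sub_mul, Complex.exp_add, Complex.exp_sub,
        Complex.exp_neg] <;> ring
  rw [← key]
  simp only [Matrix.mul_assoc, magic_mul_conjTranspose, Matrix.mul_one]

/-- The two-qubit circuits with two controlled-NOT gates and free single-qubit gates. -/
def twoCnotCircuits : Set (Matrix (BitString 2) (BitString 2) ℂ) :=
  {M | ∃ a ∈ Matrix.unitaryGroup (Fin 2) ℂ, ∃ b ∈ Matrix.unitaryGroup (Fin 2) ℂ,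
    ∃ e ∈ Matrix.unitaryGroup (Fin 2) ℂ, ∃ f ∈ Matrix.unitaryGroup (Fin 2) ℂ,
    ∃ c ∈ Matrix.unitaryGroup (Fin 2) ℂ, ∃ d ∈ Matrix.unitaryGroup (Fin 2) ℂ,
    M = singleQubitMatrix 1 a * singleQubitMatrix 0 b *
      (cnotMatrix 1 0 * (singleQubitMatrix 1 e * singleQubitMatrix 0 f *
        (cnotMatrix 1 0 * (singleQubitMatrix 1 c * singleQubitMatrix 0 d))))}

theorem synth_two_singles : Synth 0 {M : Matrix (BitString 2) (BitString 2) ℂ |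
    ∃ a ∈ Matrix.unitaryGroup (Fin 2) ℂ, ∃ b ∈ Matrix.unitaryGroup (Fin 2) ℂ,
    M = singleQubitMatrix 1 a * singleQubitMatrix 0 b} := by
  refine (synth_single 1).mul (synth_single 0) ?_
  rintro _ ⟨a, ha, b, hb, rfl⟩
  exact ⟨_, ⟨a, ha, rfl⟩, _, ⟨b, hb, rfl⟩, rfl⟩

theorem synth_twoCnotCircuits : Synth 2 twoCnotCircuits := by
  have h := synth_two_singles.mul ((synth_cnot (1 : Fin 2) 0 (by decide)).mul
    (synth_two_singles.mul ((synth_cnot (1 : Fin 2) 0 (by decide)).mul synth_two_singles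
    (fun M hM => hM)) (fun M hM => hM)) (fun M hM => hM)) (fun M hM => hM)
  refine h.mono ?_ le_rfl
  rintro _ ⟨a, ha, b, hb, e, he, f, hf, c, hc, d, hd, rfl⟩
  exact ⟨_, ⟨a, ha, b, hb, rfl⟩, _, ⟨_, rfl, _, ⟨_, ⟨e, he, f, hf, rfl⟩, _,
    ⟨_, rfl, _, ⟨c, hc, d, hd, rfl⟩, rfl⟩, rfl⟩, rfl⟩, rfl⟩

/-- Any two-qubit unitary is a circuit with two controlled-NOT gates, preceded by a diagonal gate
which is a rotation between two controlled-NOT gates. -/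
theorem exists_twoCnotCircuit {U : Matrix (BitString 2) (BitString 2) ℂ}
    (hU : U ∈ Matrix.unitaryGroup (BitString 2) ℂ) :
    ∃ ψ : ℝ, ∃ M ∈ twoCnotCircuits,
      U = M * (Matrix.diagonal (parityPhase ψ)).submatrix bitPair bitPair ∧
      (Matrix.diagonal (parityPhase ψ)).submatrix bitPair bitPair =
        cnotMatrix 1 0 * (singleQubitMatrix 0 (rotZ ψ) * cnotMatrix 1 0) := by
  have hU' : U.submatrix bitPair.symm bitPair.symm ∈ Matrix.unitaryGroup (Fin 2 × Fin 2) ℂ := by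
    rw [Matrix.mem_unitaryGroup_iff] at hU ⊢
    rw [Matrix.star_eq_conjTranspose, Matrix.conjTranspose_submatrix, Matrix.submatrix_mul_equiv,
      ← Matrix.star_eq_conjTranspose, hU, Matrix.submatrix_one_equiv]
  obtain ⟨ψ, α, a, ha, b, hb, c, hc, d, hd, h⟩ := exists_magic_diagonal hU'
  have hone : (1 : Matrix (Fin 2) (Fin 2) ℂ) ∈ Matrix.unitaryGroup (Fin 2) ℂ := one_mem _
  -- The parity gate was multiplied onto `U`; bringing it to the other side inverts it.
  refine ⟨-ψ, _, ⟨a, ha, b, hb, rotX ((α 0 - α 1) / 2), rotX_mem _, rotZ ((α 0 + α 1) / 2),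
    isReversedBy_rotZ.mem _, c, hc, d, hd, rfl⟩, ?_, ?_⟩
  · rw [magic_diagonal_eq] at h
    simp only [single_mul_single_eq_kronecker, cnotMatrix_one_zero, Matrix.submatrix_mul_equiv]
    have h2 : Matrix.diagonal (parityPhase ψ) * Matrix.diagonal (parityPhase (-ψ)) = 1 := by
      rw [Matrix.diagonal_mul_diagonal, ← Matrix.diagonal_one]
      congr 1
      ext p
      simp only [parityPhase]
      split_ifs <;> simp [← Complex.exp_add]
    have h3 : U.submatrix bitPair.symm bitPair.symm = U.submatrix bitPair.symm bitPair.symm *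
        Matrix.diagonal (parityPhase ψ) * Matrix.diagonal (parityPhase (-ψ)) := by
      rw [Matrix.mul_assoc, h2, Matrix.mul_one]
    rw [h] at h3
    have h4 := congrArg (fun M => M.submatrix bitPair bitPair) h3
    simp only [Matrix.submatrix_submatrix, Equiv.symm_comp_self, Matrix.submatrix_id_id] at h4
    rw [h4]
    simp only [Matrix.mul_assoc]
  · have h1 : singleQubitMatrix (0 : Fin 2) (rotZ (-ψ)) =
        ((1 : Matrix (Fin 2) (Fin 2) ℂ) ⊗ₖ rotZ (-ψ)).submatrix bitPair bitPair := by
      rw [← single_mul_single_eq_kronecker, singleQubitMatrix_eq_ctl 1, ctl_one, Matrix.one_mul]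
    rw [h1, cnotMatrix_one_zero, Matrix.submatrix_mul_equiv, Matrix.submatrix_mul_equiv,
      ← diagonal_parityPhase]

/-- Any two-qubit unitary is a circuit with three controlled-NOT gates. -/
theorem synth_unitary_two :
    Synth 3 {U : Matrix (BitString 2) (BitString 2) ℂ | U ∈ Matrix.unitaryGroup (BitString 2) ℂ} := by
  refine (synth_twoCnotCircuits.mul (synth_cnot (1 : Fin 2) 0 (by decide)) (R := {M | ∃ A ∈
    twoCnotCircuits, M = A * cnotMatrix 1 0}) ?_).mul (synth_single 0) ?_
  · rintro _ ⟨A, hA, rfl⟩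
    exact ⟨A, hA, _, rfl, rfl⟩
  · intro U hU
    have hC : cnotMatrix (1 : Fin 2) 0 * cnotMatrix 1 0 = 1 := by
      rw [cnotMatrix_one_zero, Matrix.submatrix_mul_equiv, cnotPair_mul_self,
        Matrix.submatrix_one_equiv]
    have hCmem : cnotMatrix (1 : Fin 2) 0 ∈ Matrix.unitaryGroup (BitString 2) ℂ := by
      rw [cnotMatrix_eq_ctl (by decide)]
      refine ctl_mem_unitaryGroup _ (fun b x => by rw [Function.update_of_ne (by decide)]) fun b => ?_
      split_ifs
      · rw [Matrix.mem_unitaryGroup_iff]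
        ext i j
        fin_cases i <;> fin_cases j <;> simp [pauliX, Matrix.mul_apply, Matrix.star_apply]
      · exact one_mem _
    -- For `U * CNOT` the parity gate is CNOT · `rotZ` · CNOT, and its last CNOT cancels against the
    -- inserted one. One CNOT and a free rotation remain beside the two of `M`.
    obtain ⟨ψ, M, hM, h1, h2⟩ := exists_twoCnotCircuit (mul_mem hU hCmem)
    refine ⟨_, ⟨M, hM, rfl⟩, _, ⟨rotZ ψ, isReversedBy_rotZ.mem ψ, rfl⟩, ?_⟩
    rw [h2] at h1
    have h3 := congrArg (fun N => N * cnotMatrix (1 : Fin 2) 0) h1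
    simp only [Matrix.mul_assoc, hC, Matrix.mul_one] at h3
    rw [h3]
    simp only [Matrix.mul_assoc]

end TwoQubitSynthesis

/-! ### Block matrices over the top qubit, and the inclusion of the input qubits. -/

section Multiplexers

/-! ### The most significant qubit -/

/-- The bit string with the bit `x` added on top of the bits of `c`. -/
def addTop {n : ℕ} (c : BitString n) (x : Fin 2) : BitString (n + 1) :=
  Fin.snoc (α := fun _ => Fin 2) c x

variable {n m : ℕ} {κ : Type*}

@[simp] theorem addTop_last (c : BitString n) (x : Fin 2) : addTop c x (Fin.last n) = x := by
  simp [addTop]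

@[simp] theorem addTop_castSucc (c : BitString n) (x : Fin 2) (i : Fin n) :
    addTop c x i.castSucc = c i := by
  simp [addTop]

@[simp] theorem addTop_comp_castSucc (c : BitString n) (x : Fin 2) :
    addTop c x ∘ Fin.castSucc = c :=
  funext fun i => addTop_castSucc c x i

@[simp] theorem addTop_self (b : BitString (n + 1)) :
    addTop (b ∘ Fin.castSucc) (b (Fin.last n)) = b := by
  ext1 i
  refine Fin.lastCases ?_ (fun i => ?_) i
  · simp
  · simp

theorem sum_addTop (f : BitString (n + 1) → ℂ) :
    ∑ b, f b = ∑ x, ∑ c, f (addTop c x) := by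
  rw [← (Fin.snocEquiv fun _ : Fin (n + 1) => Fin 2).sum_comp, Fintype.sum_prod_type]
  rfl

theorem Matrix.ext_addTop {M N : Matrix (BitString (n + 1)) κ ℂ}
    (h : ∀ c x k, M (addTop c x) k = N (addTop c x) k) : M = N := by
  ext b k
  rw [← addTop_self b]
  exact h _ _ _

theorem forall_ne_last {b b' : BitString (n + 1)} :
    (∀ i, i ≠ Fin.last n → b i = b' i) ↔ b ∘ Fin.castSucc = b' ∘ Fin.castSucc := by
  constructor
  · exact fun h => funext fun i => h _ (Fin.castSucc_lt_last i).ne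
  · intro h i
    refine Fin.lastCases (fun h => absurd rfl h) (fun i _ => congrFun h i) i

/-- The matrix with blocks `Z 0` and `Z 1`, according to the bit of the top qubit. -/
def stack (Z : Fin 2 → Matrix (BitString n) κ ℂ) : Matrix (BitString (n + 1)) κ ℂ :=
  Matrix.of fun b k => Z (b (Fin.last n)) (b ∘ Fin.castSucc) k

/-- The operation `A x` on the lower qubits, selected by the bit `x` of the top qubit. -/
def mux (A : Fin 2 → Matrix (BitString n) (BitString n) ℂ) :
    Matrix (BitString (n + 1)) (BitString (n + 1)) ℂ :=
  Matrix.of fun b b' => if b (Fin.last n) = b' (Fin.last n) then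
    A (b (Fin.last n)) (b ∘ Fin.castSucc) (b' ∘ Fin.castSucc) else 0

@[simp] theorem stack_addTop (Z : Fin 2 → Matrix (BitString n) κ ℂ) (c : BitString n) (x : Fin 2)
    (k : κ) : stack Z (addTop c x) k = Z x c k := by
  simp [stack]

@[simp] theorem mux_addTop (A : Fin 2 → Matrix (BitString n) (BitString n) ℂ) (c c' : BitString n)
    (x x' : Fin 2) : mux A (addTop c x) (addTop c' x') = if x = x' then A x c c' else 0 := by
  simp [mux]

theorem exists_eq_stack (M : Matrix (BitString (n + 1)) κ ℂ) : M = stack fun x =>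
    M.submatrix (fun c => addTop c x) id := by
  ext b k
  simp [stack]

theorem stack_mul {μ : Type*} [Fintype κ] (Z : Fin 2 → Matrix (BitString n) κ ℂ)
    (Y : Matrix κ μ ℂ) : stack Z * Y = stack fun x => Z x * Y := by
  refine Matrix.ext_addTop fun c x k => ?_
  rw [stack_addTop, Matrix.mul_apply, Matrix.mul_apply]
  simp

theorem mux_mul_stack (A : Fin 2 → Matrix (BitString n) (BitString n) ℂ)
    (Z : Fin 2 → Matrix (BitString n) κ ℂ) : mux A * stack Z = stack fun x => A x * Z x := by
  refine Matrix.ext_addTop fun c x k => ?_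
  rw [stack_addTop, Matrix.mul_apply, Matrix.mul_apply, sum_addTop]
  simp only [mux_addTop, stack_addTop, ite_mul, zero_mul]
  rw [Finset.sum_eq_single x]
  · simp
  · intro y _ hy
    simp [Ne.symm hy]
  · simp

theorem mux_mul (A B : Fin 2 → Matrix (BitString n) (BitString n) ℂ) :
    mux A * mux B = mux fun x => A x * B x := by
  rw [exists_eq_stack (mux B), mux_mul_stack]
  refine Matrix.ext_addTop fun c x b => ?_
  rw [← addTop_self b, stack_addTop, mux_addTop, Matrix.mul_apply]
  simp only [Matrix.submatrix_apply, id, mux_addTop]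
  split_ifs
  · rw [Matrix.mul_apply]
  · simp

theorem liftMatrix_castSucc (A : Matrix (BitString n) (BitString n) ℂ) :
    liftMatrix Fin.castSucc A = mux fun _ => A := by
  ext b b'
  simp only [liftMatrix, mux, Matrix.of_apply]
  refine if_congr ⟨fun h => h _ fun a => (Fin.castSucc_lt_last a).ne, fun h i => ?_⟩ rfl rfl
  refine Fin.lastCases (fun _ => h) (fun i hi => absurd rfl (hi i)) i

theorem mux_one : mux (fun _ => (1 : Matrix (BitString n) (BitString n) ℂ)) = 1 := by
  rw [← liftMatrix_castSucc, liftMatrix_one]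

theorem mux_conjTranspose (A : Fin 2 → Matrix (BitString n) (BitString n) ℂ) :
    (mux A)ᴴ = mux fun x => (A x)ᴴ := by
  ext b b'
  rw [← addTop_self b, ← addTop_self b', Matrix.conjTranspose_apply, mux_addTop, mux_addTop]
  by_cases h : b (Fin.last n) = b' (Fin.last n)
  · simp [h]
  · simp [h, Ne.symm h]

theorem mux_injective {A B : Fin 2 → Matrix (BitString n) (BitString n) ℂ} (h : mux A = mux B)
    (x : Fin 2) : A x = B x := by
  ext c c'
  have := congrFun (congrFun h (addTop c x)) (addTop c' x)
  simpa using this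

theorem mux_mem_unitaryGroup_iff {A : Fin 2 → Matrix (BitString n) (BitString n) ℂ} :
    mux A ∈ Matrix.unitaryGroup (BitString (n + 1)) ℂ ↔
      ∀ x, A x ∈ Matrix.unitaryGroup (BitString n) ℂ := by
  simp only [Matrix.mem_unitaryGroup_iff, Matrix.star_eq_conjTranspose]
  rw [mux_conjTranspose, mux_mul, ← mux_one]
  exact ⟨fun h x => mux_injective h x, fun h => by rw [funext h]⟩

/-- A one-qubit operation on the top qubit, selected by all lower qubits. -/
theorem ctl_last_mul_stack (f : BitString n → Matrix (Fin 2) (Fin 2) ℂ)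
    (Z : Fin 2 → Matrix (BitString n) κ ℂ) :
    ctl (Fin.last n) (fun b => f (b ∘ Fin.castSucc)) * stack Z =
      stack fun x => ∑ y, Matrix.diagonal (fun c => f c x y) * Z y := by
  refine Matrix.ext_addTop fun c x k => ?_
  rw [stack_addTop, Matrix.mul_apply, sum_addTop, Matrix.sum_apply]
  refine Finset.sum_congr rfl fun y _ => ?_
  simp only [stack_addTop, Matrix.diagonal_mul, ctl, Matrix.of_apply, forall_ne_last,
    addTop_comp_castSucc, addTop_last, ite_mul, zero_mul]
  simp

theorem ctl_last_eq_mux (f : BitString n → Fin 2 → ℂ) :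
    ctl (Fin.last n) (fun b => Matrix.diagonal (f (b ∘ Fin.castSucc))) =
      mux fun x => Matrix.diagonal fun c => f c x := by
  ext b b'
  rw [← addTop_self b, ← addTop_self b']
  simp only [ctl, Matrix.of_apply, forall_ne_last, addTop_comp_castSucc, addTop_last, mux_addTop,
    Matrix.diagonal_apply]
  split_ifs <;> rfl

theorem update_last_comp_castSucc (b : BitString (n + 1)) (x : Fin 2) :
    Function.update b (Fin.last n) x ∘ Fin.castSucc = b ∘ Fin.castSucc :=
  funext fun i => Function.update_of_ne (Fin.castSucc_lt_last i).ne _ _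

/-- Diagonal operations of the lower qubits commute with operations on the top qubit that are
selected by the lower qubits. -/
theorem ctl_last_mul_lift_diagonal (f : BitString n → Matrix (Fin 2) (Fin 2) ℂ)
    (δ : BitString n → ℂ) :
    ctl (Fin.last n) (fun b => f (b ∘ Fin.castSucc)) *
        liftMatrix Fin.castSucc (Matrix.diagonal δ) =
      liftMatrix Fin.castSucc (Matrix.diagonal δ) *
        ctl (Fin.last n) (fun b => f (b ∘ Fin.castSucc)) := by
  have h : liftMatrix Fin.castSucc (Matrix.diagonal δ) =
      ctl (Fin.last n) (fun b => Matrix.diagonal fun _ => δ (b ∘ Fin.castSucc)) := by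
    rw [liftMatrix_castSucc, ctl_last_eq_mux fun c _ => δ c]
  rw [h, ctl_mul, ctl_mul]
  · refine ctl_congr fun b => ?_
    rw [← Matrix.smul_one_eq_diagonal, Matrix.mul_smul, Matrix.smul_mul, Matrix.mul_one,
      Matrix.one_mul]
  · intro b x
    rw [update_last_comp_castSucc]
  · intro b x
    rw [update_last_comp_castSucc]

/-! ### Columns of the identity -/

/-- The bits of `c`, followed by zeros. -/
def padZero {m : ℕ} (n : ℕ) (c : BitString m) : BitString n :=
  fun i => if h : i.val < m then c ⟨i.val, h⟩ else 0

theorem padZero_castLE (h : m ≤ n) (c : BitString m) (i : Fin m) :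
    padZero n c (Fin.castLE h i) = c i := by
  simp [padZero]

theorem padZero_comp_castLE (h : m ≤ n) (c : BitString m) : padZero n c ∘ Fin.castLE h = c :=
  funext fun i => padZero_castLE h c i

theorem padZero_injective (h : m ≤ n) : Function.Injective (padZero (m := m) n) :=
  fun c c' hc => by rw [← padZero_comp_castLE h c, hc, padZero_comp_castLE]

theorem padZero_succ (h : m ≤ n) (c : BitString m) :
    padZero (n + 1) c = addTop (padZero n c) 0 := by
  ext1 i
  refine Fin.lastCases ?_ (fun i => ?_) i
  · simp [padZero, h]
  · simp [padZero]

theorem padZero_self (c : BitString n) : padZero n c = c := by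
  ext1 i; simp [padZero]

theorem padZero_padZero {k : ℕ} (h : m ≤ k) (c : BitString m) :
    padZero n (padZero k c) = padZero n c := by
  ext1 i
  simp only [padZero]
  by_cases h1 : i.val < m
  · simp [h1, h1.trans_le h]
  · simp [h1]

theorem firstColumns_apply (b : BitString n) (c : BitString m) :
    firstColumns m n b c = if b = padZero n c then 1 else 0 :=
  if_congr ⟨fun h => funext h, fun h i => congrFun h i⟩ rfl rfl

theorem firstColumns_eq (m n : ℕ) :
    firstColumns m n = (1 : Matrix (BitString n) (BitString n) ℂ).submatrix id (padZero n) := by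
  ext b c
  rw [firstColumns_apply, Matrix.submatrix_apply, id, Matrix.one_apply]

theorem mul_firstColumns {ι : Type*} (M : Matrix ι (BitString n) ℂ) :
    M * firstColumns m n = M.submatrix id (padZero n) := by
  rw [firstColumns_eq]
  have := Matrix.submatrix_mul M (1 : Matrix (BitString n) (BitString n) ℂ) id id (padZero (m := m) n)
    Function.bijective_id
  rw [Matrix.mul_one, Matrix.submatrix_id_id] at this
  exact this.symm

theorem firstColumns_self (n : ℕ) : firstColumns n n = 1 := by
  ext b c
  rw [firstColumns_apply, padZero_self, Matrix.one_apply]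

theorem firstColumns_mul_firstColumns {k : ℕ} (h : m ≤ k) :
    firstColumns k n * firstColumns m k = firstColumns m n := by
  rw [mul_firstColumns]
  ext b c
  rw [Matrix.submatrix_apply, firstColumns_apply, firstColumns_apply, padZero_padZero h, id]

theorem firstColumns_conjTranspose_mul_self (h : m ≤ n) :
    (firstColumns m n)ᴴ * firstColumns m n = 1 := by
  rw [mul_firstColumns, firstColumns_eq, Matrix.conjTranspose_submatrix, Matrix.conjTranspose_one]
  ext b c
  simp [Matrix.one_apply, (padZero_injective h).eq_iff]

theorem firstColumns_succ (h : m ≤ n) : firstColumns m (n + 1) =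
    stack fun x => if x = 0 then firstColumns m n else 0 := by
  refine Matrix.ext_addTop fun c x k => ?_
  rw [stack_addTop, firstColumns_apply, padZero_succ h]
  have h1 : (addTop c x = addTop (padZero n k) 0) ↔ x = 0 ∧ c = padZero n k := by
    constructor
    · intro h2
      exact ⟨by simpa using congrFun h2 (Fin.last n),
        funext fun i => by simpa using congrFun h2 i.castSucc⟩
    · rintro ⟨rfl, rfl⟩; rfl
  by_cases hx : x = 0
  · rw [if_pos hx, firstColumns_apply]
    exact if_congr (h1.trans (and_iff_right hx)) rfl rfl
  · rw [if_neg hx, if_neg fun h2 => hx (h1.1 h2).1, Matrix.zero_apply]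

theorem diagonal_mul_firstColumns (d : BitString n → ℂ) :
    Matrix.diagonal d * firstColumns m n =
      firstColumns m n * Matrix.diagonal (fun c : BitString m => d (padZero n c)) := by
  ext b c
  refine (Matrix.diagonal_mul _ _ _ _).trans (Eq.trans ?_ (Matrix.mul_diagonal _ _ _ _).symm)
  rw [firstColumns_apply]
  split_ifs with h
  · rw [h, mul_comm]
  · simp

/-- A right factor of an isometry becomes the first stage of its circuit: gates on the inputs pass
through the initialisation of the other qubits. -/
theorem liftMatrix_mul_firstColumns (h : m ≤ n) (M : Matrix (BitString m) (BitString m) ℂ) :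
    liftMatrix (Fin.castLE h) M * firstColumns m n = firstColumns m n * M := by
  ext b c
  rw [mul_firstColumns, Matrix.mul_apply, Matrix.submatrix_apply, id]
  have h1 : ∀ c', b = padZero n c' ↔
      (∀ i, (∀ a, Fin.castLE h a ≠ i) → b i = padZero n c i) ∧ c' = b ∘ Fin.castLE h := by
    intro c'
    have h0 : ∀ (c : BitString m) i, (∀ a, Fin.castLE h a ≠ i) → padZero n c i = 0 := by
      intro c i hi
      simp only [padZero]
      rw [dif_neg]
      intro hlt
      exact hi ⟨i, hlt⟩ rfl
    constructor
    · rintro rfl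
      exact ⟨fun i hi => by rw [h0 _ _ hi, h0 _ _ hi], (padZero_comp_castLE h c').symm⟩
    · rintro ⟨h2, rfl⟩
      ext1 i
      by_cases hi : ∃ a, Fin.castLE h a = i
      · obtain ⟨a, rfl⟩ := hi
        rw [padZero_castLE]; rfl
      · have hi' : ∀ a, Fin.castLE h a ≠ i := by simpa using hi
        rw [h2 i hi', h0 _ _ hi', h0 _ _ hi']
  simp only [firstColumns_apply, liftMatrix, Matrix.of_apply, padZero_comp_castLE]
  by_cases h2 : ∀ i, (∀ a, Fin.castLE h a ≠ i) → b i = padZero n c i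
  · have h3 : ∀ c', b = padZero n c' ↔ c' = b ∘ Fin.castLE h :=
      fun c' => (h1 c').trans (and_iff_right h2)
    rw [if_pos h2]
    simp [h3]
  · have h3 : ∀ c', ¬ b = padZero n c' := fun c' h4 => h2 ((h1 c').1 h4).1
    rw [if_neg h2]
    simp [h3]

end Multiplexers

/-! ### The recursion for isometries. -/

section Steps

variable {m n k r v w : ℕ}

/-- One topology with at most `k` controlled-NOT gates performs all isometries. -/
def Generates (m n k : ℕ) : Prop :=
  ∃ S : Set (Matrix (BitString n) (BitString n) ℂ), Synth k S ∧
    ∀ U ∈ Matrix.unitaryGroup (BitString n) ℂ, ∃ M ∈ S,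
      M * firstColumns m n = U * firstColumns m n

/-- One topology with at most `k` controlled-NOT gates performs all isometries, up to a diagonal
gate on the input. -/
def GeneratesUpToDiagonal (m n k : ℕ) : Prop :=
  ∃ S : Set (Matrix (BitString n) (BitString n) ℂ), Synth k S ∧
    ∀ U ∈ Matrix.unitaryGroup (BitString n) ℂ, ∃ M ∈ S, ∃ δ : BitString m → ℂ,
      (∀ c, ‖δ c‖ = 1) ∧ U * firstColumns m n = M * firstColumns m n * Matrix.diagonal δ

theorem Generates.cnotsSuffice (hmn : m ≤ n) (h : Generates m n k) : CnotsSuffice m n k := by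
  obtain ⟨S, ⟨T, hT, hTS⟩, hS⟩ := h
  refine ⟨T, hT, fun V hV => ?_⟩
  obtain ⟨U, hU, hUV⟩ := exists_unitary_extension (padZero n) (padZero_injective hmn) V hV
  obtain ⟨M, hM, hMU⟩ := hS U hU
  obtain ⟨C, hC, hCM⟩ := hTS M hM
  exact ⟨C, hC, 1, norm_one, by rw [hCM, hMU, one_smul, hUV, mul_firstColumns]⟩

theorem Generates.upToDiagonal (h : Generates m n k) : GeneratesUpToDiagonal m n k := by
  obtain ⟨S, hS, h⟩ := h
  refine ⟨S, hS, fun U hU => ?_⟩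
  obtain ⟨M, hM, hMU⟩ := h U hU
  exact ⟨M, hM, fun _ => 1, by simp, by rw [hMU]; simp⟩

/-- A diagonal gate sends no padded input out of the range of the inclusion, so it restricts to a
diagonal gate on the inputs. -/
theorem GeneratesUpToDiagonal.of_self (h : GeneratesUpToDiagonal n n k) :
    GeneratesUpToDiagonal m n k := by
  obtain ⟨S, hS, h⟩ := h
  refine ⟨S, hS, fun U hU => ?_⟩
  obtain ⟨M, hM, δ, hδ, hMU⟩ := h U hU
  rw [firstColumns_self, Matrix.mul_one, Matrix.mul_one] at hMU
  exact ⟨M, hM, fun c => δ (padZero n c), fun c => hδ _, by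
    rw [hMU, Matrix.mul_assoc, diagonal_mul_firstColumns]; exact (Matrix.mul_assoc _ _ _).symm⟩

/-- The missing diagonal is a unitary on the `m` input qubits and is performed there first. -/
theorem GeneratesUpToDiagonal.generates (hmn : m ≤ n) (h : GeneratesUpToDiagonal m n k)
    (h' : Generates m m r) : Generates m n (k + r) := by
  obtain ⟨S, hS, h⟩ := h
  obtain ⟨S', hS', h'⟩ := h'
  refine ⟨{M | ∃ A ∈ S, ∃ B ∈ liftMatrix (Fin.castLE hmn) '' S', M = A * B},
    hS.mul (hS'.lift (Fin.castLE_injective hmn)) fun M hM => hM, fun U hU => ?_⟩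
  obtain ⟨M, hM, δ, hδ, hMU⟩ := h U hU
  obtain ⟨N, hN, hNδ⟩ := h' _ (diagonal_mem_unitaryGroup hδ)
  rw [firstColumns_self, Matrix.mul_one, Matrix.mul_one] at hNδ
  refine ⟨_, ⟨M, hM, _, ⟨N, hN, rfl⟩, rfl⟩, ?_⟩
  rw [Matrix.mul_assoc, liftMatrix_mul_firstColumns, hNδ, hMU, Matrix.mul_assoc]

/-- The controls of the rotations of the top qubit: the input qubits. -/
def inputQubits (hmn : m ≤ n) : List (Fin n) := (List.finRange m).map (Fin.castLE hmn)

theorem last_notMem_inputQubits (hmn : m ≤ n) :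
    Fin.last n ∉ (inputQubits hmn).map Fin.castSucc := by
  simp only [List.mem_map, not_exists, not_and]
  intro x _
  exact (Fin.castSucc_lt_last x).ne

theorem length_inputQubits (hmn : m ≤ n) :
    ((inputQubits hmn).map Fin.castSucc).length = m := by
  simp [inputQubits]

theorem dependsOn_inputQubits (hmn : m ≤ n) (θ : BitString m → ℝ) :
    DependsOn (fun b : BitString (n + 1) => θ (b ∘ Fin.castSucc ∘ Fin.castLE hmn))
      {i | i ∈ (inputQubits hmn).map Fin.castSucc} := by
  intro b b' h
  refine congrArg θ (funext fun i => h _ ?_)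
  simp [inputQubits]

/-- The controlled Z is diagonal, hence also block diagonal over its target, the top qubit. This
lets it merge into the multiplexer beside it. -/
theorem ctlHead_eq_mux (l : List (Fin n)) : ∃ d : Fin 2 → BitString n → ℂ,
    (∀ x c, ‖d x c‖ = 1) ∧ (∀ x c, d x c * d x c = 1) ∧
    ctlHead (Fin.last n) pauliZ (l.map Fin.castSucc) = mux fun x => Matrix.diagonal (d x) := by
  cases l with
  | nil =>
    refine ⟨fun _ _ => 1, by simp, by simp, ?_⟩
    simp only [List.map_nil, ctlHead, Matrix.diagonal_one, mux_one]
  | cons i l =>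
    refine ⟨fun x c => if c i = 1 ∧ x = 1 then -1 else 1, ?_, ?_, ?_⟩
    · intro x c; dsimp only; split_ifs <;> simp
    · intro x c; dsimp only; split_ifs <;> simp
    · rw [List.map_cons, ctlHead,
        ← ctl_last_eq_mux fun (c : BitString n) x => if c i = 1 ∧ x = 1 then (-1 : ℂ) else 1]
      refine ctl_congr fun b => ?_
      simp only [Function.comp_apply]
      split_ifs with h
      · ext x y
        fin_cases x <;> fin_cases y <;> simp [pauliZ, h]
      · simp [h]

theorem ctl_last_rotZ (d : BitString n → ℝ) :
    ctl (Fin.last n) (fun b => rotZ (d (b ∘ Fin.castSucc))) = mux fun x => Matrix.diagonal fun c =>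
      if x = 0 then Complex.exp (d c * Complex.I) else Complex.exp (-(d c * Complex.I)) := by
  rw [← ctl_last_eq_mux fun c x => if x = 0 then Complex.exp (d c * Complex.I)
    else Complex.exp (-(d c * Complex.I))]
  refine ctl_congr fun b => ?_
  ext x y
  fin_cases x <;> fin_cases y <;> simp [rotZ]

/-- The rotations of the top qubit selected by all lower qubits. -/
theorem synth_top_rotZ (n : ℕ) : Synth (2 ^ n) {M | ∃ d : BitString n → ℝ,
    M = ctl (Fin.last n) fun b => rotZ (d (b ∘ Fin.castSucc))} := by
  have h := synth_rot isReversedBy_rotZ (Fin.last n) _ (last_notMem_inputQubits (le_refl n))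
  rw [length_inputQubits] at h
  refine h.mono ?_ le_rfl
  rintro _ ⟨d, rfl⟩
  exact ⟨_, dependsOn_inputQubits le_rfl d, rfl⟩

/-- The corrected rotations of the top qubit selected by the `m` lowest qubits. -/
theorem synth_top_rotY (hmn : m ≤ n) : Synth (2 ^ m - 1) {M | ∃ θ : BitString m → ℝ,
    M = ctlHead (Fin.last n) pauliZ ((inputQubits hmn).map Fin.castSucc) *
      ctl (Fin.last n) fun b => rotY (θ (b ∘ Fin.castSucc ∘ Fin.castLE hmn))} := by
  have h := synth_ctlHead_mul_rot isReversedBy_rotY (Fin.last n) _ (last_notMem_inputQubits hmn)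
  rw [length_inputQubits] at h
  refine h.mono ?_ le_rfl
  rintro _ ⟨d, rfl⟩
  exact ⟨_, dependsOn_inputQubits hmn d, rfl⟩

theorem exists_mux_eq {A : Fin 2 → Matrix (BitString n) (BitString n) ℂ}
    (hA : ∀ x, A x ∈ Matrix.unitaryGroup (BitString n) ℂ) :
    ∃ V ∈ Matrix.unitaryGroup (BitString n) ℂ, ∃ W ∈ Matrix.unitaryGroup (BitString n) ℂ,
      ∃ d : BitString n → ℝ, mux A = liftMatrix Fin.castSucc V *
        (ctl (Fin.last n) fun b => rotZ (d (b ∘ Fin.castSucc))) * liftMatrix Fin.castSucc W := by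
  obtain ⟨V, hV, W, hW, d, h0, h1⟩ := exists_demultiplex (hA 0) (hA 1)
  refine ⟨V, hV, W, hW, d, ?_⟩
  rw [ctl_last_rotZ, liftMatrix_castSucc, liftMatrix_castSucc, mux_mul, mux_mul]
  congr 1
  ext1 x
  fin_cases x
  · simpa using h0
  · simpa using h1

/-- Cosine-sine decomposition of an isometry with respect to the top qubit. -/
theorem exists_cosineSine_stack (hmn : m ≤ n) {U : Matrix (BitString (n + 1)) (BitString (n + 1)) ℂ}
    (hU : U ∈ Matrix.unitaryGroup (BitString (n + 1)) ℂ) :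
    ∃ A : Fin 2 → Matrix (BitString n) (BitString n) ℂ,
      (∀ x, A x ∈ Matrix.unitaryGroup (BitString n) ℂ) ∧
      ∃ R ∈ Matrix.unitaryGroup (BitString m) ℂ, ∃ θ : BitString m → ℝ,
        U * firstColumns m (n + 1) = stack fun x => A x * firstColumns m n *
          Matrix.diagonal (fun c : BitString m => rotY (θ c) x 0) * R := by
  set V := U * firstColumns m (n + 1) with hV
  have hVV : Vᴴ * V = 1 := by
    rw [hV, Matrix.conjTranspose_mul, Matrix.mul_assoc, ← Matrix.mul_assoc Uᴴ,
      ← Matrix.star_eq_conjTranspose U, Matrix.mem_unitaryGroup_iff'.1 hU, Matrix.one_mul,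
      firstColumns_conjTranspose_mul_self (by omega)]
  have hsum : (V.submatrix (fun c => addTop c 0) id)ᴴ * V.submatrix (fun c => addTop c 0) id +
      (V.submatrix (fun c => addTop c 1) id)ᴴ * V.submatrix (fun c => addTop c 1) id = 1 := by
    rw [← hVV]
    ext b c
    rw [Matrix.add_apply, Matrix.mul_apply, Matrix.mul_apply, Matrix.mul_apply, sum_addTop,
      Fin.sum_univ_two]
    rfl
  obtain ⟨A, hA, B, hB, R, hR, θ, h0, h1⟩ := exists_cosineSine (padZero n)
    (padZero_injective hmn) _ _ hsum
  refine ⟨fun x => if x = 0 then A else B, fun x => by dsimp only; split_ifs <;> assumption,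
    R, hR, θ, ?_⟩
  rw [exists_eq_stack V]
  congr 1
  ext1 x
  fin_cases x
  · simpa [mul_firstColumns, rotY] using h0
  · simpa [mul_firstColumns, rotY] using h1

/-- A rotation of the top qubit, selected by the input qubits, after a gate on the input qubits. -/
theorem ctl_rotY_mul_liftMatrix_mul_firstColumns (hmn : m ≤ n) (θ : BitString m → ℝ)
    (R : Matrix (BitString m) (BitString m) ℂ) :
    (ctl (Fin.last n) fun b => rotY (θ (b ∘ Fin.castSucc ∘ Fin.castLE hmn))) *
        (liftMatrix (Fin.castLE (Nat.le_succ_of_le hmn)) R * firstColumns m (n + 1)) =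
      stack fun x => firstColumns m n * Matrix.diagonal (fun c : BitString m => rotY (θ c) x 0) * R := by
  rw [liftMatrix_mul_firstColumns, firstColumns_succ hmn, stack_mul]
  refine (ctl_last_mul_stack (fun c => rotY (θ (c ∘ Fin.castLE hmn))) _).trans ?_
  refine congrArg stack (funext fun x => ?_)
  rw [Fin.sum_univ_two, if_pos rfl, if_neg one_ne_zero, Matrix.zero_mul, Matrix.mul_zero, add_zero,
    ← Matrix.mul_assoc, diagonal_mul_firstColumns]
  simp only [padZero_comp_castLE]

theorem diagonal_mul_comm {ι : Type*} [Fintype ι] [DecidableEq ι] (d e : ι → ℂ) :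
    Matrix.diagonal d * Matrix.diagonal e = Matrix.diagonal e * Matrix.diagonal d := by
  rw [Matrix.diagonal_mul_diagonal, Matrix.diagonal_mul_diagonal]
  simp only [mul_comm]

/-- Factors from left to right: `V` up to a diagonal (`v`), multiplexed `rotZ` (`2 ^ n`), `W` (`w`),
corrected `rotY` (`2 ^ m - 1`), `R` (`r`). At `W` only the input qubits and the top qubit have left
their initial state, so it matters only as an isometry from `m` qubits. -/
theorem generates_succ (hmn : m ≤ n) (hr : Generates m m r) (hw : GeneratesUpToDiagonal m n w)
    (hv : GeneratesUpToDiagonal n n v) :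
    Generates m (n + 1) (v + (2 ^ n + (w + (2 ^ m - 1 + r)))) := by
  obtain ⟨Sr, hSr, hr⟩ := hr
  obtain ⟨Sw, hSw, hw⟩ := hw
  obtain ⟨Sv, hSv, hv⟩ := hv
  have hc := Fin.castSucc_injective n
  refine ⟨_, (hSv.lift hc).mul ((synth_top_rotZ n).mul ((hSw.lift hc).mul ((synth_top_rotY hmn).mul
    (hSr.lift (Fin.castLE_injective (Nat.le_succ_of_le hmn))) fun M hM => hM) fun M hM => hM)
    fun M hM => hM) fun M hM => hM, fun U hU => ?_⟩
  obtain ⟨A, hA, R, hR, θ, hUA⟩ := exists_cosineSine_stack hmn hU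
  obtain ⟨d, hd, hdd, hE⟩ := ctlHead_eq_mux (inputQubits hmn)
  -- The controlled Z that corrects the `rotY` stage is an involution; its second copy is absorbed
  -- into the multiplexer before demultiplexing.
  obtain ⟨V, hV, W, hW, z, hmux⟩ := exists_mux_eq (A := fun x => A x * Matrix.diagonal (d x))
    fun x => mul_mem (hA x) (diagonal_mem_unitaryGroup (hd x))
  obtain ⟨MV, hMV, δ, hδ, hVM⟩ := hv V hV
  rw [firstColumns_self, Matrix.mul_one, Matrix.mul_one] at hVM
  -- The diagonal left over from `V` passes the `rotZ` stage and joins `W`; the one left over from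
  -- `W` passes the diagonal blocks of the `rotY` stage and joins `R`.
  obtain ⟨MW, hMW, ε, hε, hWM⟩ := hw _ (mul_mem (diagonal_mem_unitaryGroup hδ) hW)
  obtain ⟨MR, hMR, hRM⟩ := hr _ (mul_mem (diagonal_mem_unitaryGroup hε) hR)
  rw [firstColumns_self, Matrix.mul_one, Matrix.mul_one] at hRM
  refine ⟨_, ⟨_, ⟨MV, hMV, rfl⟩, _, ⟨_, ⟨z, rfl⟩, _, ⟨_, ⟨MW, hMW, rfl⟩, _, ⟨_, ⟨θ, rfl⟩, _,
    ⟨MR, hMR, rfl⟩, rfl⟩, rfl⟩, rfl⟩, rfl⟩, ?_⟩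
  have hdd' : ∀ x, Matrix.diagonal (d x) * Matrix.diagonal (d x) = 1 := by
    intro x
    rw [Matrix.diagonal_mul_diagonal, ← Matrix.diagonal_one]
    congr 1
    ext c
    exact hdd x c
  have h1 : U * firstColumns m (n + 1) = mux (fun x => A x * Matrix.diagonal (d x)) *
      stack fun x => Matrix.diagonal (d x) *
        (firstColumns m n * Matrix.diagonal (fun c : BitString m => rotY (θ c) x 0) * R) := by
    rw [hUA, mux_mul_stack]
    congr 1
    ext1 x
    simp only [Matrix.mul_assoc]
    rw [← Matrix.mul_assoc (Matrix.diagonal (d x)) (Matrix.diagonal (d x)), hdd', Matrix.one_mul]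
  have h2 : ∀ x, ∀ R' : Matrix (BitString m) (BitString m) ℂ, Matrix.diagonal (d x) *
      (firstColumns m n * Matrix.diagonal (fun c : BitString m => rotY (θ c) x 0) * R') =
      firstColumns m n *
        (Matrix.diagonal (fun c : BitString m => d x (padZero n c) * rotY (θ c) x 0) * R') := by
    intro x R'
    rw [← Matrix.mul_assoc, ← Matrix.mul_assoc, diagonal_mul_firstColumns,
      Matrix.mul_assoc (firstColumns m n), Matrix.diagonal_mul_diagonal, Matrix.mul_assoc]
  have h3 : ∀ x, MW * (firstColumns m n * (Matrix.diagonal (fun c : BitString m =>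
      d x (padZero n c) * rotY (θ c) x 0) * (Matrix.diagonal ε * R))) =
      Matrix.diagonal δ * W * (firstColumns m n * (Matrix.diagonal (fun c : BitString m =>
        d x (padZero n c) * rotY (θ c) x 0) * R)) := by
    intro x
    rw [← Matrix.mul_assoc _ _ R, diagonal_mul_comm, ← Matrix.mul_assoc (Matrix.diagonal δ * W),
      hWM]
    simp only [Matrix.mul_assoc]
  rw [h1, hmux, hVM, liftMatrix_mul hc, hE, hRM, Matrix.mul_assoc, Matrix.mul_assoc,
    Matrix.mul_assoc, Matrix.mul_assoc, Matrix.mul_assoc, ctl_rotY_mul_liftMatrix_mul_firstColumns hmn,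
    mux_mul_stack]
  simp only [h2]
  rw [Matrix.mul_assoc, Matrix.mul_assoc, Matrix.mul_assoc]
  refine congrArg (liftMatrix Fin.castSucc MV * ·) ?_
  rw [← Matrix.mul_assoc (liftMatrix Fin.castSucc (Matrix.diagonal δ)),
    ← ctl_last_mul_lift_diagonal (fun c => rotZ (z c)), Matrix.mul_assoc]
  refine congrArg ((ctl (Fin.last n) fun b => rotZ (z (b ∘ Fin.castSucc))) * ·) ?_
  rw [← Matrix.mul_assoc (liftMatrix Fin.castSucc (Matrix.diagonal δ)), ← liftMatrix_mul hc,
    liftMatrix_castSucc, liftMatrix_castSucc, mux_mul_stack, mux_mul_stack]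
  exact congrArg stack (funext h3)

end Steps

/-! ### The recursion for full unitaries. -/

section FullStep

variable {n v r : ℕ}

theorem firstColumns_apply_addTop_one (c c' : BitString n) :
    firstColumns n (n + 1) (addTop c 1) c' = 0 := by
  rw [firstColumns_succ le_rfl, stack_addTop, if_neg one_ne_zero, Matrix.zero_apply]

/-- A unitary that maps the lower half space into itself is block diagonal. -/
theorem exists_eq_mux {W : Matrix (BitString (n + 1)) (BitString (n + 1)) ℂ}
    {R : Matrix (BitString n) (BitString n) ℂ}
    (hW : W ∈ Matrix.unitaryGroup (BitString (n + 1)) ℂ)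
    (hR : R ∈ Matrix.unitaryGroup (BitString n) ℂ)
    (h : W * firstColumns n (n + 1) = firstColumns n (n + 1) * R) :
    ∃ B : Fin 2 → Matrix (BitString n) (BitString n) ℂ,
      (∀ x, B x ∈ Matrix.unitaryGroup (BitString n) ℂ) ∧ W = mux B := by
  -- Because `R` is invertible, `W` maps the lower half space onto itself and so does its adjoint.
  -- This kills the other off-diagonal block.
  have h' : Wᴴ * firstColumns n (n + 1) = firstColumns n (n + 1) * Rᴴ := by
    have h1 : firstColumns n (n + 1) = Wᴴ * (firstColumns n (n + 1) * R) := by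
      rw [← h, ← Matrix.mul_assoc, ← Matrix.star_eq_conjTranspose,
        Matrix.mem_unitaryGroup_iff'.1 hW, Matrix.one_mul]
    calc _ = Wᴴ * (firstColumns n (n + 1) * R) * Rᴴ := by
          rw [Matrix.mul_assoc, Matrix.mul_assoc, ← Matrix.star_eq_conjTranspose R,
            Matrix.mem_unitaryGroup_iff.1 hR, Matrix.mul_one]
      _ = _ := by rw [← h1]
  have h0 : ∀ (X : Matrix (BitString (n + 1)) (BitString (n + 1)) ℂ)
      (Y : Matrix (BitString n) (BitString n) ℂ),
      X * firstColumns n (n + 1) = firstColumns n (n + 1) * Y → ∀ c c',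
        X (addTop c 1) (addTop c' 0) = 0 := by
    intro X Y hXY c c'
    have := congrFun (congrFun hXY (addTop c 1)) c'
    rw [mul_firstColumns, Matrix.submatrix_apply, id, padZero_succ le_rfl, padZero_self,
      Matrix.mul_apply] at this
    rw [this]
    exact Finset.sum_eq_zero fun c _ => by rw [firstColumns_apply_addTop_one, zero_mul]
  have hB : W = mux fun x => W.submatrix (fun c => addTop c x) fun c => addTop c x := by
    refine Matrix.ext_addTop fun c x b => ?_
    rw [← addTop_self b, mux_addTop]
    generalize b (Fin.last n) = y
    split_ifs with hxy
    · rw [hxy]; rfl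
    · by_cases hx : x = 0
      · have hy : y = 1 := by omega
        have := h0 _ _ h' (b ∘ Fin.castSucc) c
        rw [Matrix.conjTranspose_apply, star_eq_zero] at this
        rw [hx, hy, this]
      · have hx : x = 1 := by omega
        have hy : y = 0 := by omega
        rw [hx, hy, h0 _ _ h]
  exact ⟨_, mux_mem_unitaryGroup_iff.1 (hB ▸ hW), hB⟩

theorem ctl_last_rotY_mem_unitaryGroup (θ : BitString n → ℝ) :
    (ctl (Fin.last n) fun b => rotY (θ (b ∘ Fin.castSucc))) ∈
      Matrix.unitaryGroup (BitString (n + 1)) ℂ :=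
  ctl_mem_unitaryGroup _ (fun b x => by rw [update_last_comp_castSucc])
    fun b => isReversedBy_rotY.mem _

/-- The full cosine-sine decomposition. -/
theorem exists_mux_mul_rotY_mul_mux {U : Matrix (BitString (n + 1)) (BitString (n + 1)) ℂ}
    (hU : U ∈ Matrix.unitaryGroup (BitString (n + 1)) ℂ) :
    ∃ A : Fin 2 → Matrix (BitString n) (BitString n) ℂ,
      (∀ x, A x ∈ Matrix.unitaryGroup (BitString n) ℂ) ∧
      ∃ B : Fin 2 → Matrix (BitString n) (BitString n) ℂ,
        (∀ x, B x ∈ Matrix.unitaryGroup (BitString n) ℂ) ∧ ∃ θ : BitString n → ℝ,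
          U = mux A * (ctl (Fin.last n) fun b => rotY (θ (b ∘ Fin.castSucc))) * mux B := by
  obtain ⟨A, hA, R, hR, θ, hUA⟩ := exists_cosineSine_stack le_rfl hU
  set T := mux A * (ctl (Fin.last n) fun b => rotY (θ (b ∘ Fin.castSucc)))
  have hT : T ∈ Matrix.unitaryGroup (BitString (n + 1)) ℂ :=
    mul_mem (mux_mem_unitaryGroup_iff.2 hA) (ctl_last_rotY_mem_unitaryGroup θ)
  have h1 : U * firstColumns n (n + 1) = T * (firstColumns n (n + 1) * R) := by
    rw [hUA, Matrix.mul_assoc, ← liftMatrix_mul_firstColumns (Nat.le_succ n)]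
    refine Eq.symm ((congrArg (mux A * ·)
      (ctl_rotY_mul_liftMatrix_mul_firstColumns le_rfl θ R)).trans ?_)
    rw [mux_mul_stack]
    simp only [Matrix.mul_assoc]
  -- `T` and `U` agree on the lower half space up to `R`, so `T† U` preserves that space and is
  -- block diagonal.
  have h2 : star T * U * firstColumns n (n + 1) = firstColumns n (n + 1) * R := by
    rw [Matrix.mul_assoc, h1, ← Matrix.mul_assoc, Matrix.mem_unitaryGroup_iff'.1 hT, Matrix.one_mul]
  obtain ⟨B, hB, hBT⟩ := exists_eq_mux (mul_mem (Unitary.star_mem hT) hU) hR h2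
  exact ⟨A, hA, B, hB, θ, by
    rw [← hBT, ← Matrix.mul_assoc, Matrix.mem_unitaryGroup_iff.1 hT, Matrix.one_mul]⟩

theorem mux_diagonal_mul_lift_diagonal (d : Fin 2 → BitString n → ℂ) (δ : BitString n → ℂ) :
    mux (fun x => Matrix.diagonal (d x)) * liftMatrix Fin.castSucc (Matrix.diagonal δ) =
      liftMatrix Fin.castSucc (Matrix.diagonal δ) * mux fun x => Matrix.diagonal (d x) := by
  rw [liftMatrix_castSucc, mux_mul, mux_mul]
  simp only [diagonal_mul_comm δ]

/-- Up to a gate on the lower qubits that acts first, one topology performs all unitaries. -/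
theorem exists_synth_mul_lift (hv : GeneratesUpToDiagonal n n v) :
    ∃ S : Set (Matrix (BitString (n + 1)) (BitString (n + 1)) ℂ),
      Synth (v + (2 ^ n + (v + (2 ^ n - 1 + (v + 2 ^ n))))) S ∧
      ∀ U ∈ Matrix.unitaryGroup (BitString (n + 1)) ℂ, ∃ M ∈ S,
        ∃ W ∈ Matrix.unitaryGroup (BitString n) ℂ, U = M * liftMatrix Fin.castSucc W := by
  obtain ⟨S, hS, hv⟩ := hv
  have hc := Fin.castSucc_injective n
  have hv' : ∀ U ∈ Matrix.unitaryGroup (BitString n) ℂ, ∃ M ∈ S, ∃ δ : BitString n → ℂ,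
      Matrix.diagonal δ ∈ Matrix.unitaryGroup (BitString n) ℂ ∧ U = M * Matrix.diagonal δ := by
    intro U hU
    obtain ⟨M, hM, δ, hδ, h⟩ := hv U hU
    rw [firstColumns_self, Matrix.mul_one, Matrix.mul_one] at h
    exact ⟨M, hM, δ, diagonal_mem_unitaryGroup hδ, h⟩
  refine ⟨_, (hS.lift hc).mul ((synth_top_rotZ n).mul ((hS.lift hc).mul ((synth_top_rotY le_rfl).mul
    ((hS.lift hc).mul (synth_top_rotZ n) fun M hM => hM) fun M hM => hM) fun M hM => hM)
    fun M hM => hM) fun M hM => hM, fun U hU => ?_⟩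
  obtain ⟨A, hA, B, hB, θ, hUA⟩ := exists_mux_mul_rotY_mul_mux hU
  obtain ⟨d, hd, hdd, hE⟩ := ctlHead_eq_mux (inputQubits (le_refl n))
  obtain ⟨V, hV, W, hW, z, hmux⟩ := exists_mux_eq (A := fun x => A x * Matrix.diagonal (d x))
    fun x => mul_mem (hA x) (diagonal_mem_unitaryGroup (hd x))
  obtain ⟨V', hV', W', hW', z', hmux'⟩ := exists_mux_eq hB
  -- Each leftover diagonal is handed to the next lower gate on the right; the third one ends in
  -- `W'`, the factor left open.
  obtain ⟨M₁, hM₁, δ₁, hδ₁, h₁⟩ := hv' V hV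
  obtain ⟨M₂, hM₂, δ₂, hδ₂, h₂⟩ := hv' _ (mul_mem hδ₁ hW)
  obtain ⟨M₃, hM₃, δ₃, hδ₃, h₃⟩ := hv' _ (mul_mem hδ₂ hV')
  refine ⟨_, ⟨_, ⟨M₁, hM₁, rfl⟩, _, ⟨_, ⟨z, rfl⟩, _, ⟨_, ⟨M₂, hM₂, rfl⟩, _, ⟨_, ⟨θ, rfl⟩, _,
    ⟨_, ⟨M₃, hM₃, rfl⟩, _, ⟨z', rfl⟩, rfl⟩, rfl⟩, rfl⟩, rfl⟩, rfl⟩, _, mul_mem hδ₃ hW', ?_⟩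
  have hA' : mux A = mux (fun x => A x * Matrix.diagonal (d x)) *
      mux fun x => Matrix.diagonal (d x) := by
    rw [mux_mul]
    refine congrArg mux (funext fun x => ?_)
    rw [Matrix.mul_assoc, Matrix.diagonal_mul_diagonal]
    simp only [hdd, Matrix.diagonal_one, Matrix.mul_one]
  have hY := ctl_last_mul_lift_diagonal (fun c => rotY (θ c)) δ₂
  have hZ := ctl_last_mul_lift_diagonal (fun c => rotZ (z c)) δ₁
  have hZ' := ctl_last_mul_lift_diagonal (fun c => rotZ (z' c)) δ₃
  have hD := mux_diagonal_mul_lift_diagonal d δ₂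
  have e₁ : liftMatrix Fin.castSucc V = liftMatrix Fin.castSucc M₁ *
      liftMatrix Fin.castSucc (Matrix.diagonal δ₁) := by rw [h₁, liftMatrix_mul hc]
  have e₂ : liftMatrix Fin.castSucc (Matrix.diagonal δ₁) * liftMatrix Fin.castSucc W =
      liftMatrix Fin.castSucc M₂ * liftMatrix Fin.castSucc (Matrix.diagonal δ₂) := by
    rw [← liftMatrix_mul hc, h₂, liftMatrix_mul hc]
  have e₃ : liftMatrix Fin.castSucc (Matrix.diagonal δ₂) * liftMatrix Fin.castSucc V' =
      liftMatrix Fin.castSucc M₃ * liftMatrix Fin.castSucc (Matrix.diagonal δ₃) := by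
    rw [← liftMatrix_mul hc, h₃, liftMatrix_mul hc]
  rw [hUA, hA', hmux, hmux', e₁, hE, liftMatrix_mul hc]
  change _ = _ * (_ * (_ * (_ * (ctl (Fin.last n) fun b => rotY (θ (b ∘ Fin.castSucc))) * _))) * _
  generalize (ctl (Fin.last n) fun b => rotY (θ (b ∘ Fin.castSucc))) = Y at *
  generalize (ctl (Fin.last n) fun b => rotZ (z (b ∘ Fin.castSucc))) = Z at *
  generalize (ctl (Fin.last n) fun b => rotZ (z' (b ∘ Fin.castSucc))) = Z' at *
  generalize (mux fun x => Matrix.diagonal (d x)) = D at *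
  generalize liftMatrix Fin.castSucc (Matrix.diagonal δ₁) = a₁ at *
  generalize liftMatrix Fin.castSucc (Matrix.diagonal δ₂) = a₂ at *
  generalize liftMatrix Fin.castSucc (Matrix.diagonal δ₃) = a₃ at *
  generalize liftMatrix Fin.castSucc W = w at *
  generalize liftMatrix Fin.castSucc V' = v' at *
  calc _ = liftMatrix Fin.castSucc M₁ * (a₁ * Z) * w * D * Y * v' * Z' *
        liftMatrix Fin.castSucc W' := by simp only [Matrix.mul_assoc]
    _ = liftMatrix Fin.castSucc M₁ * Z * (a₁ * w) * D * Y * v' * Z' *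
        liftMatrix Fin.castSucc W' := by rw [← hZ]; simp only [Matrix.mul_assoc]
    _ = liftMatrix Fin.castSucc M₁ * Z * liftMatrix Fin.castSucc M₂ * (a₂ * D) * Y * v' * Z' *
        liftMatrix Fin.castSucc W' := by rw [e₂]; simp only [Matrix.mul_assoc]
    _ = liftMatrix Fin.castSucc M₁ * Z * liftMatrix Fin.castSucc M₂ * D * (a₂ * Y) * v' * Z' *
        liftMatrix Fin.castSucc W' := by rw [← hD]; simp only [Matrix.mul_assoc]
    _ = liftMatrix Fin.castSucc M₁ * Z * liftMatrix Fin.castSucc M₂ * D * Y * (a₂ * v') * Z' *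
        liftMatrix Fin.castSucc W' := by rw [← hY]; simp only [Matrix.mul_assoc]
    _ = liftMatrix Fin.castSucc M₁ * Z * liftMatrix Fin.castSucc M₂ * D * Y *
        liftMatrix Fin.castSucc M₃ * (a₃ * Z') * liftMatrix Fin.castSucc W' := by
          rw [e₃]; simp only [Matrix.mul_assoc]
    _ = _ := by rw [← hZ']; simp only [Matrix.mul_assoc]

theorem Generates.succ (hv : GeneratesUpToDiagonal n n v) (hr : Generates n n r) :
    Generates (n + 1) (n + 1) (v + (2 ^ n + (v + (2 ^ n - 1 + (v + 2 ^ n)))) + r) := by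
  obtain ⟨S, hS, h⟩ := exists_synth_mul_lift hv
  obtain ⟨S', hS', h'⟩ := hr
  refine ⟨_, hS.mul (hS'.lift (Fin.castSucc_injective n)) fun M hM => hM, fun U hU => ?_⟩
  obtain ⟨M, hM, W, hW, rfl⟩ := h U hU
  obtain ⟨N, hN, hNW⟩ := h' W hW
  rw [firstColumns_self, Matrix.mul_one, Matrix.mul_one] at hNW
  exact ⟨_, ⟨M, hM, _, ⟨N, hN, rfl⟩, rfl⟩, by rw [hNW]⟩

/-- The open lower factor is itself performed up to a diagonal, and a diagonal gate of the lower
qubits is diagonal on the whole register. -/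
theorem GeneratesUpToDiagonal.succ (hv : GeneratesUpToDiagonal n n v) :
    GeneratesUpToDiagonal (n + 1) (n + 1)
      (v + (2 ^ n + (v + (2 ^ n - 1 + (v + 2 ^ n)))) + v) := by
  obtain ⟨S, hS, h⟩ := exists_synth_mul_lift hv
  obtain ⟨S', hS', h'⟩ := hv
  refine ⟨_, hS.mul (hS'.lift (Fin.castSucc_injective n)) fun M hM => hM, fun U hU => ?_⟩
  obtain ⟨M, hM, W, hW, rfl⟩ := h U hU
  obtain ⟨N, hN, δ, hδ, hNW⟩ := h' W hW
  rw [firstColumns_self, Matrix.mul_one, Matrix.mul_one] at hNW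
  refine ⟨_, ⟨M, hM, _, ⟨N, hN, rfl⟩, rfl⟩, fun b => δ (b ∘ Fin.castSucc), fun b => hδ _, ?_⟩
  rw [firstColumns_self, Matrix.mul_one, Matrix.mul_one, hNW,
    liftMatrix_mul (Fin.castSucc_injective n), Matrix.mul_assoc]
  have : liftMatrix Fin.castSucc (Matrix.diagonal δ) =
      Matrix.diagonal fun b : BitString (n + 1) => δ (b ∘ Fin.castSucc) := by
    rw [liftMatrix_castSucc]
    ext b b'
    rw [← addTop_self b, ← addTop_self b', mux_addTop, Matrix.diagonal_apply,
      Matrix.diagonal_apply, addTop_comp_castSucc, addTop_self, addTop_self]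
    by_cases hb : b = b'
    · simp [hb]
    · rw [if_neg hb]
      split_ifs with h1 h2
      · exact absurd (by rw [← addTop_self b, h1, h2, addTop_self]) hb
      · rfl
      · rfl
  rw [this]

end FullStep

/-! ### State preparation. -/

section StatePreparation

variable {m n k l p x y : ℕ}

theorem Generates.of_self (h : Generates n n k) : Generates m n k := by
  obtain ⟨S, hS, h⟩ := h
  refine ⟨S, hS, fun U hU => ?_⟩
  obtain ⟨M, hM, hMU⟩ := h U hU
  rw [firstColumns_self, Matrix.mul_one, Matrix.mul_one] at hMU
  exact ⟨M, hM, by rw [hMU]⟩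

theorem Generates.mono (h : Generates m n k) (hkl : k ≤ l) : Generates m n l := by
  obtain ⟨S, hS, h⟩ := h
  exact ⟨S, hS.mono subset_rfl hkl, h⟩

theorem generates_one : Generates 1 1 0 := by
  refine ⟨_, synth_single 0, fun U hU => ⟨U, ⟨U.submatrix (fun x _ => x) (fun x _ => x), ?_, ?_⟩, rfl⟩⟩
  · have h := Matrix.mem_unitaryGroup_iff.1 hU
    rw [Matrix.star_eq_conjTranspose] at h
    rw [Matrix.mem_unitaryGroup_iff, Matrix.star_eq_conjTranspose, Matrix.conjTranspose_submatrix]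
    refine (Matrix.submatrix_mul_equiv U Uᴴ _ (Equiv.funUnique (Fin 1) (Fin 2)).symm _).trans ?_
    rw [h]
    ext a b
    simp [Matrix.one_apply, funext_iff]
  · ext b b'
    have h : ∀ c : BitString 1, (fun _ => c 0) = c := fun c => funext fun i => by
      rw [Subsingleton.elim i 0]
    have h' : ∀ i : Fin 1, i ≠ 0 → b i = b' i := fun i hi => absurd (Subsingleton.elim i 0) hi
    simp only [singleQubitMatrix, Matrix.of_apply, if_pos h', Matrix.submatrix_apply, h]

theorem generates_two : Generates 2 2 3 :=
  ⟨_, synth_unitary_two, fun U hU => ⟨U, hU, rfl⟩⟩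

theorem generatesUpToDiagonal_two : GeneratesUpToDiagonal 2 2 2 := by
  refine ⟨_, synth_twoCnotCircuits, fun U hU => ?_⟩
  obtain ⟨ψ, M, hM, h, _⟩ := exists_twoCnotCircuit hU
  refine ⟨M, hM, fun b => parityPhase ψ (bitPair b), ?_, ?_⟩
  · intro b
    simp only [parityPhase]
    split_ifs <;> simp [Complex.norm_exp]
  · rw [firstColumns_self, Matrix.mul_one, Matrix.mul_one, h, Matrix.submatrix_diagonal_equiv]
    rfl

theorem extend_comp_self {e : Fin k → Fin n} (he : Function.Injective e) (c : BitString k)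
    (b : BitString n) : Function.extend e c b ∘ e = c :=
  funext fun _ => he.extend_apply _ _ _

theorem liftMatrix_mul_apply {κ : Type*} {e : Fin k → Fin n} (he : Function.Injective e)
    (A : Matrix (BitString k) (BitString k) ℂ) (Z : Matrix (BitString n) κ ℂ) (b : BitString n)
    (i : κ) : (liftMatrix e A * Z) b i = ∑ c, A (b ∘ e) c * Z (Function.extend e c b) i := by
  rw [Matrix.mul_apply]
  simp only [liftMatrix, Matrix.of_apply, ite_mul, zero_mul]
  rw [sum_agree_off_range he b fun b' => A (b ∘ e) (b' ∘ e) * Z b' i]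
  refine Finset.sum_congr rfl fun c _ => ?_
  rw [extend_comp_self he]

theorem cnotMatrix_mul_apply {κ : Type*} {c t : Fin n} (h : c ≠ t) (Z : Matrix (BitString n) κ ℂ)
    (b : BitString n) (i : κ) :
    (cnotMatrix c t * Z) b i = Z (Function.update b t (b t + b c)) i := by
  have h2 : ∀ z w : Fin 2, z + w + w = z := by decide
  have h1 : ∀ b', b = Function.update b' t (b' t + b' c) ↔
      b' = Function.update b t (b t + b c) := by
    intro b'
    constructor <;>
    · rintro rfl
      simp [h, h2]
  rw [Matrix.mul_apply]
  simp only [cnotMatrix, Matrix.of_apply, h1, ite_mul, one_mul, zero_mul, Finset.sum_ite_eq',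
    Finset.mem_univ, if_true]

/-- The lowest `l` of the `k` lower qubits are copied to the `l` upper qubits. -/
theorem exists_synth_copy (hlk : l ≤ k) (L : List (Fin l)) (hL : L.Nodup) :
    ∃ C : Matrix (BitString (k + l)) (BitString (k + l)) ℂ, Synth L.length {C} ∧
      ∀ (Z : Matrix (BitString (k + l)) (BitString 0) ℂ) (b : BitString (k + l)) i,
        (C * Z) b i = Z (Fin.append (b ∘ Fin.castAdd l) fun q => b (Fin.natAdd k q) +
          if q ∈ L then b (Fin.castAdd l (Fin.castLE hlk q)) else 0) i := by
  induction L with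
  | nil =>
    refine ⟨1, synth_one, fun Z b i => ?_⟩
    rw [Matrix.one_mul]
    congr 1
    ext1 q
    refine Fin.addCases (fun q => ?_) (fun q => ?_) q <;> simp
  | cons j L ih =>
    obtain ⟨C, hC, h⟩ := ih hL.of_cons
    have hj : j ∉ L := (List.nodup_cons.1 hL).1
    have hne : Fin.castAdd l (Fin.castLE hlk j) ≠ Fin.natAdd k j := by
      intro h1
      have := congrArg Fin.val h1
      simp at this
      omega
    refine ⟨C * cnotMatrix (Fin.castAdd l (Fin.castLE hlk j)) (Fin.natAdd k j),
      hC.mul (synth_cnot _ _ hne) fun M hM => ⟨_, rfl, _, rfl, hM⟩, fun Z b i => ?_⟩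
    rw [Matrix.mul_assoc, h, cnotMatrix_mul_apply hne]
    congr 1
    ext1 q
    refine Fin.addCases (fun q => ?_) (fun q => ?_) q
    · rw [Function.update_of_ne]
      · simp
      · intro h1
        have := congrArg Fin.val h1
        simp at this
        omega
    · by_cases hq : q = j
      · subst hq
        simp [hj]
      · rw [Function.update_of_ne]
        · simp [hq]
        · intro h1
          exact hq (Fin.natAdd_injective _ _ h1)

theorem sum_append (f : BitString (k + l) → ℂ) : ∑ b, f b = ∑ c, ∑ d, f (Fin.append c d) := by
  rw [← (Fin.appendEquiv k l).sum_comp, Fintype.sum_prod_type]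
  rfl

theorem append_eq_padZero_iff (hlk : l ≤ k) (b : BitString (k + l)) (e : BitString l) :
    (Fin.append (b ∘ Fin.castAdd l) fun q => b (Fin.natAdd k q) +
      b (Fin.castAdd l (Fin.castLE hlk q))) = padZero (k + l) e ↔
      b ∘ Fin.castAdd l = padZero k e ∧ b ∘ Fin.natAdd k = e := by
  have h2 : ∀ z w : Fin 2, z + w = 0 ↔ z = w := by decide
  have h3 : ∀ q : Fin l, padZero (k + l) e (Fin.natAdd k q) = 0 := by
    intro q
    simp only [padZero]
    rw [dif_neg (by simp; omega)]
  have h4 : ∀ q : Fin k, padZero (k + l) e (Fin.castAdd l q) = padZero k e q := fun q => rfl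
  constructor
  · intro h
    have h5 : b ∘ Fin.castAdd l = padZero k e := by
      ext1 q
      have := congrFun h (Fin.castAdd l q)
      rwa [Fin.append_left, h4] at this
    refine ⟨h5, funext fun q => ?_⟩
    have := congrFun h (Fin.natAdd k q)
    rw [Fin.append_right, h3, h2] at this
    rw [Function.comp_apply, this]
    exact (congrFun h5 (Fin.castLE hlk q)).trans (padZero_castLE hlk e q)
  · rintro ⟨h5, h6⟩
    ext1 q
    refine Fin.addCases (fun q => ?_) (fun q => ?_) q
    · rw [Fin.append_left, h4, h5]
    · rw [Fin.append_right, h3, h2]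
      refine (congrFun h6 q).trans ?_
      exact ((congrFun h5 (Fin.castLE hlk q)).trans (padZero_castLE hlk e q)).symm

/-- State preparation by the Schmidt decomposition. -/
theorem generates_zero_add (hlk : l ≤ k) (hp : Generates 0 l p) (hx : GeneratesUpToDiagonal l k x)
    (hy : Generates l l y) : Generates 0 (k + l) (y + (x + (l + p))) := by
  obtain ⟨Sp, hSp, hp⟩ := hp
  obtain ⟨Sx, hSx, hx⟩ := hx
  obtain ⟨Sy, hSy, hy⟩ := hy
  have hln : l ≤ k + l := Nat.le_add_left l k
  obtain ⟨C, hC, hCZ⟩ := exists_synth_copy hlk (List.finRange l) (List.nodup_finRange l)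
  rw [List.length_finRange] at hC
  simp only [List.mem_finRange, if_true] at hCZ
  have he₁ : Function.Injective (Fin.castAdd l : Fin k → Fin (k + l)) := Fin.castAdd_injective k l
  have he₂ : Function.Injective (Fin.natAdd k : Fin l → Fin (k + l)) := Fin.natAdd_injective l k
  -- In time order: the Schmidt coefficients are prepared on the `l` lowest qubits (`p`), copied to
  -- the top `l` qubits (`l` CNOTs), and then each half is rotated to its Schmidt basis (`x` and
  -- `y`).
  refine ⟨_, (hSy.lift he₂).mul ((hSx.lift he₁).mul (hC.mul (hSp.lift (Fin.castLE_injective hln))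
    fun M hM => hM) fun M hM => hM) fun M hM => hM, fun U hU => ?_⟩
  -- The amplitudes of the state, arranged as a matrix with rows for the lower and columns for the
  -- upper qubits.
  obtain ⟨X, hX, Y, hY, s, -, hM⟩ := exists_svd (padZero k) (padZero_injective hlk)
    (Matrix.of fun c d => (U * firstColumns 0 (k + l)) (Fin.append c d) Fin.elim0)
  set σ : Matrix (BitString l) (BitString 0) ℂ := Matrix.of fun e _ => (s e : ℂ) with hσ
  -- The sum of the squared singular values is the squared norm of the amplitude matrix, which is
  -- that of the state.
  have hσσ : σᴴ * σ = 1 := by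
    have h1 : (U * firstColumns 0 (k + l))ᴴ * (U * firstColumns 0 (k + l)) = 1 := by
      rw [Matrix.conjTranspose_mul, Matrix.mul_assoc, ← Matrix.mul_assoc Uᴴ,
        ← Matrix.star_eq_conjTranspose U, Matrix.mem_unitaryGroup_iff'.1 hU, Matrix.one_mul,
        firstColumns_conjTranspose_mul_self (by omega)]
    have h2 := congrFun (congrFun h1 Fin.elim0) Fin.elim0
    rw [Matrix.mul_apply, sum_append] at h2
    have h3 : ∑ d, (s d : ℂ) * s d = 1 := by
      rw [← h2.trans (Matrix.one_apply_eq _), Finset.sum_comm]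
      have h4 := congrArg (fun M => Matrix.trace (Mᴴ * M)) hM
      have h5 : (X.submatrix id (padZero (m := l) k))ᴴ * X.submatrix id (padZero (m := l) k) =
          (1 : Matrix (BitString l) (BitString l) ℂ) := by
        rw [← mul_firstColumns, Matrix.conjTranspose_mul, Matrix.mul_assoc, ← Matrix.mul_assoc Xᴴ,
          ← Matrix.star_eq_conjTranspose X, Matrix.mem_unitaryGroup_iff'.1 hX, Matrix.one_mul,
          firstColumns_conjTranspose_mul_self hlk]
      have h6 : Matrix.trace 
          (((X.submatrix id (padZero (m := l) k) * Matrix.diagonal fun e : BitString l => (s e : ℂ)) * Y)ᴴ *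
            ((X.submatrix id (padZero (m := l) k) * Matrix.diagonal fun e : BitString l => (s e : ℂ)) * Y)) =
          ∑ d, (s d : ℂ) * s d := by
        rw [Matrix.conjTranspose_mul, Matrix.mul_assoc, Matrix.trace_mul_comm, Matrix.mul_assoc,
          Matrix.mul_assoc, ← Matrix.star_eq_conjTranspose Y, Matrix.mem_unitaryGroup_iff.1 hY,
          Matrix.mul_one, Matrix.conjTranspose_mul, Matrix.mul_assoc,
          ← Matrix.mul_assoc (X.submatrix id _)ᴴ, h5,
          Matrix.one_mul, Matrix.diagonal_conjTranspose, Matrix.diagonal_mul_diagonal,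
          Matrix.trace_diagonal]
        simp
      rw [h6] at h4
      rw [← h4]
      simp only [Matrix.trace, Matrix.diag_apply, Matrix.mul_apply, Matrix.conjTranspose_apply,
        Matrix.of_apply]
    ext i j
    rw [Subsingleton.elim i j, Matrix.one_apply_eq, ← h3, Matrix.mul_apply]
    simp [hσ]
  obtain ⟨P, hP, hPσ⟩ := exists_unitary_extension (padZero l) (padZero_injective (by omega)) σ hσσ
  obtain ⟨MP, hMP, hMPP⟩ := hp P hP
  rw [mul_firstColumns P, ← hPσ] at hMPP
  obtain ⟨MX, hMX, δ, hδ, hXM⟩ := hx X hX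
  -- After copying, both registers carry the same bits, so the diagonal missing from `X` can be
  -- applied to the upper one, where it merges with `Yᵀ`.
  obtain ⟨N, hN, hNY⟩ := hy (Yᵀ * Matrix.diagonal δ) (mul_mem
    (Matrix.transpose_mem_unitaryGroup_iff.2 hY) (diagonal_mem_unitaryGroup hδ))
  rw [firstColumns_self, Matrix.mul_one, Matrix.mul_one] at hNY
  refine ⟨_, ⟨_, ⟨N, hN, rfl⟩, _, ⟨_, ⟨MX, hMX, rfl⟩, _, ⟨C, rfl, _, ⟨MP, hMP, rfl⟩, rfl⟩, rfl⟩,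
    rfl⟩, ?_⟩
  have hstart : liftMatrix (Fin.castLE hln) MP * firstColumns 0 (k + l) =
      firstColumns l (k + l) * σ := by
    rw [← firstColumns_mul_firstColumns (Nat.zero_le l), ← Matrix.mul_assoc,
      liftMatrix_mul_firstColumns, Matrix.mul_assoc, hMPP]
  have hcopy : ∀ b i, (C * (firstColumns l (k + l) * σ)) b i =
      if b ∘ Fin.castAdd l = padZero k (b ∘ Fin.natAdd k) then (s (b ∘ Fin.natAdd k) : ℂ) else 0 := by
    intro b i
    rw [hCZ, Matrix.mul_apply]
    simp only [firstColumns_apply, append_eq_padZero_iff hlk]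
    rw [Finset.sum_eq_single (b ∘ Fin.natAdd k)]
    · simp [hσ]
    · intro e _ he
      simp [Ne.symm he]
    · simp
  have hext₁ : ∀ (b : BitString (k + l)) c, Function.extend (Fin.castAdd l) c b ∘ Fin.natAdd k =
      b ∘ Fin.natAdd k := by
    intro b c
    ext1 q
    rw [Function.comp_apply, Function.extend_apply']
    · rfl
    · rintro ⟨a, ha⟩
      have := congrArg Fin.val ha
      simp at this
      omega
  have hext₂ : ∀ (b : BitString (k + l)) d, Function.extend (Fin.natAdd k) d b ∘ Fin.castAdd l =
      b ∘ Fin.castAdd l := by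
    intro b c
    ext1 q
    rw [Function.comp_apply, Function.extend_apply']
    · rfl
    · rintro ⟨a, ha⟩
      have := congrArg Fin.val ha
      simp at this
      omega
  have hlow : ∀ b i, (liftMatrix (Fin.castAdd l) MX * (C * (firstColumns l (k + l) * σ))) b i =
      MX (b ∘ Fin.castAdd l) (padZero k (b ∘ Fin.natAdd k)) * s (b ∘ Fin.natAdd k) := by
    intro b i
    rw [liftMatrix_mul_apply he₁]
    simp only [hcopy, hext₁, extend_comp_self he₁, mul_ite, mul_zero, Finset.sum_ite_eq',
      Finset.mem_univ, if_true]
  have hXM' : ∀ c d, X c (padZero k d) = MX c (padZero k d) * δ d := by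
    intro c d
    have := congrFun (congrFun hXM c) d
    rwa [Matrix.mul_diagonal, mul_firstColumns, mul_firstColumns] at this
  rw [Matrix.mul_assoc, Matrix.mul_assoc, Matrix.mul_assoc, hstart]
  ext b i
  rw [liftMatrix_mul_apply he₂]
  simp only [hlow, hext₂, extend_comp_self he₂]
  have hMb := congrFun (congrFun hM (b ∘ Fin.castAdd l)) (b ∘ Fin.natAdd k)
  rw [Matrix.of_apply] at hMb
  have hb : Fin.append (b ∘ Fin.castAdd l) (b ∘ Fin.natAdd k) = b := Fin.append_castAdd_natAdd
  rw [hb] at hMb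
  rw [Subsingleton.elim i Fin.elim0, hMb, hNY, Matrix.mul_apply]
  refine Finset.sum_congr rfl fun d _ => ?_
  rw [Matrix.mul_diagonal, Matrix.mul_diagonal, Matrix.transpose_apply, Matrix.submatrix_apply, id,
    hXM']
  ring

end StatePreparation

/-! ### One input and four outputs. -/

section OneInput

variable {m n k l : ℕ}

theorem diagonal_mul_stack {κ : Type*} (d : BitString (n + 1) → ℂ)
    (Z : Fin 2 → Matrix (BitString n) κ ℂ) : Matrix.diagonal d * stack Z =
      stack fun x => Matrix.diagonal (fun c : BitString n => d (addTop c x)) * Z x := by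
  refine Matrix.ext_addTop fun c x k => ?_
  rw [stack_addTop, Matrix.diagonal_mul, Matrix.diagonal_mul, stack_addTop]

theorem mul_stack {ι κ : Type*} (Q : Matrix ι (BitString (n + 1)) ℂ)
    (Z : Fin 2 → Matrix (BitString n) κ ℂ) :
    Q * stack Z = ∑ x, Q.submatrix id (fun c => addTop c x) * Z x := by
  ext i k
  rw [Matrix.mul_apply, sum_addTop, Matrix.sum_apply]
  refine Finset.sum_congr rfl fun x _ => ?_
  rw [Matrix.mul_apply]
  exact Finset.sum_congr rfl fun c _ => by rw [stack_addTop]; rfl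

/-- Two isometries with orthogonal sum and difference are rotated into each other. -/
theorem exists_rotation_of_diagonal (hmn : m + 1 ≤ n) {a b : Matrix (BitString n) (BitString m) ℂ}
    {g : BitString m → ℝ} (ha : aᴴ * a = 1) (hb : bᴴ * b = 1)
    (hba : bᴴ * a = Matrix.diagonal fun c : BitString m => (g c : ℂ)) :
    ∃ V ∈ Matrix.unitaryGroup (BitString n) ℂ, ∃ φ : BitString m → ℝ,
      a = V * firstColumns (m + 1) n *
        (stack fun y => Matrix.diagonal fun c : BitString m => rotY (φ c) y 0) ∧
      b = V * firstColumns (m + 1) n *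
        (stack fun y => Matrix.diagonal fun c : BitString m => rotY (-φ c) y 0) := by
  have hab : aᴴ * b = Matrix.diagonal fun c : BitString m => (g c : ℂ) := by
    have := congrArg Matrix.conjTranspose hba
    rw [Matrix.conjTranspose_mul, Matrix.conjTranspose_conjTranspose,
      Matrix.diagonal_conjTranspose] at this
    rw [this]
    congr 1
    ext c
    simp
  -- The columns of `Q` are those of `(a + b) / 2` and `(a - b) / 2`. They are orthogonal because
  -- the overlap is real and diagonal, and their squared lengths are `(1 ± g) / 2`.
  set σ : Fin 2 → ℝ := fun y => if y = 0 then 1 else -1 with hσ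
  set Q : Matrix (BitString n) (BitString (m + 1)) ℂ := Matrix.of fun i e =>
    2⁻¹ * (a i (e ∘ Fin.castSucc) + σ (e (Fin.last m)) * b i (e ∘ Fin.castSucc)) with hQ
  set t : BitString (m + 1) → ℝ := fun e => (1 + σ (e (Fin.last m)) * g (e ∘ Fin.castSucc)) / 2
    with ht
  have hQQ : Qᴴ * Q = Matrix.diagonal fun e : BitString (m + 1) => (t e : ℂ) := by
    refine Matrix.ext_addTop fun c x e => ?_
    rw [← addTop_self e]
    generalize e ∘ Fin.castSucc = c'
    generalize e (Fin.last m) = x'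
    have h1 : ∀ i, Qᴴ (addTop c x) i * Q i (addTop c' x') =
        4⁻¹ * (aᴴ c i * a i c' + σ x' * (aᴴ c i * b i c') + σ x * (bᴴ c i * a i c') +
          σ x * σ x' * (bᴴ c i * b i c')) := by
      intro i
      simp only [hQ, Matrix.conjTranspose_apply, Matrix.of_apply, addTop_comp_castSucc, addTop_last,
        star_mul', star_add, star_inv₀, star_ofNat, Complex.star_def, Complex.conj_ofReal]
      ring
    rw [Matrix.mul_apply, Finset.sum_congr rfl fun i _ => h1 i, ← Finset.mul_sum,
      Finset.sum_add_distrib, Finset.sum_add_distrib, Finset.sum_add_distrib, ← Finset.mul_sum,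
      ← Finset.mul_sum, ← Finset.mul_sum, ← Matrix.mul_apply, ← Matrix.mul_apply,
      ← Matrix.mul_apply, ← Matrix.mul_apply, ha, hb, hab, hba, Matrix.diagonal_apply,
      Matrix.diagonal_apply, Matrix.one_apply]
    have h2 : addTop c x = addTop c' x' ↔ c = c' ∧ x = x' := by
      constructor
      · intro h
        exact ⟨by simpa using congrArg (· ∘ Fin.castSucc) h, by simpa using congrFun h (Fin.last m)⟩
      · rintro ⟨rfl, rfl⟩; rfl
    simp only [h2]
    by_cases hc : c = c'
    · subst hc
      simp only [ht, addTop_last, addTop_comp_castSucc]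
      fin_cases x <;> fin_cases x' <;> simp [hσ] <;> ring
    · simp [hc]
  have ht0 : ∀ e, 0 ≤ t e := nonneg_of_conjTranspose_mul_self_eq_diagonal hQQ
  have ht1 : ∀ c, t (addTop c 1) = 1 - t (addTop c 0) := by
    intro c
    simp only [ht, hσ, addTop_last, addTop_comp_castSucc, if_true, if_neg one_ne_zero]
    ring
  obtain ⟨V, hV, hQV⟩ := exists_unitary_of_orthogonal_columns (padZero n) (padZero_injective hmn)
    Q (fun e => √(t e)) (by
      rw [hQQ]
      congr 1
      ext e
      rw [← Complex.ofReal_pow, Real.sq_sqrt (ht0 e)])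
  rw [← mul_firstColumns] at hQV
  -- The two squared lengths for `c` add up to 1, so they are a squared cosine and sine. Hence `a`
  -- and `b` are the cosine column plus, respectively minus, the sine column.
  refine ⟨V, hV, fun c => Real.arccos √(t (addTop c 0)), ?_⟩
  have hcos : ∀ c, Real.cos (Real.arccos √(t (addTop c 0))) = √(t (addTop c 0)) := by
    intro c
    refine Real.cos_arccos (by linarith [Real.sqrt_nonneg (t (addTop c 0))]) ?_
    rw [Real.sqrt_le_one]
    linarith [ht0 (addTop c 1), ht1 c]
  have hsin : ∀ c, Real.sin (Real.arccos √(t (addTop c 0))) = √(t (addTop c 1)) := by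
    intro c
    rw [Real.sin_arccos, Real.sq_sqrt (ht0 _), ht1]
  have h3 : ∀ τ : Fin 2 → ℝ, V * firstColumns (m + 1) n * (stack fun y =>
      Matrix.diagonal fun c : BitString m => ((√(t (addTop c y)) * τ y : ℝ) : ℂ)) =
      ∑ y, (τ y : ℂ) • Q.submatrix id fun c => addTop c y := by
    intro τ
    have h4 : (stack fun y =>
        Matrix.diagonal fun c : BitString m => ((√(t (addTop c y)) * τ y : ℝ) : ℂ)) =
        Matrix.diagonal (fun e : BitString (m + 1) => (√(t e) : ℂ)) *
          stack fun y => (τ y : ℂ) • (1 : Matrix (BitString m) (BitString m) ℂ) := by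
      rw [diagonal_mul_stack]
      refine congrArg stack (funext fun y => ?_)
      rw [Matrix.smul_one_eq_diagonal, Matrix.diagonal_mul_diagonal]
      simp
    rw [h4, ← Matrix.mul_assoc, ← hQV, mul_stack]
    simp only [Matrix.mul_smul, Matrix.mul_one]
  constructor
  · have h4 : (stack fun y => Matrix.diagonal fun c : BitString m =>
        rotY (Real.arccos √(t (addTop c 0))) y 0) = stack fun y =>
        Matrix.diagonal fun c : BitString m => ((√(t (addTop c y)) * (fun _ => 1) y : ℝ) : ℂ) := by
      refine congrArg stack (funext fun y => congrArg Matrix.diagonal (funext fun c => ?_))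
      fin_cases y
      · simp [rotY, -Complex.ofReal_cos, -Complex.ofReal_sin, hcos]
      · simp [rotY, -Complex.ofReal_cos, -Complex.ofReal_sin, hsin]
    rw [h4, h3]
    ext i c
    simp [hQ, hσ, Fin.sum_univ_two]
    ring
  · have h4 : (stack fun y => Matrix.diagonal fun c : BitString m =>
        rotY (-Real.arccos √(t (addTop c 0))) y 0) = stack fun y =>
        Matrix.diagonal fun c : BitString m => ((√(t (addTop c y)) * σ y : ℝ) : ℂ) := by
      refine congrArg stack (funext fun y => congrArg Matrix.diagonal (funext fun c => ?_))
      fin_cases y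
      · simp [rotY, -Complex.ofReal_cos, -Complex.ofReal_sin, hcos, hσ]
      · simp [rotY, -Complex.ofReal_cos, -Complex.ofReal_sin, hsin, hσ]
    rw [h4, h3]
    ext i c
    simp [hQ, hσ, Fin.sum_univ_two]
    ring

/-- Two isometries have a common range of twice the dimension, in which they are rotations. -/
theorem exists_common_range (hmn : m + 1 ≤ n) {a : Fin 2 → Matrix (BitString n) (BitString m) ℂ}
    (ha : ∀ x, (a x)ᴴ * a x = 1) :
    ∃ V ∈ Matrix.unitaryGroup (BitString n) ℂ, ∃ φ : Fin 2 → BitString m → ℝ,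
      ∃ R : Fin 2 → Matrix (BitString m) (BitString m) ℂ,
      (∀ x, R x ∈ Matrix.unitaryGroup (BitString m) ℂ) ∧
      ∀ x, a x = V * firstColumns (m + 1) n *
        (stack fun y => Matrix.diagonal fun c : BitString m => rotY (φ x c) y 0) * R x := by
  -- Principal angles: the singular value decomposition of the overlap gives bases of the inputs in
  -- which it is real and diagonal.
  obtain ⟨X, hX, Y, hY, g, -, hG⟩ := exists_svd id Function.injective_id ((a 1)ᴴ * a 0)
  rw [Matrix.submatrix_id_id] at hG
  have hX1 := Matrix.mem_unitaryGroup_iff'.1 hX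
  have hX2 := Matrix.mem_unitaryGroup_iff.1 hX
  have hY1 := Matrix.mem_unitaryGroup_iff'.1 hY
  have hY2 := Matrix.mem_unitaryGroup_iff.1 hY
  rw [Matrix.star_eq_conjTranspose] at hX1 hX2 hY1 hY2
  obtain ⟨V, hV, φ, h0, h1⟩ := exists_rotation_of_diagonal hmn (a := a 0 * Yᴴ) (b := a 1 * X)
    (g := g) (by
      rw [Matrix.conjTranspose_mul, Matrix.conjTranspose_conjTranspose, Matrix.mul_assoc,
        ← Matrix.mul_assoc (a 0)ᴴ, ha, Matrix.one_mul, hY2])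
    (by rw [Matrix.conjTranspose_mul, Matrix.mul_assoc, ← Matrix.mul_assoc (a 1)ᴴ, ha,
        Matrix.one_mul, hX1])
    (by rw [Matrix.conjTranspose_mul, Matrix.mul_assoc, ← Matrix.mul_assoc (a 1)ᴴ, hG,
        Matrix.mul_assoc _ Y, hY2, Matrix.mul_one, ← Matrix.mul_assoc, hX1, Matrix.one_mul])
  refine ⟨V, hV, fun x c => if x = 0 then φ c else -φ c, fun x => if x = 0 then Y else Xᴴ,
    fun x => ?_, fun x => ?_⟩
  · dsimp only
    split_ifs
    · exact hY
    · exact Unitary.star_mem hX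
  · by_cases hx : x = 0
    · subst hx
      simp only [if_true]
      rw [← h0, Matrix.mul_assoc, hY1, Matrix.mul_one]
    · have hx : x = 1 := by omega
      subst hx
      simp only [if_neg one_ne_zero]
      rw [← h1, Matrix.mul_assoc, hX2, Matrix.mul_one]

theorem mux_ctl (t : Fin n) (f : Fin 2 → BitString n → Matrix (Fin 2) (Fin 2) ℂ) :
    (mux fun x => ctl t (f x)) =
      ctl t.castSucc fun b => f (b (Fin.last n)) (b ∘ Fin.castSucc) := by
  ext b b'
  simp only [mux, ctl, Matrix.of_apply, Function.comp_apply]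
  rw [← ite_and]
  refine if_congr ⟨?_, fun h => ⟨h _ (Fin.castSucc_lt_last t).ne', fun i hi => h _ ?_⟩⟩ rfl rfl
  · rintro ⟨h1, h2⟩ i hi
    induction i using Fin.lastCases with
    | last => exact h1
    | cast i => exact h2 i fun h => hi (by rw [h])
  · exact fun h => hi (Fin.castSucc_injective n h)

/-- A gate on the lowest qubit, selected by another qubit. -/
theorem synth_mux_one : Synth 2 {M : Matrix (BitString 2) (BitString 2) ℂ |
    ∃ R : Fin 2 → Matrix (BitString 1) (BitString 1) ℂ,
      (∀ x, R x ∈ Matrix.unitaryGroup (BitString 1) ℂ) ∧ M = mux R} := by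
  obtain ⟨S, hS, h⟩ := generates_one
  have hc := Fin.castSucc_injective 1
  refine Synth.mono ((hS.lift hc).mul ((synth_top_rotZ 1).mul (hS.lift hc) fun M hM => hM)
    fun M hM => hM) ?_ le_rfl
  rintro _ ⟨R, hR, rfl⟩
  obtain ⟨V, hV, W, hW, d, hd⟩ := exists_mux_eq hR
  obtain ⟨V', hV', hVV⟩ := h V hV
  obtain ⟨W', hW', hWW⟩ := h W hW
  rw [firstColumns_self, Matrix.mul_one, Matrix.mul_one] at hVV hWW
  exact ⟨_, ⟨V', hV', rfl⟩, _, ⟨_, ⟨d, rfl⟩, _, ⟨W', hW', rfl⟩, rfl⟩, by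
    rw [hd, hVV, hWW, Matrix.mul_assoc]⟩

theorem liftMatrix_mux_one (R : Fin 2 → Matrix (BitString 1) (BitString 1) ℂ) (hn : 1 ≤ n) :
    liftMatrix ![(0 : Fin (n + 1)), Fin.last n] (mux R) =
      mux fun x => liftMatrix (Fin.castLE hn) (R x) := by
  ext b b'
  have h1 : Fin.last n ≠ 0 := by
    intro h
    have := congrArg Fin.val h
    simp at this
    omega
  have h2 : ∀ b : BitString (n + 1), (b ∘ ![(0 : Fin (n + 1)), Fin.last n]) ∘ Fin.castSucc =
      (b ∘ Fin.castSucc) ∘ Fin.castLE hn := by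
    intro b
    ext1 i
    rw [Subsingleton.elim i 0]
    rfl
  simp only [liftMatrix, mux, Matrix.of_apply, h2]
  rw [← ite_and, ← ite_and]
  refine if_congr ⟨fun ⟨h3, h4⟩ => ⟨h4, fun i hi => h3 _ ?_⟩, fun ⟨h3, h4⟩ => ⟨fun i hi => ?_, h3⟩⟩
    rfl rfl
  · intro a
    fin_cases a
    · intro h
      refine hi 0 (Fin.castSucc_injective n ?_)
      rw [← h]
      rfl
    · exact (Fin.castSucc_lt_last i).ne'
  · induction i using Fin.lastCases with
    | last => exact h3
    | cast i =>
      refine h4 i fun a ha => hi 0 ?_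
      rw [← ha, Subsingleton.elim a 0]
      rfl

/-- The isometries into three qubits selected by the top qubit share a range, so a single unselected
2 to 3 isometry `V` (`k`) suffices. Before it come a `rotY` of the added qubit (4), a one-qubit gate
selected by the top qubit (2), and the cosine-sine rotation of the top qubit (2), after a free gate
on the input. -/
theorem generates_one_four (h : Generates 2 3 k) : Generates 1 4 (k + (4 + (2 + (2 + 0)))) := by
  obtain ⟨S, hS, h⟩ := h
  obtain ⟨S₁, hS₁, h₁⟩ := generates_one
  have hc := Fin.castSucc_injective 3
  have he : Function.Injective ![(0 : Fin 4), Fin.last 3] := by decide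
  -- Qubit 1 is the one added for the common range. Its angle depends on the input qubit 0 and on
  -- the top qubit 3, which selects the isometry.
  have hY := synth_rot isReversedBy_rotY (1 : Fin 4) [0, 3] (by decide)
  have hY' := synth_rot isReversedBy_rotY (Fin.last 3) _
    (last_notMem_inputQubits (show 1 ≤ 3 by norm_num))
  rw [length_inputQubits] at hY'
  refine ⟨_, (hS.lift hc).mul (hY.mul ((synth_mux_one.lift he).mul (hY'.mul
    (hS₁.lift (Fin.castLE_injective (show 1 ≤ 4 by norm_num))) fun M hM => hM) fun M hM => hM)
    fun M hM => hM) fun M hM => hM, fun U hU => ?_⟩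
  obtain ⟨A, hA, R, hR, θ, hUA⟩ := exists_cosineSine_stack (show 1 ≤ 3 by norm_num) hU
  obtain ⟨V, hV, φ, Q, hQ, hVQ⟩ := exists_common_range (show 1 + 1 ≤ 3 by norm_num)
    (a := fun x => A x * firstColumns 1 3) fun x => by
      rw [Matrix.conjTranspose_mul, Matrix.mul_assoc, ← Matrix.mul_assoc (A x)ᴴ,
        ← Matrix.star_eq_conjTranspose (A x), Matrix.mem_unitaryGroup_iff'.1 (hA x),
        Matrix.one_mul, firstColumns_conjTranspose_mul_self (by norm_num)]
  obtain ⟨MV, hMV, hMVV⟩ := h V hV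
  obtain ⟨MR, hMR, hMRR⟩ := h₁ R hR
  rw [firstColumns_self, Matrix.mul_one, Matrix.mul_one] at hMRR
  have hl : (1 : ℕ) ≤ 1 := le_rfl
  refine ⟨_, ⟨_, ⟨MV, hMV, rfl⟩, _, ⟨_, ⟨fun b => φ (b (Fin.last 3))
      (b ∘ Fin.castSucc ∘ Fin.castLE (show 1 ≤ 3 by norm_num)), ?_, rfl⟩, _, ⟨_, ⟨_, ⟨Q, hQ, rfl⟩,
      rfl⟩, _, ⟨_, ⟨_, dependsOn_inputQubits _ θ, rfl⟩, _, ⟨MR, hMR, rfl⟩, rfl⟩, rfl⟩, rfl⟩, rfl⟩,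
      ?_⟩
  · intro b b' hb
    have h0 := hb 0 (by simp)
    have h3 : b (Fin.last 3) = b' (Fin.last 3) := hb 3 (by simp)
    change φ (b (Fin.last 3)) _ = φ (b' (Fin.last 3)) _
    rw [h3]
    refine congrArg _ (funext fun i => ?_)
    rw [Subsingleton.elim i 0]
    exact h0
  · have e₁ : (ctl (1 : Fin 4) fun b => rotY (φ (b (Fin.last 3))
        (b ∘ Fin.castSucc ∘ Fin.castLE (show 1 ≤ 3 by norm_num)))) = mux fun x =>
        liftMatrix (Fin.castLE (show 2 ≤ 3 by norm_num))
          (ctl (Fin.last 1) fun b => rotY (φ x (b ∘ Fin.castSucc ∘ Fin.castLE hl))) := by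
      simp only [liftMatrix_ctl (Fin.castLE_injective _)]
      rw [mux_ctl]
      rfl
    have e₂ : ∀ x, (ctl (Fin.last 1) fun b => rotY (φ x (b ∘ Fin.castSucc ∘ Fin.castLE hl))) *
        firstColumns 1 2 = stack fun y => Matrix.diagonal fun c => rotY (φ x c) y 0 := by
      intro x
      have := ctl_rotY_mul_liftMatrix_mul_firstColumns hl (φ x) 1
      rw [liftMatrix_one, Matrix.one_mul, firstColumns_self] at this
      simpa using this
    rw [hUA, hMRR, Matrix.mul_assoc, Matrix.mul_assoc, Matrix.mul_assoc, Matrix.mul_assoc,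
      ctl_rotY_mul_liftMatrix_mul_firstColumns, liftMatrix_mux_one _ (by norm_num), mux_mul_stack,
      e₁, mux_mul_stack, liftMatrix_castSucc, mux_mul_stack]
    refine congrArg stack (funext fun x => ?_)
    have e₃ := hVQ x
    have e₄ : firstColumns 1 3 = firstColumns 2 3 * firstColumns 1 2 :=
      (firstColumns_mul_firstColumns (by norm_num)).symm
    have e₅ := liftMatrix_mul_firstColumns (show 1 ≤ 3 by norm_num) (Q x)
    have e₆ := liftMatrix_mul_firstColumns (show 2 ≤ 3 by norm_num)
      (ctl (Fin.last 1) fun b => rotY (φ x (b ∘ Fin.castSucc ∘ Fin.castLE hl)))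
    generalize (Matrix.diagonal fun c : BitString 1 => rotY (θ c) x 0) = D
    calc _ = MV * (liftMatrix (Fin.castLE (show 2 ≤ 3 by norm_num))
          (ctl (Fin.last 1) fun b => rotY (φ x (b ∘ Fin.castSucc ∘ Fin.castLE hl))) *
            (liftMatrix (Fin.castLE (show 1 ≤ 3 by norm_num)) (Q x) * firstColumns 1 3)) * D * R := by
          simp only [Matrix.mul_assoc]
      _ = MV * firstColumns 2 3 * ((ctl (Fin.last 1) fun b =>
          rotY (φ x (b ∘ Fin.castSucc ∘ Fin.castLE hl))) * firstColumns 1 2) * Q x * D * R := by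
          rw [e₅, e₄, Matrix.mul_assoc (firstColumns 2 3), ← Matrix.mul_assoc _ (firstColumns 2 3),
            e₆]
          simp only [Matrix.mul_assoc]
      _ = _ := by rw [hMVV, e₂, ← e₃]

end OneInput

/-! ### The lower bound for one input and two outputs. -/

section LowerBound

/-- The operation `a` on the qubit `0` and `d` on the qubit `1`. -/
def localMatrix (a d : Matrix (Fin 2) (Fin 2) ℂ) : Matrix (BitString 2) (BitString 2) ℂ :=
  Matrix.of fun b b' => a (b 0) (b' 0) * d (b 1) (b' 1)

theorem sum_bitString_two (f : BitString 2 → ℂ) : ∑ b, f b = ∑ x, ∑ y, f ![x, y] := by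
  rw [← (finTwoArrowEquiv (Fin 2)).symm.sum_comp, Fintype.sum_prod_type]
  rfl

theorem localMatrix_mul (a d a' d' : Matrix (Fin 2) (Fin 2) ℂ) :
    localMatrix a d * localMatrix a' d' = localMatrix (a * a') (d * d') := by
  ext b b'
  simp only [localMatrix, Matrix.of_apply, Matrix.mul_apply, sum_bitString_two, Finset.sum_mul_sum]
  refine Finset.sum_congr rfl fun x _ => Finset.sum_congr rfl fun y _ => ?_
  simp only [Matrix.cons_val_zero, Matrix.cons_val_one]
  ring

theorem localMatrix_transpose (a d : Matrix (Fin 2) (Fin 2) ℂ) :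
    (localMatrix a d)ᵀ = localMatrix aᵀ dᵀ := rfl

theorem localMatrix_one : localMatrix 1 1 = 1 := by
  ext b b'
  simp only [localMatrix, Matrix.of_apply, Matrix.one_apply, funext_iff, Fin.forall_fin_two]
  split_ifs <;> simp_all

theorem singleQubitMatrix_zero_eq (U : Matrix (Fin 2) (Fin 2) ℂ) :
    singleQubitMatrix 0 U = localMatrix U 1 := by
  ext b b'
  simp [singleQubitMatrix, localMatrix, Matrix.one_apply, Fin.forall_fin_two]

theorem singleQubitMatrix_one_eq (U : Matrix (Fin 2) (Fin 2) ℂ) :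
    singleQubitMatrix 1 U = localMatrix 1 U := by
  ext b b'
  simp [singleQubitMatrix, localMatrix, Matrix.one_apply, Fin.forall_fin_two]

/-- The invertible product operations. -/
def IsLocal (M : Matrix (BitString 2) (BitString 2) ℂ) : Prop :=
  ∃ a d : Matrix (Fin 2) (Fin 2) ℂ, a.det ≠ 0 ∧ d.det ≠ 0 ∧ M = localMatrix a d

theorem IsLocal.mul {M N : Matrix (BitString 2) (BitString 2) ℂ} (hM : IsLocal M)
    (hN : IsLocal N) : IsLocal (M * N) := by
  obtain ⟨a, d, ha, hd, rfl⟩ := hM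
  obtain ⟨a', d', ha', hd', rfl⟩ := hN
  exact ⟨a * a', d * d', by rw [Matrix.det_mul]; exact mul_ne_zero ha ha',
    by rw [Matrix.det_mul]; exact mul_ne_zero hd hd', localMatrix_mul _ _ _ _⟩

theorem isLocal_single (j : Fin 2) (U : Matrix.unitaryGroup (Fin 2) ℂ) :
    IsLocal (QGate.toMatrix (.single j U)) := by
  have hU : (U : Matrix (Fin 2) (Fin 2) ℂ).det ≠ 0 := by
    intro h
    have := congrArg Matrix.det (Matrix.mem_unitaryGroup_iff.1 U.2)
    rw [Matrix.det_mul, h] at this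
    simp at this
  fin_cases j
  · exact ⟨U, 1, hU, by simp, singleQubitMatrix_zero_eq _⟩
  · exact ⟨1, U, by simp, hU, singleQubitMatrix_one_eq _⟩

theorem isLocal_toMatrix {C : QCircuit 2} (hC : QCircuit.cnotCount C = 0) :
    IsLocal (QCircuit.toMatrix C) := by
  induction C with
  | nil => exact ⟨1, 1, by simp, by simp, localMatrix_one.symm⟩
  | cons g C ih =>
    cases g with
    | single j U =>
      refine (ih ?_).mul (isLocal_single j U)
      simpa [QCircuit.cnotCount, QTopology.cnotCount, QCircuit.topology, QGate.slot,
        QSlot.isCnot] using hC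
    | cnot c t h =>
      simp [QCircuit.cnotCount, QTopology.cnotCount, QCircuit.topology, QGate.slot,
        QSlot.isCnot] at hC

theorem isLocal_or_exists_of_cnotCount_le_one {C : QCircuit 2} (hC : QCircuit.cnotCount C ≤ 1) :
    IsLocal (QCircuit.toMatrix C) ∨ ∃ M N : Matrix (BitString 2) (BitString 2) ℂ, ∃ c t, c ≠ t ∧
      IsLocal M ∧ IsLocal N ∧ QCircuit.toMatrix C = M * cnotMatrix c t * N := by
  induction C with
  | nil => exact Or.inl (isLocal_toMatrix (by simp [QCircuit.cnotCount, QTopology.cnotCount,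
      QCircuit.topology]))
  | cons g C ih =>
    cases g with
    | single j U =>
      have hg := isLocal_single j U
      rcases ih (by simpa [QCircuit.cnotCount, QTopology.cnotCount, QCircuit.topology, QGate.slot,
        QSlot.isCnot] using hC) with h | ⟨M, N, c, t, hct, hM, hN, h⟩
      · exact Or.inl (h.mul hg)
      · exact Or.inr ⟨M, N * QGate.toMatrix (.single j U), c, t, hct, hM, hN.mul hg, by
          rw [QCircuit.toMatrix, h, Matrix.mul_assoc, Matrix.mul_assoc]⟩
    | cnot c t h =>
      -- The head acts first and is the only CNOT, so nothing precedes it and the rest is local.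
      refine Or.inr ⟨QCircuit.toMatrix C, 1, c, t, h, isLocal_toMatrix ?_,
        ⟨1, 1, by simp, by simp, localMatrix_one.symm⟩, by rw [Matrix.mul_one]; rfl⟩
      have h1 : QCircuit.cnotCount (QGate.cnot c t h :: C) = QCircuit.cnotCount C + 1 :=
        List.countP_cons_of_pos (p := QSlot.isCnot) (l := C.map QGate.slot) (a := .cnot c t h) rfl
      omega

/-- The symplectic form of a qubit. -/
def qubitForm : Matrix (Fin 2) (Fin 2) ℂ := !![0, 1; -1, 0]

/-- The symmetric form of two qubits that local operations preserve up to a scalar. -/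
def concurrenceForm : Matrix (BitString 2) (BitString 2) ℂ := localMatrix qubitForm qubitForm

/-- An alternating form on the plane is scaled by the determinant. -/
theorem transpose_mul_qubitForm_mul (a : Matrix (Fin 2) (Fin 2) ℂ) :
    aᵀ * qubitForm * a = a.det • qubitForm := by
  ext i j
  fin_cases i <;> fin_cases j <;>
    simp [qubitForm, Matrix.mul_apply, Fin.sum_univ_two, Matrix.det_fin_two] <;> ring

theorem transpose_mul_concurrenceForm_mul (a d : Matrix (Fin 2) (Fin 2) ℂ) :
    (localMatrix a d)ᵀ * concurrenceForm * localMatrix a d =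
      (a.det * d.det) • concurrenceForm := by
  rw [concurrenceForm, localMatrix_transpose, localMatrix_mul, localMatrix_mul,
    transpose_mul_qubitForm_mul, transpose_mul_qubitForm_mul]
  ext b b'
  simp only [localMatrix, Matrix.of_apply, Matrix.smul_apply, smul_eq_mul]
  ring

theorem cnotMatrix_transpose_mul_mul {c t : Fin 2} (N : Matrix (BitString 2) (BitString 2) ℂ) :
    (cnotMatrix c t)ᵀ * N * cnotMatrix c t = Matrix.of fun b b' =>
      N (Function.update b t (b t + b c)) (Function.update b' t (b' t + b' c)) := by
  ext b b'
  rw [Matrix.mul_apply]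
  simp only [Matrix.mul_apply, Matrix.transpose_apply, cnotMatrix, Matrix.of_apply]
  simp

/-- The pulled-back form is X on the control times Z on the target. Invertibility is recorded for
qubit 0 only: it carries the input, while qubit 1 starts in the zero state and contributes a scalar.
-/
theorem cnotMatrix_transpose_mul_concurrenceForm_mul {c t : Fin 2} (h : c ≠ t) :
    ∃ p q : Matrix (Fin 2) (Fin 2) ℂ, p.det ≠ 0 ∧
      (cnotMatrix c t)ᵀ * concurrenceForm * cnotMatrix c t = localMatrix p q := by
  have key : ∀ x y x' y' : Fin 2, qubitForm x x' * qubitForm (y + x) (y' + x') =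
      pauliX x x' * pauliZ y y' := by
    intro x y x' y'
    fin_cases x <;> fin_cases x' <;> fin_cases y <;> fin_cases y' <;>
      simp [qubitForm, pauliX, pauliZ]
  rw [cnotMatrix_transpose_mul_mul]
  rcases (by omega : c = 0 ∧ t = 1 ∨ c = 1 ∧ t = 0) with ⟨rfl, rfl⟩ | ⟨rfl, rfl⟩
  · refine ⟨pauliX, pauliZ, by simp [pauliX, Matrix.det_fin_two], ?_⟩
    ext b b'
    simpa [concurrenceForm, localMatrix] using key (b 0) (b 1) (b' 0) (b' 1)
  · refine ⟨pauliZ, pauliX, by simp [pauliZ, Matrix.det_fin_two], ?_⟩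
    ext b b'
    have := key (b 1) (b 0) (b' 1) (b' 0)
    rw [mul_comm, mul_comm (pauliX _ _)] at this
    simpa [concurrenceForm, localMatrix] using this

/-- The form that one controlled-NOT gate pulls back to the input qubit is a multiple of an
invertible one. -/
theorem exists_form_of_cnotCount_le_one {C : QCircuit 2} (hC : QCircuit.cnotCount C ≤ 1) :
    ∃ (w : ℂ) (p : Matrix (Fin 2) (Fin 2) ℂ), p.det ≠ 0 ∧ ∀ c c' : BitString 1,
      ((QCircuit.toMatrix C * firstColumns 1 2)ᵀ * concurrenceForm *
        (QCircuit.toMatrix C * firstColumns 1 2)) c c' = w * p (c 0) (c' 0) := by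
  have h0 : ∀ (M : Matrix (BitString 2) (BitString 2) ℂ) c c',
      ((M * firstColumns 1 2)ᵀ * concurrenceForm * (M * firstColumns 1 2)) c c' =
        (Mᵀ * concurrenceForm * M) (padZero 2 c) (padZero 2 c') := by
    intro M c c'
    rw [mul_firstColumns]
    rfl
  have h1 : ∀ c : BitString 1, padZero 2 c 0 = c 0 := fun c => rfl
  have h2 : ∀ c : BitString 1, padZero 2 c 1 = 0 := fun c => rfl
  simp only [h0]
  rcases isLocal_or_exists_of_cnotCount_le_one hC with
    ⟨a, d, ha, hd, h⟩ | ⟨M, N, c, t, hct, ⟨a, d, ha, hd, rfl⟩, ⟨a', d', ha', hd', rfl⟩, h⟩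
  · refine ⟨0, 1, by simp, fun c c' => ?_⟩
    rw [h, transpose_mul_concurrenceForm_mul]
    simp [concurrenceForm, localMatrix, h2, qubitForm]
  · obtain ⟨p, q, hp, hpq⟩ := cnotMatrix_transpose_mul_concurrenceForm_mul hct
    refine ⟨a.det * d.det * (d'ᵀ * q * d') 0 0, a'ᵀ * p * a', ?_, fun e e' => ?_⟩
    · rw [Matrix.det_mul, Matrix.det_mul, Matrix.det_transpose]
      exact mul_ne_zero (mul_ne_zero ha' hp) ha'
    · have h3 : (localMatrix a d * cnotMatrix c t * localMatrix a' d')ᵀ * concurrenceForm *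
          (localMatrix a d * cnotMatrix c t * localMatrix a' d') =
          (localMatrix a' d')ᵀ * ((cnotMatrix c t)ᵀ * ((localMatrix a d)ᵀ * concurrenceForm *
            localMatrix a d) * cnotMatrix c t) * localMatrix a' d' := by
        simp only [Matrix.transpose_mul, Matrix.mul_assoc]
      rw [h, h3, transpose_mul_concurrenceForm_mul, Matrix.mul_smul, Matrix.smul_mul, hpq,
        Matrix.mul_smul, Matrix.smul_mul, localMatrix_transpose, localMatrix_mul, localMatrix_mul]
      simp only [Matrix.smul_apply, localMatrix, Matrix.of_apply, h1, h2, smul_eq_mul]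
      ring

/-- The isometry with `|0⟩ ↦ |00⟩` and `|1⟩ ↦ (|01⟩ + |10⟩) / √2`. -/
noncomputable def symmetricIsometry : Matrix (BitString 2) (BitString 1) ℂ :=
  Matrix.of fun b c => if c 0 = 0 then (if b 0 = 0 ∧ b 1 = 0 then 1 else 0)
    else if b 0 = b 1 then 0 else ((√2 : ℝ) : ℂ)⁻¹

theorem isQubitIsometry_symmetricIsometry : IsQubitIsometry symmetricIsometry := by
  have h := sqrt_two_inv_mul_self
  ext c c'
  have hc : c = c' ↔ c 0 = c' 0 := by
    rw [funext_iff, Fin.forall_fin_one]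
  rw [Matrix.mul_apply, sum_bitString_two, Matrix.one_apply]
  simp only [hc, symmetricIsometry, Matrix.conjTranspose_apply, Matrix.of_apply]
  generalize c 0 = x
  generalize c' 0 = x'
  fin_cases x <;> fin_cases x' <;> simp [Fin.sum_univ_two]
  rw [h]
  norm_num

theorem two_le_cnotCount {C : QCircuit 2} (hC : QCircuit.Implements C symmetricIsometry) :
    2 ≤ QCircuit.cnotCount C := by
  by_contra hlt
  obtain ⟨w, p, hp, h⟩ := exists_form_of_cnotCount_le_one (C := C) (by omega)
  obtain ⟨z, hz, hCz⟩ := hC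
  have hs := sqrt_two_inv_mul_self
  have hz0 : z ≠ 0 := fun h => by simp [h] at hz
  rw [hCz] at h
  -- The isometry pulls the form back to one whose only nonzero entry is -1, at the input 1. Being
  -- nonzero it forces `w ≠ 0`; being singular it then forces `det p = 0`.
  have h1 : ∀ c c' : BitString 1, z * z * (if c 0 = 1 ∧ c' 0 = 1 then -1 else 0) =
      w * p (c 0) (c' 0) := by
    intro c c'
    rw [← h c c', Matrix.transpose_smul, Matrix.smul_mul, Matrix.smul_mul, Matrix.mul_smul,
      smul_smul, Matrix.smul_apply, smul_eq_mul]
    congr 1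
    rw [Matrix.mul_apply]
    simp only [Matrix.mul_apply, sum_bitString_two, symmetricIsometry, concurrenceForm, localMatrix,
      qubitForm, Matrix.of_apply, Matrix.transpose_apply]
    generalize c 0 = x
    generalize c' 0 = x'
    fin_cases x <;> fin_cases x' <;> simp [Fin.sum_univ_two]
    rw [hs]
    norm_num
  have h00 := h1 (fun _ => 0) (fun _ => 0)
  have h01 := h1 (fun _ => 0) (fun _ => 1)
  have h11 := h1 (fun _ => 1) (fun _ => 1)
  simp at h00 h01 h11
  have hw : w ≠ 0 := by
    rintro rfl
    simp [hz0] at h11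
  apply hp
  rw [Matrix.det_fin_two, h00.resolve_left hw, h01.resolve_left hw]
  ring

theorem two_le_of_cnotsSuffice {r : ℕ} (h : CnotsSuffice 1 2 r) : 2 ≤ r := by
  obtain ⟨T, hT, h⟩ := h
  obtain ⟨C, hC, hCV⟩ := h _ isQubitIsometry_symmetricIsometry
  refine (two_le_cnotCount hCV).trans ?_
  rwa [QCircuit.cnotCount, hC]

theorem cnotLowerBound_one_two : cnotLowerBound 1 2 = 2 := by
  rw [cnotLowerBound, Int.ceil_eq_iff]
  norm_num

end LowerBound
-- Assembly of the table.
theorem mainTheorem9 :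
    -- two-qubit outputs, m = 0, 1, 2
    (CnotsSuffice 0 2 1 ∧ CnotsSuffice 1 2 2 ∧ CnotsSuffice 2 2 3) ∧
    -- three-qubit outputs, m = 0, 1, 2, 3
    (CnotsSuffice 0 3 3 ∧ CnotsSuffice 1 3 9 ∧ CnotsSuffice 2 3 14 ∧ CnotsSuffice 3 3 20) ∧
    -- four-qubit outputs, m = 0, 1, 2, 3, 4
    (CnotsSuffice 0 4 8 ∧ CnotsSuffice 1 4 22 ∧ CnotsSuffice 2 4 54 ∧ CnotsSuffice 3 4 73 ∧
      CnotsSuffice 4 4 100) ∧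
    -- the count for 1 to 2 isometries meets the lower bound and is optimal
    (cnotLowerBound 1 2 = 2 ∧
      IsLeast {r : ℕ | CnotsSuffice 1 2 r} 2 ∧
      ∃ V : Matrix (BitString 2) (BitString 1) ℂ, IsQubitIsometry V ∧
        ∀ C : QCircuit 2, QCircuit.Implements C V → 2 ≤ QCircuit.cnotCount C) := by
  have g11 : Generates 1 1 0 := generates_one
  have g22 : Generates 2 2 3 := generates_two
  have d22 : GeneratesUpToDiagonal 2 2 2 := generatesUpToDiagonal_two
  -- The leftover diagonal acts on the single input qubit and is therefore free.
  have g12 : Generates 1 2 (2 + 0) := d22.of_self.generates (by norm_num) g11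
  have g02 : Generates 0 2 1 :=
    generates_zero_add (k := 1) le_rfl g11.of_self g11.upToDiagonal g11
  have g03 : Generates 0 3 3 :=
    generates_zero_add (k := 2) (by norm_num) g11.of_self d22.of_self g11
  have g04 : Generates 0 4 8 := generates_zero_add (k := 2) le_rfl g02 d22 g22
  have g13 : Generates 1 3 9 := generates_succ (by norm_num) g11 d22.of_self d22
  have g23 : Generates 2 3 14 := generates_succ le_rfl g22 d22 d22
  have g33 : Generates 3 3 20 := Generates.succ d22 g22
  have d33 : GeneratesUpToDiagonal 3 3 19 := d22.succ
  have g14 : Generates 1 4 22 := generates_one_four g23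
  -- The count is 19 + 8 + (14 + 3 + 3) = 47, which is below the tabulated 54.
  have g24 : Generates 2 4 47 := generates_succ (by norm_num) g22 g23.upToDiagonal d33
  have g34 : Generates 3 4 73 := generates_succ le_rfl g33 d33 d33
  have g44 : Generates 4 4 100 := Generates.succ d33 g33
  have c12 : CnotsSuffice 1 2 2 := g12.cnotsSuffice (by norm_num)
  exact ⟨⟨g02.cnotsSuffice (by norm_num), c12, g22.cnotsSuffice le_rfl⟩,
    ⟨g03.cnotsSuffice (by norm_num), g13.cnotsSuffice (by norm_num),
      g23.cnotsSuffice (by norm_num), g33.cnotsSuffice le_rfl⟩,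
    ⟨g04.cnotsSuffice (by norm_num), g14.cnotsSuffice (by norm_num),
      (g24.mono (by norm_num)).cnotsSuffice (by norm_num), g34.cnotsSuffice (by norm_num),
      g44.cnotsSuffice le_rfl⟩,
    cnotLowerBound_one_two, ⟨c12, fun _ h => two_le_of_cnotsSuffice h⟩,
    symmetricIsometry, isQubitIsometry_symmetricIsometry, fun _ h => two_le_cnotCount h⟩
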